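/- Let $k$ be an algebraically closed field, $Q$ a finite quiver and $I\subseteq kQ$ an admissible ideal generated by paths of length two, such that $(Q,I)$ is gentle (at most two arrows start and at most two arrows end at each vertex; for each arrow $a$ there is at most one arrow $b$ with $ba\notin I$, at most one arrow $c$ with $ac\notin I$, at most one arrow $b$ starting where $a$ ends with $ba\in I$, and at most one arrow $c$ ending where $a$ starts with $ac\in I$). Let $\Lambda$ be a $k$-algebra Morita equivalent to $kQ/I$. Paths are read from right to left, modules are left modules, and for a vertex $x$ let $P(x)$ be the projective $\Lambda$-module corresponding to $(kQ/I)e_x$; a path $p$ from $y$ to $x$ gives by right multiplication a map $p\colon P(x)\to P(y)$. A (possibly infinite) homotopy string is a walk $\sigma$, decomposed into homotopy letters $\cdots\sigma_{i+1}\sigma_i\sigma_{i-1}\cdots$, where $\sigma_i$ joins a vertex $x_i$ (on its left) to a vertex $x_{i-1}$ (on its right): each $\sigma_i$ is a nontrivial path from $x_{i-1}$ to $x_i$ without subpath in $I$ (a direct letter) or the formal inverse of such a path from $x_i$ to $x_{i-1}$ (an inverse letter); two consecutive letters of the same direction meet in a relation of $I$, and two consecutive letters of different directions do not cancel ($a\bar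 a$ and $\bar a a$ do not occur). If $\sigma$ is infinite to the left, then all letters far to the left are direct and consist of one arrow; if it is infinite to the right, then all letters far to the right are inverse and consist of one inverse arrow. Its string complex $P^\bullet_\sigma$ is the sum of the $P(x_i)$, placed in suitable cohomological degrees, with differential given by the maps $\sigma_i\colon P(x_i)\to P(x_{i-1})$ for $\sigma_i$ direct and $\bar\sigma_i\colon P(x_{i-1})\to P(x_i)$ for $\sigma_i$ inverse. Let $\sigma=\beta\sigma_L\sigma_C\sigma_R\alpha$ and $\tau=\delta\tau_L\tau_C\tau_R\gamma$ be homotopy strings, where $\sigma_C,\tau_C$ are direct homotopy letters, $\sigma_L,\sigma_R,\tau_L,\tau_R$ are homotopy letters, each of them possibly missing (then the adjacent one of $\beta,\alpha,\delta,\gamma$ is missing too), and $\alpha,\beta,\gamma,\delta$ are the (possibly empty or infinite) remaining parts. Let $f^\bullet\colon P^\bullet_\sigma\to P^\bullet_\tau$ be a double map with components $(f_L,f_R)$, that is: $\sigma_C$ and $\tau_C$ lie in the same cohomological degrees; $f_L$ is a map from the projective at the left end of $\sigma_C$ to the one at the left end of $\tau_C$ and $f_R$ one from the projective at the right end of $\sigma_C$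 to the one at the right end of $\tau_C$, both given by nontrivial paths without subpath in $I$; $f_L\tau_C=\sigma_Cf_R$ is a path without subpath in $I$; and (as far as the letters exist) * (L1) $\sigma_L$ is inverse, or $\sigma_L$ is direct and $\sigma_Lf_L$ has a subpath in $I$; * (L2) $\tau_L$ is direct, or $\tau_L$ is inverse and $f_L\bar\tau_L$ has a subpath in $I$; * (R1) $\sigma_R$ is direct, or $\sigma_R$ is inverse and $\bar\sigma_Rf_R$ has a subpath in $I$; * (R2) $\tau_R$ is inverse, or $\tau_R$ is direct and $f_R\tau_R$ has a subpath in $I$; and all other components of $f^\bullet$ are zero. Suppose that $f^\bullet$ is not null-homotopic. **Theorem.** The words $$c_1=\bar\gamma\,\bar\tau_R\,\bar f_R\,\sigma_R\,\alpha\qquad\text{and}\qquad c_2=\beta\,\sigma_L\,f_L\,\bar\tau_L\,\bar\delta$$ are homotopy strings (with $\bar f_R$ and $f_L$ as homotopy letters), and the mapping cone $M^\bullet_{f^\bullet}$, with $M^n=P^{n+1}_\sigma\oplus P^n_\tau$, is isomorphic to $P^\bullet_{c_1}\oplus P^\bullet_{c_2}$ in the homotopy category of complexes. Here the vertices of $c_1$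 and $c_2$ that come from $\sigma$ are placed one degree lower than in $P^\bullet_\sigma$ and those that come from $\tau$ in the same degree as in $P^\bullet_\tau$. -/

import Mathlib

open CategoryTheory

universe u

noncomputable section

namespace GentleAlg

/-! ### The path algebra of a quiver and gentle ideals -/

section PathAlgebra

variable (k : Type u) [Field k] (Q : Type u) [Quiver.{u} Q]

/-- The `k`-vector space on all paths of `Q` (including the trivial ones); with the
multiplication below it is the path algebra `kQ`. -/
def PathAlgebra : Type u := (Σ x y : Q, Quiver.Path x y) →₀ k

instance : AddCommGroup (PathAlgebra k Q) :=
  inferInstanceAs (AddCommGroup ((Σ x y : Q, Quiver.Path x y) →₀ k))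

instance : Module k (PathAlgebra k Q) :=
  inferInstanceAs (Module k ((Σ x y : Q, Quiver.Path x y) →₀ k))

namespace PathAlgebra

variable {Q}

/-- The basis element of `kQ` given by a path. -/
def ofPath {x y : Q} (p : Quiver.Path x y) : PathAlgebra k Q :=
  Finsupp.single (⟨x, y, p⟩ : Σ x y : Q, Quiver.Path x y) (1 : k)

open Classical in
/-- The product `p q` of two paths: first `q`, then `p` (paths are read from right to left);
it is zero if the two paths cannot be composed. -/
def basisMul (p q : Σ x y : Q, Quiver.Path x y) : PathAlgebra k Q :=
  if h : q.2.1 = p.1 then ofPath k ((q.2.2.cast rfl h).comp p.2.2) else 0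

/-- The bilinear extension of the product of paths. -/
def mulHom : PathAlgebra k Q →ₗ[k] PathAlgebra k Q →ₗ[k] PathAlgebra k Q :=
  Finsupp.linearCombination k fun p => Finsupp.linearCombination k fun q => basisMul k p q

instance : Mul (PathAlgebra k Q) := ⟨fun f g => mulHom k f g⟩

theorem mul_def (f g : PathAlgebra k Q) : f * g = mulHom k f g := rfl

variable {k} in
theorem induction_linear {motive : PathAlgebra k Q → Prop} (f : PathAlgebra k Q)
    (zero : motive 0) (add : ∀ f g, motive f → motive g → motive (f + g))
    (basis : ∀ (c : k) {x y : Q} (p : Quiver.Path x y), motive (c • ofPath k p)) : motive f := by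
  refine Finsupp.induction_linear f zero add ?_
  rintro ⟨x, y, p⟩ c
  have h := basis c p
  have e : c • ofPath k p = Finsupp.single (⟨x, y, p⟩ : Σ x y : Q, Quiver.Path x y) c := by
    unfold ofPath
    exact (Finsupp.smul_single c _ _).trans (by simp)
  rwa [e] at h

theorem ofPath_mul_ofPath {x y x' y' : Q} (p : Quiver.Path x y) (q : Quiver.Path x' y') :
    ofPath k p * ofPath k q = basisMul k ⟨x, y, p⟩ ⟨x', y', q⟩ := by
  have h1 : mulHom k (ofPath k p) =
      Finsupp.linearCombination k fun q => basisMul k ⟨x, y, p⟩ q := by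
    unfold mulHom ofPath
    exact (Finsupp.linearCombination_single k _ _).trans (one_smul _ _)
  rw [mul_def, h1]
  exact (Finsupp.linearCombination_single k _ _).trans (one_smul _ _)

theorem ofPath_mul_comp {x y z : Q} (p : Quiver.Path y z) (q : Quiver.Path x y) :
    ofPath k p * ofPath k q = ofPath k (q.comp p) := by
  rw [ofPath_mul_ofPath]
  simp [basisMul]

theorem ofPath_mul_of_ne {x y x' y' : Q} (p : Quiver.Path x y) (q : Quiver.Path x' y')
    (h : y' ≠ x) : ofPath k p * ofPath k q = 0 := by
  rw [ofPath_mul_ofPath]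
  simp [basisMul, h]

variable {k} in
theorem add_mul' (f g h : PathAlgebra k Q) : (f + g) * h = f * h + g * h := by
  simp [mul_def]

variable {k} in
theorem mul_add' (f g h : PathAlgebra k Q) : f * (g + h) = f * g + f * h := by
  simp [mul_def]

variable {k} in
theorem zero_mul' (f : PathAlgebra k Q) : 0 * f = 0 := by simp [mul_def]

variable {k} in
theorem mul_zero' (f : PathAlgebra k Q) : f * 0 = 0 := by simp [mul_def]

variable {k} in
theorem smul_mul' (c : k) (f g : PathAlgebra k Q) : (c • f) * g = c • (f * g) := by
  simp [mul_def]

variable {k} in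
theorem mul_smul' (c : k) (f g : PathAlgebra k Q) : f * (c • g) = c • (f * g) := by
  simp [mul_def]

theorem ofPath_mul_assoc {x y x' y' x'' y'' : Q} (p : Quiver.Path x y) (q : Quiver.Path x' y')
    (r : Quiver.Path x'' y'') :
    ofPath k p * ofPath k q * ofPath k r = ofPath k p * (ofPath k q * ofPath k r) := by
  by_cases h1 : y' = x
  · subst h1
    by_cases h2 : y'' = x'
    · subst h2
      simp [ofPath_mul_comp, Quiver.Path.comp_assoc]
    · rw [ofPath_mul_comp, ofPath_mul_of_ne k _ r h2, ofPath_mul_of_ne k _ r h2, mul_zero']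
  · rw [ofPath_mul_of_ne k p q h1, zero_mul']
    by_cases h2 : y'' = x'
    · subst h2
      rw [ofPath_mul_comp, ofPath_mul_of_ne k _ _ h1]
    · rw [ofPath_mul_of_ne k _ r h2, mul_zero']

variable {k} in
theorem mul_assoc' (f g h : PathAlgebra k Q) : f * g * h = f * (g * h) := by
  induction f using induction_linear with
  | zero => simp [zero_mul']
  | add f f' hf hf' => simp [add_mul', hf, hf']
  | basis c p =>
    induction g using induction_linear with
    | zero => simp [zero_mul', mul_zero']
    | add g g' hg hg' => simp only [add_mul', mul_add', hg, hg']
    | basis d q =>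
      induction h using induction_linear with
      | zero => simp [mul_zero']
      | add h h' hh hh' => simp only [mul_add', hh, hh']
      | basis e r => simp only [smul_mul', mul_smul', ofPath_mul_assoc]

variable [Fintype Q]

/-- The unit of `kQ` is the sum of the trivial paths. -/
instance : One (PathAlgebra k Q) := ⟨∑ x : Q, ofPath k (Quiver.Path.nil : Quiver.Path x x)⟩

theorem one_def :
    (1 : PathAlgebra k Q) = ∑ x : Q, ofPath k (Quiver.Path.nil : Quiver.Path x x) := rfl

variable {k} in
theorem one_mul' (f : PathAlgebra k Q) : 1 * f = f := by
  induction f using induction_linear with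
  | zero => exact mul_zero' _
  | add f f' hf hf' => rw [mul_add', hf, hf']
  | @basis c x y p =>
    rw [mul_smul', one_def, mul_def, map_sum, LinearMap.sum_apply,
      Finset.sum_eq_single y]
    · rw [← mul_def, ofPath_mul_comp, Quiver.Path.comp_nil]
    · intro z _ hz
      rw [← mul_def, ofPath_mul_of_ne k _ _ (Ne.symm hz)]
    · simp

variable {k} in
theorem mul_one' (f : PathAlgebra k Q) : f * 1 = f := by
  induction f using induction_linear with
  | zero => exact zero_mul' _
  | add f f' hf hf' => rw [add_mul', hf, hf']
  | @basis c x y p =>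
    rw [smul_mul', one_def, mul_def, map_sum, Finset.sum_eq_single x]
    · rw [← mul_def, ofPath_mul_comp, Quiver.Path.nil_comp]
    · intro z _ hz
      rw [← mul_def, ofPath_mul_of_ne k _ _ hz]
    · simp

instance : Ring (PathAlgebra k Q) :=
  { (inferInstance : AddCommGroup (PathAlgebra k Q)) with
    mul := (· * ·)
    one := 1
    left_distrib := mul_add'
    right_distrib := add_mul'
    zero_mul := zero_mul'
    mul_zero := mul_zero'
    mul_assoc := mul_assoc'
    one_mul := one_mul'
    mul_one := mul_one' }

instance : Algebra k (PathAlgebra k Q) := Algebra.ofModule smul_mul' mul_smul'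

/-- The element of `kQ` given by an arrow. -/
def arrow (a : Quiver.Total Q) : PathAlgebra k Q := ofPath k a.hom.toPath

/-- The element of `kQ` given by a word `[a_n, …, a_1]` of arrows, i.e. `a_n ⋯ a_1`. -/
def word (l : List (Quiver.Total Q)) : PathAlgebra k Q := (l.map (arrow k)).prod

end PathAlgebra

end PathAlgebra

section Gentle

variable {k : Type u} [Field k] {Q : Type u} [Quiver.{u} Q] [Fintype Q]

open PathAlgebra

/-- `I` is an admissible ideal: `J ^ m ⊆ I ⊆ J ^ 2` for some `m ≥ 2`, where `J` is the ideal of `kQ`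
generated by the arrows, so that `J ^ m` is the span of the paths of length at least `m`. -/
def IsAdmissible (I : TwoSidedIdeal (PathAlgebra k Q)) : Prop :=
  (∃ m : ℕ, 2 ≤ m ∧ ∀ (x y : Q) (p : Quiver.Path x y), m ≤ p.length → ofPath k p ∈ I) ∧
  ∀ f ∈ I, f ∈ Submodule.span k
    {g : PathAlgebra k Q | ∃ (x y : Q) (p : Quiver.Path x y), 2 ≤ p.length ∧ g = ofPath k p}

/-- The conditions on a (finite) quiver `Q` and an ideal `I` for `kQ/I` to be gentle. -/
structure IsGentle (I : TwoSidedIdeal (PathAlgebra k Q)) : Prop where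
  admissible : IsAdmissible I
  starting : ∀ x : Q, {a : Quiver.Total Q | a.left = x}.encard ≤ 2
  ending : ∀ x : Q, {a : Quiver.Total Q | a.right = x}.encard ≤ 2
  left_unique : ∀ a b b' : Quiver.Total Q,
    arrow k b * arrow k a ∉ I → arrow k b' * arrow k a ∉ I → b = b'
  right_unique : ∀ a c c' : Quiver.Total Q,
    arrow k a * arrow k c ∉ I → arrow k a * arrow k c' ∉ I → c = c'
  left_unique_rel : ∀ a b b' : Quiver.Total Q, b.left = a.right → b'.left = a.right →
    arrow k b * arrow k a ∈ I → arrow k b' * arrow k a ∈ I → b = b'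
  right_unique_rel : ∀ a c c' : Quiver.Total Q, c.right = a.left → c'.right = a.left →
    arrow k a * arrow k c ∈ I → arrow k a * arrow k c' ∈ I → c = c'
  monomial : ∃ R : Set (Quiver.Total Q × Quiver.Total Q), (∀ r ∈ R, r.1.left = r.2.right) ∧
    I = TwoSidedIdeal.span {f | ∃ r ∈ R, f = arrow k r.1 * arrow k r.2}

/-- The bound quiver algebra `kQ/I`. -/
abbrev BoundAlgebra (I : TwoSidedIdeal (PathAlgebra k Q)) : Type u :=
  I.ringCon.Quotient

/-- The class in `kQ/I` of a word of arrows. -/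
def cls (I : TwoSidedIdeal (PathAlgebra k Q)) (l : List (Quiver.Total Q)) : BoundAlgebra I :=
  I.ringCon.mk' (word k l)

/-- The idempotent of `kQ/I` at a vertex. -/
def idem (I : TwoSidedIdeal (PathAlgebra k Q)) (x : Q) : BoundAlgebra I :=
  I.ringCon.mk' (ofPath k (Quiver.Path.nil : Quiver.Path x x))

/-- The indecomposable projective left module `P(x) = (kQ/I) e_x`. -/
def proj (I : TwoSidedIdeal (PathAlgebra k Q)) (x : Q) : Ideal (BoundAlgebra I) :=
  Ideal.span {idem I x}

theorem cls_append (I : TwoSidedIdeal (PathAlgebra k Q)) (l l' : List (Quiver.Total Q)) :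
    cls I (l ++ l') = cls I l * cls I l' := by
  simp [cls, word]

theorem cls_eq_zero (I : TwoSidedIdeal (PathAlgebra k Q)) {l : List (Quiver.Total Q)}
    (h : word k l ∈ I) : cls I l = 0 := by
  have h' : word k l ∈ TwoSidedIdeal.ker I.ringCon.mk' := by
    rwa [TwoSidedIdeal.ker_ringCon_mk']
  exact (TwoSidedIdeal.mem_ker _).1 h'

end Gentle

/-! ### Homotopy strings -/

section Strings

variable {Q : Type u} [Quiver.{u} Q]

/-- `IsPath l x y`: the word `l = [a_n, …, a_1]` is a path `a_n ⋯ a_1` of `Q` that starts in `x`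
and ends in `y` (read from right to left). -/
def IsPath : List (Quiver.Total Q) → Q → Q → Prop
  | [], x, y => x = y
  | a :: l, x, y => a.right = y ∧ IsPath l x a.left

/-- `IsPathIn I l x y`: the word `l` is a nontrivial path from `x` to `y` in `(Q, I)`, i.e. without
subpath in `I`. -/
def IsPathIn {k : Type u} [Field k] [Fintype Q] (I : TwoSidedIdeal (PathAlgebra k Q))
    (l : List (Quiver.Total Q)) (x y : Q) : Prop :=
  l ≠ [] ∧ IsPath l x y ∧ PathAlgebra.word k l ∉ I

variable (Q) in
/-- A letter: a path `p` (a direct letter) or its formal inverse `p̄` (an inverse letter). -/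
inductive Letter : Type u
  | direct (p : List (Quiver.Total Q))
  | inverse (p : List (Quiver.Total Q))

namespace Letter

/-- The path underlying a letter. -/
def path : Letter Q → List (Quiver.Total Q)
  | direct p => p
  | inverse p => p

/-- The letter is direct. -/
def IsDirect : Letter Q → Prop
  | direct _ => True
  | inverse _ => False

/-- The letter is inverse. -/
def IsInverse : Letter Q → Prop
  | direct _ => False
  | inverse _ => True

theorem not_direct_inverse {ℓ : Letter Q} (h : ℓ.IsDirect) (h' : ℓ.IsInverse) : False := by
  cases ℓ
  · exact h'
  · exact h

/-- The formal inverse of a letter. -/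
def inv : Letter Q → Letter Q
  | direct p => inverse p
  | inverse p => direct p

variable {k : Type u} [Field k] [Fintype Q] (I : TwoSidedIdeal (PathAlgebra k Q))

/-- `ℓ` is a homotopy letter with left end `y` and right end `x`: either a direct one, i.e. a
nontrivial path in `(Q, I)` from `x` to `y`, or the inverse of a nontrivial path in `(Q, I)` from
`y` to `x`. -/
def Joins (y x : Q) : Letter Q → Prop
  | direct p => IsPathIn I p x y
  | inverse p => IsPathIn I p y x

/-- The condition for the (composable) letters `ℓ' ℓ` to be consecutive homotopy letters of a
walk: at the junction there is a relation if they have the same direction, and no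
cancellation `a ā` or `ā a` if they have different directions. -/
def Junction : Letter Q → Letter Q → Prop
  | direct p', direct p => ∃ b a, p'.getLast? = some b ∧ p.head? = some a ∧
      PathAlgebra.arrow k b * PathAlgebra.arrow k a ∈ I
  | inverse p', inverse p => ∃ b a, p.getLast? = some b ∧ p'.head? = some a ∧
      PathAlgebra.arrow k b * PathAlgebra.arrow k a ∈ I
  | direct p', inverse p => p'.getLast? ≠ p.getLast?
  | inverse p', direct p => p'.head? ≠ p.head?

end Letter

variable (Q) in
/-- The data of a finite or infinite sequence of letters `⋯ σ_{i+1} σ_i σ_{i-1} ⋯` with a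
cohomological degree for each vertex of its unfolded diagram. The vertices of the unfolded diagram
are placed at the integers in `pos`, and the letter `σ_i` joins the vertex at `i`, on its left, to
the vertex at `i - 1`, on its right (if `i` and `i - 1` belong to `pos`; the values of the
functions elsewhere have no meaning). -/
structure GradedWalk : Type u where
  pos : Set ℤ
  vertex : ℤ → Q
  letter : ℤ → Letter Q
  deg : ℤ → ℤ

namespace GradedWalk

variable {k : Type u} [Field k] [Fintype Q] (I : TwoSidedIdeal (PathAlgebra k Q))

/-- `σ_i` is a letter of the walk. -/
def HasLetter (σ : GradedWalk Q) (i : ℤ) : Prop := i ∈ σ.pos ∧ i - 1 ∈ σ.pos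

/-- `σ` is a (graded) homotopy string, decomposed into its homotopy letters. A single vertex gives
a trivial homotopy string. A homotopy string that is infinite to the left is a direct antipath far
to the left, and one that is infinite to the right is an inverse antipath far to the right. The
degree goes up by one along the differential of the string complex. -/
structure IsHomotopyString (σ : GradedWalk Q) : Prop where
  nonempty : σ.pos.Nonempty
  ordConnected : σ.pos.OrdConnected
  joins : ∀ i, σ.HasLetter i → (σ.letter i).Joins I (σ.vertex i) (σ.vertex (i - 1))
  junction : ∀ i, σ.HasLetter (i + 1) → σ.HasLetter i →
    Letter.Junction I (σ.letter (i + 1)) (σ.letter i)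
  left_infinite : ¬ BddAbove σ.pos →
    ∃ m, ∀ i, m ≤ i → (σ.letter i).IsDirect ∧ (σ.letter i).path.length = 1
  right_infinite : ¬ BddBelow σ.pos →
    ∃ m, ∀ i, i ≤ m → (σ.letter i).IsInverse ∧ (σ.letter i).path.length = 1
  deg_direct : ∀ i, σ.HasLetter i → (σ.letter i).IsDirect → σ.deg (i - 1) = σ.deg i + 1
  deg_inverse : ∀ i, σ.HasLetter i → (σ.letter i).IsInverse → σ.deg i = σ.deg (i - 1) + 1

/-- The inverse walk `σ̄`; the vertex at `i` is placed at `-i`. -/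
def inv (σ : GradedWalk Q) : GradedWalk Q where
  pos := {i | -i ∈ σ.pos}
  vertex i := σ.vertex (-i)
  letter i := (σ.letter (1 - i)).inv
  deg i := σ.deg (-i)

/-- The same walk with all degrees raised by `n`. -/
def raise (σ : GradedWalk Q) (n : ℤ) : GradedWalk Q where
  pos := σ.pos
  vertex := σ.vertex
  letter := σ.letter
  deg i := σ.deg i + n

/-- The walk `σ' ℓ τ'`, where `σ'` is the part of `σ` to the left of its vertex at `a` (this vertex
included) and `τ'` is the part of `τ` to the right of its vertex at `b` (this vertex included). The
vertex of `σ` at `a` is placed at `1` and the vertex of `τ` at `b` is placed at `0`. -/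
def splice (σ : GradedWalk Q) (a : ℤ) (ℓ : Letter Q) (τ : GradedWalk Q) (b : ℤ) :
    GradedWalk Q where
  pos := {i | (1 ≤ i ∧ a + (i - 1) ∈ σ.pos) ∨ (i ≤ 0 ∧ b + i ∈ τ.pos)}
  vertex i := if 1 ≤ i then σ.vertex (a + (i - 1)) else τ.vertex (b + i)
  letter i := if 2 ≤ i then σ.letter (a + (i - 1)) else if i = 1 then ℓ else τ.letter (b + i)
  deg i := if 1 ≤ i then σ.deg (a + (i - 1)) else τ.deg (b + i)

end GradedWalk

end Strings

/-! ### String complexes -/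

section Complexes

variable {k : Type u} [Field k] {Q : Type u} [Quiver.{u} Q] [Fintype Q]
variable (I : TwoSidedIdeal (PathAlgebra k Q))

/-- Right multiplication by `p`, a homomorphism of left modules. -/
def rightMul (p : BoundAlgebra I) : BoundAlgebra I →ₗ[BoundAlgebra I] BoundAlgebra I :=
  LinearMap.toSpanSingleton (BoundAlgebra I) (BoundAlgebra I) p

@[simp]
theorem rightMul_apply (p u : BoundAlgebra I) : rightMul I p u = u * p := rfl

theorem vertex_mul_arrow_aux {l : List (Quiver.Total Q)} {x y : Q} (h : IsPath l x y)
    (hl : l ≠ []) : cls I l * idem I x = cls I l := by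
  induction l generalizing y with
  | nil => exact absurd rfl hl
  | cons a l ih =>
    obtain ⟨-, h2⟩ := h
    have e : cls I (a :: l) = cls I [a] * cls I l := cls_append I [a] l
    by_cases hl' : l = []
    · subst hl'
      have h2 : x = a.left := h2
      subst h2
      rw [cls, idem, ← map_mul]
      simp only [PathAlgebra.word, List.map_cons, List.map_nil, List.prod_cons, List.prod_nil,
        mul_one, PathAlgebra.arrow]
      rw [PathAlgebra.ofPath_mul_comp, Quiver.Path.nil_comp]
    · rw [e, mul_assoc, ih h2 hl']

theorem mul_cls_mem_proj {l : List (Quiver.Total Q)} {x y : Q} (h : IsPathIn I l x y)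
    (u : BoundAlgebra I) : u * cls I l ∈ proj I x := by
  rw [← vertex_mul_arrow_aux I h.2.1 h.1, ← mul_assoc]
  exact Ideal.mul_mem_left _ _ (Ideal.subset_span rfl)

namespace GradedWalk

/-- The component of degree `n` of the string complex, the direct sum of the `P(x_i)` over all
vertices `x_i` of degree `n`, as a submodule of the free module on `ℤ`: the elements with `i`-th
coordinate in `P(x_i)` that are supported on the positions of degree `n`. -/
def component (σ : GradedWalk Q) (n : ℤ) :
    Submodule (BoundAlgebra I) (ℤ →₀ BoundAlgebra I) where
  carrier := {f | ∀ i, f i ∈ proj I (σ.vertex i) ∧ (f i ≠ 0 → i ∈ σ.pos ∧ σ.deg i = n)}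
  zero_mem' := by simp
  add_mem' := by
    intro f g hf hg i
    refine ⟨add_mem (hf i).1 (hg i).1, fun h => ?_⟩
    by_cases h1 : f i = 0
    · by_cases h2 : g i = 0
      · simp [h1, h2] at h
      · exact (hg i).2 h2
    · exact (hf i).2 h1
  smul_mem' := by
    intro c f hf i
    refine ⟨Submodule.smul_mem _ c (hf i).1, fun h => (hf i).2 fun h0 => h ?_⟩
    simp [h0]

open Classical in
/-- The part of the differential that starts at the vertex `x_i`: right multiplication
`P(x_i) → P(x_{i-1})` by `σ_i` if this is a direct letter, plus right multiplication
`P(x_i) → P(x_{i+1})` by the path `p` if `σ_{i+1} = p̄` is an inverse letter. -/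
def outgoing (σ : GradedWalk Q) (i : ℤ) :
    BoundAlgebra I →ₗ[BoundAlgebra I] (ℤ →₀ BoundAlgebra I) :=
  (if σ.HasLetter i ∧ (σ.letter i).IsDirect then
    (Finsupp.lsingle (i - 1)).comp (rightMul I (cls I (σ.letter i).path)) else 0) +
  (if σ.HasLetter (i + 1) ∧ (σ.letter (i + 1)).IsInverse then
    (Finsupp.lsingle (i + 1)).comp (rightMul I (cls I (σ.letter (i + 1)).path)) else 0)

/-- The differential of the string complex, in all degrees at once. -/
def differential (σ : GradedWalk Q) :
    (ℤ →₀ BoundAlgebra I) →ₗ[BoundAlgebra I] (ℤ →₀ BoundAlgebra I) :=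
  Finsupp.lsum ℕ fun i => σ.outgoing I i

theorem single_mem_component (σ : GradedWalk Q) {n i : ℤ} (hi : i ∈ σ.pos) (hn : σ.deg i = n)
    {u : BoundAlgebra I} (hu : u ∈ proj I (σ.vertex i)) :
    Finsupp.single i u ∈ σ.component I n := by
  intro j
  by_cases h : i = j
  · subst h
    simpa [hi, hn] using hu
  · simp [Finsupp.single_eq_of_ne' h]

theorem map_mem_of_single (σ : GradedWalk Q) {n : ℤ}
    (L : (ℤ →₀ BoundAlgebra I) →ₗ[BoundAlgebra I] (ℤ →₀ BoundAlgebra I))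
    (N : Submodule (BoundAlgebra I) (ℤ →₀ BoundAlgebra I))
    (h : ∀ i u, i ∈ σ.pos → σ.deg i = n → L (Finsupp.single i u) ∈ N)
    (f : ℤ →₀ BoundAlgebra I) (hf : f ∈ σ.component I n) : L f ∈ N := by
  rw [← Finsupp.sum_single f, Finsupp.sum, map_sum]
  refine Submodule.sum_mem _ fun i hi => ?_
  obtain ⟨h1, h2⟩ := (hf i).2 (Finsupp.mem_support_iff.1 hi)
  exact h i _ h1 h2

theorem differential_single (σ : GradedWalk Q) (i : ℤ) (u : BoundAlgebra I) :
    σ.differential I (Finsupp.single i u) = σ.outgoing I i u := by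
  simp [differential]

variable {I}

theorem IsHomotopyString.direct {σ : GradedWalk Q} (hσ : σ.IsHomotopyString I) {i : ℤ}
    (h : σ.HasLetter i) (hd : (σ.letter i).IsDirect) :
    IsPathIn I (σ.letter i).path (σ.vertex (i - 1)) (σ.vertex i) := by
  have := hσ.joins i h
  revert this hd
  cases σ.letter i <;> simp [Letter.IsDirect, Letter.Joins, Letter.path]

theorem IsHomotopyString.inverse {σ : GradedWalk Q} (hσ : σ.IsHomotopyString I) {i : ℤ}
    (h : σ.HasLetter i) (hd : (σ.letter i).IsInverse) :
    IsPathIn I (σ.letter i).path (σ.vertex i) (σ.vertex (i - 1)) := by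
  have := hσ.joins i h
  revert this hd
  cases σ.letter i <;> simp [Letter.IsInverse, Letter.Joins, Letter.path]

theorem differential_mem {σ : GradedWalk Q} (hσ : σ.IsHomotopyString I) {n m : ℤ} (h : n + 1 = m)
    (f : ℤ →₀ BoundAlgebra I) (hf : f ∈ σ.component I n) :
    σ.differential I f ∈ σ.component I m := by
  refine map_mem_of_single I σ _ _ (fun i u _ hn => ?_) f hf
  rw [differential_single, outgoing, LinearMap.add_apply]
  refine add_mem ?_ ?_
  · split_ifs with hc
    · refine single_mem_component I σ hc.1.2 ?_ (mul_cls_mem_proj I (hσ.direct hc.1 hc.2) u)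
      rw [hσ.deg_direct i hc.1 hc.2]
      omega
    · exact zero_mem _
  · split_ifs with hc
    · refine single_mem_component I σ hc.1.1 ?_ (mul_cls_mem_proj I (hσ.inverse hc.1 hc.2) u)
      have := hσ.deg_inverse (i + 1) hc.1 hc.2
      rw [add_sub_cancel_right] at this
      omega
    · exact zero_mem _

theorem cls_mul_eq_zero {p q : List (Quiver.Total Q)} {b a : Quiver.Total Q}
    (hb : p.getLast? = some b) (ha : q.head? = some a)
    (h : PathAlgebra.arrow k b * PathAlgebra.arrow k a ∈ I) : cls I p * cls I q = 0 := by
  obtain ⟨p', rfl⟩ := List.getLast?_eq_some_iff.1 hb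
  obtain ⟨q', rfl⟩ := List.head?_eq_some_iff.1 ha
  have e : cls I [b] * cls I [a] = 0 := by
    rw [← cls_append]
    exact cls_eq_zero I (by simpa [PathAlgebra.word] using h)
  have e' : cls I (a :: q') = cls I [a] * cls I q' := cls_append I [a] q'
  rw [cls_append, e', mul_assoc, ← mul_assoc (cls I [b]), e, zero_mul, mul_zero]

theorem IsHomotopyString.direct_direct {σ : GradedWalk Q} (hσ : σ.IsHomotopyString I) {i : ℤ}
    (h' : σ.HasLetter (i + 1)) (h : σ.HasLetter i) (hd' : (σ.letter (i + 1)).IsDirect)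
    (hd : (σ.letter i).IsDirect) :
    cls I (σ.letter (i + 1)).path * cls I (σ.letter i).path = 0 := by
  have := hσ.junction i h' h
  revert this hd hd'
  cases σ.letter i <;> cases σ.letter (i + 1) <;>
    simp only [Letter.IsDirect, Letter.Junction, Letter.path, false_imp_iff, true_imp_iff,
      imp_true_iff]
  rintro ⟨b, a, hb, ha, hI⟩
  exact cls_mul_eq_zero hb ha hI

theorem IsHomotopyString.inverse_inverse {σ : GradedWalk Q} (hσ : σ.IsHomotopyString I) {i : ℤ}
    (h' : σ.HasLetter (i + 1)) (h : σ.HasLetter i) (hd' : (σ.letter (i + 1)).IsInverse)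
    (hd : (σ.letter i).IsInverse) :
    cls I (σ.letter i).path * cls I (σ.letter (i + 1)).path = 0 := by
  have := hσ.junction i h' h
  revert this hd hd'
  cases σ.letter i <;> cases σ.letter (i + 1) <;>
    simp only [Letter.IsInverse, Letter.Junction, Letter.path, false_imp_iff, true_imp_iff,
      imp_true_iff]
  rintro ⟨b, a, hb, ha, hI⟩
  exact cls_mul_eq_zero hb ha hI

open Classical in
theorem differential_differential {σ : GradedWalk Q} (hσ : σ.IsHomotopyString I)
    (f : ℤ →₀ BoundAlgebra I) : σ.differential I (σ.differential I f) = 0 := by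
  induction f using Finsupp.induction_linear with
  | zero => simp
  | add f g hf hg => simp [hf, hg]
  | single i u =>
    rw [differential_single, outgoing, LinearMap.add_apply, map_add]
    have h1 : σ.differential I ((if σ.HasLetter i ∧ (σ.letter i).IsDirect then
        (Finsupp.lsingle (i - 1)).comp (rightMul I (cls I (σ.letter i).path)) else 0) u) = 0 := by
      split_ifs with hc
      · rw [LinearMap.comp_apply, Finsupp.lsingle_apply, differential_single, outgoing,
          LinearMap.add_apply, sub_add_cancel,
          if_neg (fun h : σ.HasLetter i ∧ (σ.letter i).IsInverse =>
            Letter.not_direct_inverse hc.2 h.2), LinearMap.zero_apply, add_zero]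
        split_ifs with hc'
        · have := hσ.direct_direct (i := i - 1) (by simpa using hc.1) hc'.1
            (by simpa using hc.2) hc'.2
          rw [sub_add_cancel] at this
          simp [mul_assoc, this]
        · rfl
      · simp
    have h2 : σ.differential I ((if σ.HasLetter (i + 1) ∧ (σ.letter (i + 1)).IsInverse then
        (Finsupp.lsingle (i + 1)).comp (rightMul I (cls I (σ.letter (i + 1)).path))
        else 0) u) = 0 := by
      split_ifs with hc
      · rw [LinearMap.comp_apply, Finsupp.lsingle_apply, differential_single, outgoing,
          LinearMap.add_apply,
          if_neg (fun h : σ.HasLetter (i + 1) ∧ (σ.letter (i + 1)).IsDirect =>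
            Letter.not_direct_inverse h.2 hc.2), LinearMap.zero_apply, zero_add]
        split_ifs with hc'
        · have := hσ.inverse_inverse (i := i + 1) hc'.1 hc.1 hc'.2 hc.2
          simp [mul_assoc, this]
        · rfl
      · simp
    rw [h1, h2, add_zero]

/-- The string complex `P_σ` over `kQ/I` of a (graded) homotopy string `σ`. -/
def basicStringComplex (σ : GradedWalk Q) (hσ : σ.IsHomotopyString I) :
    CochainComplex (ModuleCat.{u} (BoundAlgebra I)) ℤ where
  X n := ModuleCat.of (BoundAlgebra I) (σ.component I n)
  d n m := if h : n + 1 = m then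
      ModuleCat.ofHom ((σ.differential I).restrict (differential_mem hσ h)) else 0
  shape n m h := dif_neg h
  d_comp_d' n m l h h' := by
    rw [dif_pos (show n + 1 = m from h), dif_pos (show m + 1 = l from h')]
    refine ModuleCat.hom_ext (LinearMap.ext fun f => Subtype.ext ?_)
    exact differential_differential hσ f.1

end GradedWalk

/-! ### Double maps -/

/-- The data of a double map from `σ` to `τ` with components `(f_L, f_R)`,
where `σ_C` is the letter of `σ` at `i` and `τ_C` is the letter of `τ` at `j`, so that the
letters `σ_L`, `σ_R`, `τ_L`, `τ_R` are at `i + 1`, `i - 1`, `j + 1` and `j - 1` (each of them may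
be missing). -/
structure IsDoubleMap (σ τ : GradedWalk Q) (i j : ℤ) (fL fR : List (Quiver.Total Q)) : Prop where
  letter_σ : σ.HasLetter i
  letter_τ : τ.HasLetter j
  direct_σ : (σ.letter i).IsDirect
  direct_τ : (τ.letter j).IsDirect
  deg_eq : σ.deg i = τ.deg j
  path_left : IsPathIn I fL (τ.vertex j) (σ.vertex i)
  path_right : IsPathIn I fR (τ.vertex (j - 1)) (σ.vertex (i - 1))
  comm : fL ++ (τ.letter j).path = (σ.letter i).path ++ fR
  comm_notMem : PathAlgebra.word k (fL ++ (τ.letter j).path) ∉ I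
  L1 : σ.HasLetter (i + 1) → (σ.letter (i + 1)).IsDirect →
    PathAlgebra.word k ((σ.letter (i + 1)).path ++ fL) ∈ I
  L2 : τ.HasLetter (j + 1) → (τ.letter (j + 1)).IsInverse →
    PathAlgebra.word k (fL ++ (τ.letter (j + 1)).path) ∈ I
  R1 : σ.HasLetter (i - 1) → (σ.letter (i - 1)).IsInverse →
    PathAlgebra.word k ((σ.letter (i - 1)).path ++ fR) ∈ I
  R2 : τ.HasLetter (j - 1) → (τ.letter (j - 1)).IsDirect →
    PathAlgebra.word k (fR ++ (τ.letter (j - 1)).path) ∈ I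

open Classical in
/-- The map with the two components `f_L : P(x_i) → P(y_j)` and `f_R : P(x_{i-1}) → P(y_{j-1})`, in
all degrees at once. -/
def twoComponents (i j : ℤ) (fL fR : List (Quiver.Total Q)) :
    (ℤ →₀ BoundAlgebra I) →ₗ[BoundAlgebra I] (ℤ →₀ BoundAlgebra I) :=
  Finsupp.lsum ℕ fun a =>
    if a = i then (Finsupp.lsingle j).comp (rightMul I (cls I fL))
    else if a = i - 1 then (Finsupp.lsingle (j - 1)).comp (rightMul I (cls I fR)) else 0

theorem twoComponents_left (i j : ℤ) (fL fR : List (Quiver.Total Q)) (u : BoundAlgebra I) :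
    twoComponents I i j fL fR (Finsupp.single i u) = Finsupp.single j (u * cls I fL) := by
  simp [twoComponents]

theorem twoComponents_right (i j : ℤ) (fL fR : List (Quiver.Total Q)) (u : BoundAlgebra I) :
    twoComponents I i j fL fR (Finsupp.single (i - 1) u) =
      Finsupp.single (j - 1) (u * cls I fR) := by
  simp [twoComponents]

theorem twoComponents_other (i j : ℤ) (fL fR : List (Quiver.Total Q)) (u : BoundAlgebra I) {a : ℤ}
    (h : a ≠ i) (h' : a ≠ i - 1) :
    twoComponents I i j fL fR (Finsupp.single a u) = 0 := by
  simp [twoComponents, h, h']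

variable {I}

namespace IsDoubleMap

open GradedWalk

variable {σ τ : GradedWalk Q} {i j : ℤ} {fL fR : List (Quiver.Total Q)}

theorem map_mem (hσ : σ.IsHomotopyString I) (hτ : τ.IsHomotopyString I)
    (hf : IsDoubleMap I σ τ i j fL fR) (n : ℤ)
    (f : ℤ →₀ BoundAlgebra I) (hm : f ∈ σ.component I n) :
    twoComponents I i j fL fR f ∈ τ.component I n := by
  refine map_mem_of_single I σ _ _ (fun a u _ hn => ?_) f hm
  by_cases h : a = i
  · subst h
    rw [twoComponents_left]
    exact single_mem_component I τ hf.letter_τ.1 (hf.deg_eq ▸ hn) (mul_cls_mem_proj I hf.path_left u)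
  · by_cases h' : a = i - 1
    · subst h'
      rw [twoComponents_right]
      refine single_mem_component I τ hf.letter_τ.2 ?_ (mul_cls_mem_proj I hf.path_right u)
      rw [hτ.deg_direct j hf.letter_τ hf.direct_τ, ← hf.deg_eq,
        ← hσ.deg_direct i hf.letter_σ hf.direct_σ, hn]
    · rw [twoComponents_other I i j fL fR u h h']
      exact zero_mem _

open Classical in
theorem map_comm (hf : IsDoubleMap I σ τ i j fL fR) (f : ℤ →₀ BoundAlgebra I) :
    τ.differential I (twoComponents I i j fL fR f) =
      twoComponents I i j fL fR (σ.differential I f) := by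
  induction f using Finsupp.induction_linear with
  | zero => simp
  | add f g hf hg => simp [hf, hg]
  | single a u =>
    have hout : ∀ (ρ : GradedWalk Q) (b : ℤ) (t : BoundAlgebra I), ρ.outgoing I b t =
        (if ρ.HasLetter b ∧ (ρ.letter b).IsDirect then
          Finsupp.single (b - 1) (t * cls I (ρ.letter b).path) else 0) +
        (if ρ.HasLetter (b + 1) ∧ (ρ.letter (b + 1)).IsInverse then
          Finsupp.single (b + 1) (t * cls I (ρ.letter (b + 1)).path) else 0) := by
      intro ρ b t
      rw [outgoing, LinearMap.add_apply]
      congr 1 <;> split_ifs <;> simp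
    rw [differential_single, hout, map_add]
    by_cases h : a = i
    · subst h
      have e : u * cls I fL * cls I (τ.letter j).path = u * cls I (σ.letter a).path * cls I fR := by
        rw [mul_assoc, mul_assoc, ← cls_append, ← cls_append, hf.comm]
      rw [twoComponents_left, differential_single, hout,
        if_pos (⟨hf.letter_τ, hf.direct_τ⟩ : τ.HasLetter j ∧ (τ.letter j).IsDirect),
        if_pos (⟨hf.letter_σ, hf.direct_σ⟩ : σ.HasLetter a ∧ (σ.letter a).IsDirect),
        twoComponents_right, e]
      congr 1
      have h1 : twoComponents I a j fL fR (if σ.HasLetter (a + 1) ∧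
          (σ.letter (a + 1)).IsInverse then
          Finsupp.single (a + 1) (u * cls I (σ.letter (a + 1)).path) else 0) = 0 := by
        split_ifs
        · exact twoComponents_other I _ _ _ _ _ (by omega) (by omega)
        · simp
      rw [h1]
      split_ifs with hc
      · rw [mul_assoc, ← cls_append, cls_eq_zero I (hf.L2 hc.1 hc.2), mul_zero,
          Finsupp.single_zero]
      · rfl
    · by_cases h' : a = i - 1
      · subst h'
        rw [twoComponents_right, differential_single, hout, sub_add_cancel, sub_add_cancel,
          if_neg (fun h : τ.HasLetter j ∧ (τ.letter j).IsInverse =>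
            Letter.not_direct_inverse hf.direct_τ h.2),
          if_neg (fun h : σ.HasLetter i ∧ (σ.letter i).IsInverse =>
            Letter.not_direct_inverse hf.direct_σ h.2), map_zero, add_zero, add_zero]
        have h1 : twoComponents I i j fL fR (if σ.HasLetter (i - 1) ∧
            (σ.letter (i - 1)).IsDirect then
            Finsupp.single (i - 1 - 1) (u * cls I (σ.letter (i - 1)).path) else 0) = 0 := by
          split_ifs
          · exact twoComponents_other I _ _ _ _ _ (by omega) (by omega)
          · simp
        rw [h1]
        split_ifs with hc
        · rw [mul_assoc, ← cls_append, cls_eq_zero I (hf.R2 hc.1 hc.2), mul_zero,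
            Finsupp.single_zero]
        · rfl
      · rw [twoComponents_other I i j fL fR u h h', map_zero]
        have h1 : twoComponents I i j fL fR (if σ.HasLetter a ∧ (σ.letter a).IsDirect then
            Finsupp.single (a - 1) (u * cls I (σ.letter a).path) else 0) = 0 := by
          split_ifs with hc
          · by_cases ha : a = i + 1
            · subst ha
              rw [add_sub_cancel_right, twoComponents_left, mul_assoc, ← cls_append,
                cls_eq_zero I (hf.L1 hc.1 hc.2), mul_zero, Finsupp.single_zero]
            · exact twoComponents_other I _ _ _ _ _ (by omega) (by omega)
          · simp
        have h2 : twoComponents I i j fL fR (if σ.HasLetter (a + 1) ∧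
            (σ.letter (a + 1)).IsInverse then
            Finsupp.single (a + 1) (u * cls I (σ.letter (a + 1)).path) else 0) = 0 := by
          split_ifs with hc
          · by_cases ha : a + 1 = i - 1
            · rw [ha] at hc ⊢
              rw [twoComponents_right, mul_assoc, ← cls_append,
                cls_eq_zero I (hf.R1 hc.1 hc.2), mul_zero, Finsupp.single_zero]
            · exact twoComponents_other I _ _ _ _ _ (by omega) ha
          · simp
        rw [h1, h2, add_zero]

/-- The double map `P_σ ⟶ P_τ` over `kQ/I` with components `(f_L, f_R)`. -/
def basicMap (hσ : σ.IsHomotopyString I) (hτ : τ.IsHomotopyString I)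
    (hf : IsDoubleMap I σ τ i j fL fR) :
    σ.basicStringComplex hσ ⟶ τ.basicStringComplex hτ where
  f n := ModuleCat.ofHom ((twoComponents I i j fL fR).restrict (hf.map_mem hσ hτ n))
  comm' n m h := by
    have h' : n + 1 = m := h
    simp only [basicStringComplex]
    rw [dif_pos h', dif_pos h']
    refine ModuleCat.hom_ext (LinearMap.ext fun f => Subtype.ext ?_)
    exact hf.map_comm f.1

end IsDoubleMap

/-! ### Transport to a gentle algebra that is Morita equivalent to `kQ/I` -/

section Morita

variable {A : Type u} [Ring A] [Algebra k A]

/-- The functor on complexes induced by a Morita equivalence between `kQ/I` and `A`. -/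
def moritaFunctor (E : MoritaEquivalence k (BoundAlgebra I) A) :
    CochainComplex (ModuleCat.{u} (BoundAlgebra I)) ℤ ⥤
      CochainComplex (ModuleCat.{u} A) ℤ :=
  E.eqv.functor.mapHomologicalComplex (ComplexShape.up ℤ)

/-- The string complex `P_σ` over `A`. -/
def stringComplex (E : MoritaEquivalence k (BoundAlgebra I) A) (σ : GradedWalk Q)
    (hσ : σ.IsHomotopyString I) : CochainComplex (ModuleCat.{u} A) ℤ :=
  (moritaFunctor E).obj (σ.basicStringComplex hσ)

/-- The double map `P_σ ⟶ P_τ` over `A` with components `(f_L, f_R)`. -/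
def doubleMap (E : MoritaEquivalence k (BoundAlgebra I) A) {σ τ : GradedWalk Q}
    (hσ : σ.IsHomotopyString I) (hτ : τ.IsHomotopyString I)
    {i j : ℤ} {fL fR : List (Quiver.Total Q)} (hf : IsDoubleMap I σ τ i j fL fR) :
    stringComplex E σ hσ ⟶ stringComplex E τ hτ :=
  (moritaFunctor E).map (hf.basicMap hσ hτ)

/-- The image of a complex in the homotopy category. It contains the homotopy category of right
bounded complexes of finitely generated projective modules with bounded cohomology as a full
subcategory, so that isomorphisms may be taken in either of them. -/
abbrev inHomotopyCategory (X : CochainComplex (ModuleCat.{u} A) ℤ) :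
    HomotopyCategory (ModuleCat.{u} A) (ComplexShape.up ℤ) :=
  (HomotopyCategory.quotient _ _).obj X

end Morita

/-- The walk `c₁ = γ̄ τ̄_R f̄_R σ_R α`, with its degrees in the mapping cone. -/
def cone₁ (σ τ : GradedWalk Q) (i j : ℤ) (fR : List (Quiver.Total Q)) : GradedWalk Q :=
  GradedWalk.splice τ.inv (-(j - 1)) (Letter.inverse fR) (σ.raise (-1)) (i - 1)

/-- The walk `c₂ = β σ_L f_L τ̄_L δ̄`, with its degrees in the mapping cone. -/
def cone₂ (σ τ : GradedWalk Q) (i j : ℤ) (fL : List (Quiver.Total Q)) : GradedWalk Q :=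
  GradedWalk.splice (σ.raise (-1)) i (Letter.direct fL) τ.inv (-j)

end Complexes

end GentleAlg

end

set_option linter.unusedSectionVars false

noncomputable section

namespace GentleAlg

/-! ### Words of arrows and membership in a gentle ideal -/

section Words

open PathAlgebra

variable {k : Type u} [Field k] {Q : Type u} [Quiver.{u} Q]

/-! Write x_m and y_m for the generators of P_σ and P_τ at position m. Together they generate the
cone, whose differential still contains σ_C and τ_C, two letters that occur neither in c₁ nor in c₂.
A change of basis has to remove them. Since f_L τ_C = σ_C f_R is a single path, comparing lengths
gives a possibly trivial path g with either σ_C = f_L g and τ_C = g f_R, or f_L = σ_C g and f_R = g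
τ_C.

Suppose first that σ_C = f_L g. Up to signs, the part of the cone differential of x_i coming from
σ_C and f_L is f_L (y_j - g x_{i-1}), and the new generator y_j - g x_{i-1} no longer reaches
y_{j-1}, because τ_C = g f_R. The correction has to be propagated: y_{j+t} is replaced by y_{j+t} -
c_t x_{i-1-t}, where c is a chain map, with c_0 = g, from the string complex of the part of τ to the
left of τ_C to that of the part of σ to the right of σ_C. This change of basis is triangular, so the
cone is isomorphic to the sum of the two string complexes as a complex, not only up to homotopy
(`IsDoubleMap.nonempty_biprod_iso_mappingCone`).

In the other case, a chain map in the opposite direction that starts with g becomes, with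
alternating signs, a null-homotopy of the double map (`IsDoubleMap.nonempty_homotopy_zero`), which
is excluded.

It remains to find c in one of the two directions (`IsDoubleMap.exists_isHalfMap`). If g is
nontrivial, the single coefficient g suffices, because its products with the adjacent letters
contain relations. If g is trivial, then σ_R α and τ̄_L δ̄ start at the same vertex after the same
letter. They are followed with coefficient 1 as long as their letters agree. At the first
disagreement gentleness leaves two possibilities: zero is a valid next coefficient in one direction,
or both letters have the same direction and one path extends the other, the difference being the
last nonzero coefficient (`IsMeeting.exists_isHalfMap`).

That c₁ and c₂ are homotopy strings is a check at the two ends of the new letter. It rests on the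
fact that the product of two paths in (Q, I) can only vanish through a relation at their junction
(`IsGentle.exists_rel`). -/

/-- The word `[a_n, …, a_1]` of arrows of a path `a_n ⋯ a_1`. -/
def pathWord : ∀ {x y : Q}, Quiver.Path x y → List (Quiver.Total Q)
  | _, _, .nil => []
  | _, _, .cons p e => ⟨_, _, e⟩ :: pathWord p

theorem pathWord_comp {x y z : Q} (q : Quiver.Path x y) (p : Quiver.Path y z) :
    pathWord (q.comp p) = pathWord p ++ pathWord q := by
  induction p with
  | nil => simp [pathWord]
  | cons p e ih => simp [pathWord, ih]

theorem IsPath.exists_path {l : List (Quiver.Total Q)} {x y : Q} (h : IsPath l x y) :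
    ∃ p : Quiver.Path x y, pathWord p = l := by
  induction l generalizing y with
  | nil =>
    have h' : x = y := h
    subst h'
    exact ⟨.nil, by simp [pathWord]⟩
  | cons a l ih =>
    obtain ⟨rfl, h2⟩ := h
    obtain ⟨p, hp⟩ := ih h2
    exact ⟨p.cons a.hom, by simp [pathWord, hp]⟩

theorem IsPath.append {l l' : List (Quiver.Total Q)} {x y z : Q} (h : IsPath l y z)
    (h' : IsPath l' x y) : IsPath (l ++ l') x z := by
  induction l generalizing z with
  | nil =>
    have e : y = z := h
    exact e ▸ h'
  | cons a l ih => exact ⟨h.1, ih h.2⟩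

theorem IsPath.exists_of_append {l l' : List (Quiver.Total Q)} {x z : Q}
    (h : IsPath (l ++ l') x z) : ∃ y, IsPath l y z ∧ IsPath l' x y := by
  induction l generalizing z with
  | nil => exact ⟨z, rfl, h⟩
  | cons a l ih =>
    obtain ⟨y, h1, h2⟩ := ih h.2
    exact ⟨y, ⟨h.1, h1⟩, h2⟩

theorem IsPath.right_eq {l : List (Quiver.Total Q)} {x y y' : Q} (h : IsPath l x y)
    (h' : IsPath l x y') (hl : l ≠ []) : y = y' := by
  cases l with
  | nil => exact absurd rfl hl
  | cons a l => exact h.1.symm.trans h'.1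

theorem IsPath.left_eq {l : List (Quiver.Total Q)} {x x' y y' : Q} (h : IsPath l x y)
    (h' : IsPath l x' y') (hl : l ≠ []) : x = x' := by
  induction l generalizing y y' with
  | nil => exact absurd rfl hl
  | cons a l ih =>
    by_cases hl : l = []
    · subst hl
      exact Eq.trans h.2 (Eq.symm h'.2)
    · exact ih h.2 h'.2 hl

theorem IsPath.head_right {l : List (Quiver.Total Q)} {x y : Q} (h : IsPath l x y)
    {a : Quiver.Total Q} (ha : l.head? = some a) : a.right = y := by
  obtain ⟨l', rfl⟩ := List.head?_eq_some_iff.1 ha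
  exact h.1

theorem IsPath.getLast_left {l : List (Quiver.Total Q)} {x y : Q} (h : IsPath l x y)
    {a : Quiver.Total Q} (ha : l.getLast? = some a) : a.left = x := by
  obtain ⟨l', rfl⟩ := List.getLast?_eq_some_iff.1 ha
  obtain ⟨y, -, h2⟩ := h.exists_of_append
  exact (Eq.symm h2.2)

section

variable [Fintype Q]

theorem word_cons (a : Quiver.Total Q) (l : List (Quiver.Total Q)) :
    word k (a :: l) = arrow k a * word k l := by
  simp [word]

/-- The trivial path is excluded because the empty word is the unit of kQ, not the idempotent of a
vertex. -/
theorem word_pathWord {x y : Q} (p : Quiver.Path x y) (h : pathWord p ≠ []) :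
    word k (pathWord p) = ofPath k p := by
  induction p with
  | nil => exact absurd (by simp [pathWord]) h
  | @cons y z p e ih =>
    rw [pathWord, word_cons]
    cases p with
    | nil => simp [pathWord, word, arrow, Quiver.Hom.toPath]
    | cons p e' =>
      rw [ih (by simp [pathWord])]
      exact ofPath_mul_comp k _ _

/-! ### Paths containing a relation, and words outside a gentle ideal. -/

variable (k) in
/-- The span of the paths whose word is not a chain for `N`. -/
def nonChainSpan (N : Quiver.Total Q → Quiver.Total Q → Prop) : Submodule k (PathAlgebra k Q) :=
  Submodule.span k {g | ∃ (x y : Q) (p : Quiver.Path x y), ¬ (pathWord p).IsChain N ∧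
    g = ofPath k p}

theorem ofPath_mem_nonChainSpan {N : Quiver.Total Q → Quiver.Total Q → Prop} {x y : Q}
    {p : Quiver.Path x y} (h : ¬ (pathWord p).IsChain N) : ofPath k p ∈ nonChainSpan k N :=
  Submodule.subset_span ⟨x, y, p, h, rfl⟩

/-- The paths are a basis of kQ, so a path in the span of a set of paths belongs to that set. -/
theorem not_isChain_of_mem_nonChainSpan {N : Quiver.Total Q → Quiver.Total Q → Prop} {x y : Q}
    {p : Quiver.Path x y} (h : ofPath k p ∈ nonChainSpan k N) : ¬ (pathWord p).IsChain N := by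
  let S : Set (Σ x y : Q, Quiver.Path x y) := {s | ¬ (pathWord s.2.2).IsChain N}
  let T : Submodule k (PathAlgebra k Q) :=
    (Finsupp.supported k k S : Submodule k ((Σ x y : Q, Quiver.Path x y) →₀ k))
  have hle : nonChainSpan k N ≤ T := by
    refine Submodule.span_le.2 ?_
    rintro _ ⟨x, y, p, hp, rfl⟩
    exact Finsupp.single_mem_supported k (s := S) (a := ⟨x, y, p⟩) (1 : k) hp
  have h1 : (Finsupp.single (⟨x, y, p⟩ : Σ x y : Q, Quiver.Path x y) (1 : k)) ∈
      Finsupp.supported k k S := hle h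
  rw [Finsupp.mem_supported, Finsupp.support_single _ one_ne_zero] at h1
  exact h1 (Finset.mem_coe.2 (Finset.mem_singleton_self _))

/-- A segment of a chain is a chain, so extending a non-chain path never produces a chain. This
makes the span an ideal. -/
theorem mul_mem_nonChainSpan_left {N : Quiver.Total Q → Quiver.Total Q → Prop}
    (f : PathAlgebra k Q) {g : PathAlgebra k Q} (hg : g ∈ nonChainSpan k N) :
    f * g ∈ nonChainSpan k N := by
  induction hg using Submodule.span_induction with
  | zero => simp
  | add g g' _ _ hg hg' => rw [mul_add]; exact add_mem hg hg'
  | smul c g _ hg => rw [mul_smul_comm]; exact Submodule.smul_mem _ _ hg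
  | mem g hg =>
    obtain ⟨x, y, p, hp, rfl⟩ := hg
    induction f using PathAlgebra.induction_linear with
    | zero => simp
    | add f f' hf hf' => rw [add_mul]; exact add_mem hf hf'
    | @basis c x' y' q =>
      rw [smul_mul_assoc]
      refine Submodule.smul_mem _ _ ?_
      by_cases h : y = x'
      · subst h
        rw [ofPath_mul_comp]
        refine ofPath_mem_nonChainSpan fun hc => hp ?_
        rw [pathWord_comp] at hc
        exact (List.isChain_append.1 hc).2.1
      · rw [ofPath_mul_of_ne k _ _ h]
        exact zero_mem _

theorem mul_mem_nonChainSpan_right {N : Quiver.Total Q → Quiver.Total Q → Prop}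
    (f : PathAlgebra k Q) {g : PathAlgebra k Q} (hg : g ∈ nonChainSpan k N) :
    g * f ∈ nonChainSpan k N := by
  induction hg using Submodule.span_induction with
  | zero => simp
  | add g g' _ _ hg hg' => rw [add_mul]; exact add_mem hg hg'
  | smul c g _ hg => rw [smul_mul_assoc]; exact Submodule.smul_mem _ _ hg
  | mem g hg =>
    obtain ⟨x, y, p, hp, rfl⟩ := hg
    induction f using PathAlgebra.induction_linear with
    | zero => simp
    | add f f' hf hf' => rw [mul_add]; exact add_mem hf hf'
    | @basis c x' y' q =>
      rw [mul_smul_comm]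
      refine Submodule.smul_mem _ _ ?_
      by_cases h : y' = x
      · subst h
        rw [ofPath_mul_comp]
        refine ofPath_mem_nonChainSpan fun hc => hp ?_
        rw [pathWord_comp] at hc
        exact (List.isChain_append.1 hc).1
      · rw [ofPath_mul_of_ne k _ _ h]
        exact zero_mem _

variable (k) in
/-- The ideal of `kQ` spanned by the paths whose word is not a chain for `N`. -/
def nonChainIdeal (N : Quiver.Total Q → Quiver.Total Q → Prop) : TwoSidedIdeal (PathAlgebra k Q) :=
  TwoSidedIdeal.mk' (nonChainSpan k N : Set (PathAlgebra k Q)) (zero_mem _) add_mem neg_mem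
    (mul_mem_nonChainSpan_left _) (mul_mem_nonChainSpan_right _)

theorem mem_nonChainIdeal {N : Quiver.Total Q → Quiver.Total Q → Prop} {f : PathAlgebra k Q} :
    f ∈ nonChainIdeal k N ↔ f ∈ nonChainSpan k N := by
  simp [nonChainIdeal]

/-- The arrows `b`, `a` do not form a relation `ba`. -/
def NonRel (I : TwoSidedIdeal (PathAlgebra k Q)) (b a : Quiver.Total Q) : Prop :=
  arrow k b * arrow k a ∉ I

variable {I : TwoSidedIdeal (PathAlgebra k Q)}

theorem isChain_of_word_notMem {l : List (Quiver.Total Q)} (h : word k l ∉ I) :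
    l.IsChain (NonRel I) := by
  induction l with
  | nil => simp
  | cons b l ih =>
    have hl : word k l ∉ I := fun hl => h (by rw [word_cons]; exact I.mul_mem_left _ _ hl)
    cases l with
    | nil => simp
    | cons a l =>
      refine List.isChain_cons_cons.2 ⟨fun hba => h ?_, ih hl⟩
      rw [word_cons, word_cons, ← mul_assoc]
      exact I.mul_mem_right _ _ hba

/-- A gentle ideal is generated by relations of length two, hence lies in the ideal spanned by the
paths that contain a relation; a chain is a basis element outside that span. -/
theorem IsGentle.word_notMem (hI : IsGentle I) {l : List (Quiver.Total Q)} {x y : Q}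
    (hl : l ≠ []) (hp : IsPath l x y) (hc : l.IsChain (NonRel I)) : word k l ∉ I := by
  obtain ⟨R, hR, hIR⟩ := hI.monomial
  have hle : I ≤ nonChainIdeal k (NonRel I) := by
    have hRI : ∀ r ∈ R, arrow k r.1 * arrow k r.2 ∈ I := by
      intro r hr
      rw [hIR]
      exact TwoSidedIdeal.subset_span ⟨r, hr, rfl⟩
    intro f hf
    rw [hIR] at hf
    refine TwoSidedIdeal.span_le.2 ?_ hf
    rintro _ ⟨r, hr, rfl⟩
    have hpath : IsPath [r.1, r.2] r.2.left r.1.right := ⟨rfl, (hR r hr).symm, rfl⟩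
    obtain ⟨p, hp⟩ := hpath.exists_path
    have e : arrow k r.1 * arrow k r.2 = ofPath k p := by
      rw [← word_pathWord p (by simp [hp]), hp]
      simp [word]
    show _ ∈ nonChainIdeal k (NonRel I)
    rw [mem_nonChainIdeal, e]
    refine ofPath_mem_nonChainSpan fun hc => ?_
    rw [hp] at hc
    exact (List.isChain_cons_cons.1 hc).1 (hRI r hr)
  intro hm
  obtain ⟨p, rfl⟩ := hp.exists_path
  rw [word_pathWord p hl] at hm
  exact not_isChain_of_mem_nonChainSpan (mem_nonChainIdeal.1 (hle hm)) hc

/-- Neither factor contains a relation, so the one that makes the product vanish sits at the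
junction. This turns (L1), (L2), (R1) and (R2) into conditions on consecutive homotopy letters. -/
theorem IsGentle.exists_rel (hI : IsGentle I) {l l' : List (Quiver.Total Q)} {x y z : Q}
    (h : IsPathIn I l y z) (h' : IsPathIn I l' x y) (hm : word k (l ++ l') ∈ I) :
    ∃ b a, l.getLast? = some b ∧ l'.head? = some a ∧ arrow k b * arrow k a ∈ I := by
  by_contra hno
  push Not at hno
  refine hI.word_notMem (by simp [h.1]) (h.2.1.append h'.2.1) (List.isChain_append.2
    ⟨isChain_of_word_notMem h.2.2, isChain_of_word_notMem h'.2.2, fun b hb a ha => ?_⟩) hm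
  exact hno b a hb ha

theorem nonRel_of_word_append {l l' : List (Quiver.Total Q)} (hm : word k (l ++ l') ∉ I)
    {b a : Quiver.Total Q} (hb : l.getLast? = some b) (ha : l'.head? = some a) :
    arrow k b * arrow k a ∉ I :=
  (List.isChain_append.1 (isChain_of_word_notMem hm)).2.2 b hb a ha

/-- Two chains for a right unique relation that start with the same element are comparable. -/
theorem isPrefix_or_isPrefix_of_isChain {α : Type*} {N : α → α → Prop}
    (hN : ∀ a c c', N a c → N a c' → c = c') {l l' : List α} (h : l.IsChain N) (h' : l'.IsChain N)
    (hh : l.head? = l'.head?) : l <+: l' ∨ l' <+: l := by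
  induction l generalizing l' with
  | nil => exact Or.inl List.nil_prefix
  | cons a l ih =>
    cases l' with
    | nil => exact Or.inr List.nil_prefix
    | cons a' l' =>
      obtain rfl : a = a' := by simpa using hh
      cases l with
      | nil => exact Or.inl (by simp)
      | cons c l =>
        cases l' with
        | nil => exact Or.inr (by simp)
        | cons c' l' =>
          obtain rfl := hN a c c' (List.isChain_cons_cons.1 h).1 (List.isChain_cons_cons.1 h').1
          simpa using ih (List.isChain_cons_cons.1 h).2 (List.isChain_cons_cons.1 h').2 rfl

/-- Each arrow has at most one nonzero continuation to the right, so a path in (Q, I) is determined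
by its leftmost arrow and its length. -/
theorem IsGentle.isPrefix_or_isPrefix (hI : IsGentle I) {l l' : List (Quiver.Total Q)}
    (h : word k l ∉ I) (h' : word k l' ∉ I) (hh : l.head? = l'.head?) : l <+: l' ∨ l' <+: l :=
  isPrefix_or_isPrefix_of_isChain hI.right_unique (isChain_of_word_notMem h)
    (isChain_of_word_notMem h') hh

theorem IsGentle.isSuffix_or_isSuffix (hI : IsGentle I) {l l' : List (Quiver.Total Q)}
    (h : word k l ∉ I) (h' : word k l' ∉ I) (hh : l.getLast? = l'.getLast?) :
    l <:+ l' ∨ l' <:+ l := by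
  -- Read backwards, suffixes become prefixes, and uniqueness of continuation on the left replaces
  -- uniqueness on the right.
  rw [← List.reverse_prefix, ← List.reverse_prefix]
  exact isPrefix_or_isPrefix_of_isChain (N := fun a b => NonRel I b a) hI.left_unique
    (List.isChain_reverse.2 (isChain_of_word_notMem h))
    (List.isChain_reverse.2 (isChain_of_word_notMem h')) (by simpa using hh)

end

end Words

/-! ### Junctions of letters and operations on homotopy strings -/

section Walks

open PathAlgebra

variable {k : Type u} [Field k] {Q : Type u} [Quiver.{u} Q] [Fintype Q]
variable {I : TwoSidedIdeal (PathAlgebra k Q)}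

theorem eq_of_encard_le_two {α : Type*} {S : Set α} (hS : S.encard ≤ 2) {a b c : α} (ha : a ∈ S)
    (hb : b ∈ S) (hc : c ∈ S) (hab : a ≠ b) (hac : a ≠ c) : b = c := by
  by_contra hbc
  have h3 : ({a, b, c} : Set α).encard = 3 := Set.encard_eq_three.2 ⟨a, b, c, hab, hac, hbc, rfl⟩
  have hle : ({a, b, c} : Set α).encard ≤ S.encard := by
    refine Set.encard_le_encard ?_
    rintro x (rfl | rfl | rfl) <;> assumption
  rw [h3] at hle
  exact absurd (hle.trans hS) (by decide)

theorem IsPathIn.exists_head {l : List (Quiver.Total Q)} {x y : Q} (h : IsPathIn I l x y) :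
    ∃ a, l.head? = some a ∧ a.right = y := by
  obtain ⟨a, l', rfl⟩ := List.exists_cons_of_ne_nil h.1
  exact ⟨a, rfl, h.2.1.1⟩

theorem IsPathIn.exists_getLast {l : List (Quiver.Total Q)} {x y : Q} (h : IsPathIn I l x y) :
    ∃ a, l.getLast? = some a ∧ a.left = x :=
  ⟨_, List.getLast?_eq_some_getLast h.1, h.2.1.getLast_left (List.getLast?_eq_some_getLast h.1)⟩

/-! ### Letters that can follow a given letter. -/

namespace Letter

/-- If `ℓ` is direct, its last arrow forms a relation with only one arrow ending at `v`. If `ℓ` is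
inverse, the first arrow of its path is forbidden, and at most one other arrow ends at `v`. -/
theorem head_eq_of_junction (hI : IsGentle I) {ℓ : Letter Q} {p q : List (Quiver.Total Q)}
    {v y x x' : Q} (hℓ : ℓ.Joins I y v) (hp : IsPathIn I p x v) (hq : IsPathIn I q x' v)
    (h : Junction I ℓ (direct p)) (h' : Junction I ℓ (direct q)) : p.head? = q.head? := by
  obtain ⟨a, ha, hav⟩ := hp.exists_head
  obtain ⟨a', ha', hav'⟩ := hq.exists_head
  cases ℓ with
  | direct r =>
    obtain ⟨b, c, hb, hc, hr⟩ := h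
    obtain ⟨b', c', hb', hc', hr'⟩ := h'
    obtain rfl : b = b' := Option.some.inj (hb.symm.trans hb')
    obtain rfl : a = c := Option.some.inj (ha.symm.trans hc)
    obtain rfl : a' = c' := Option.some.inj (ha'.symm.trans hc')
    have hbv : b.left = v := (hℓ : IsPathIn I r v y).2.1.getLast_left hb
    rw [ha, ha', hI.right_unique_rel b a a' (by rw [hav, hbv]) (by rw [hav', hbv]) hr hr']
  | inverse r =>
    obtain ⟨b, hb, hbv⟩ := (hℓ : IsPathIn I r y v).exists_head
    have h1 : r.head? ≠ p.head? := h
    have h2 : r.head? ≠ q.head? := h'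
    rw [hb, ha] at h1
    rw [hb, ha'] at h2
    rw [ha, ha', eq_of_encard_le_two (hI.ending v) (a := b) (b := a) (c := a') hbv hav hav'
      (fun e => h1 (by rw [e])) (fun e => h2 (by rw [e]))]

/-- Dual argument: uniqueness of the relation if `ℓ` is inverse, and at most two arrows starting at
`v` if `ℓ` is direct. -/
theorem getLast_eq_of_junction (hI : IsGentle I) {ℓ : Letter Q} {p q : List (Quiver.Total Q)}
    {v y x x' : Q} (hℓ : ℓ.Joins I y v) (hp : IsPathIn I p v x) (hq : IsPathIn I q v x')
    (h : Junction I ℓ (inverse p)) (h' : Junction I ℓ (inverse q)) :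
    p.getLast? = q.getLast? := by
  obtain ⟨a, ha, hav⟩ := hp.exists_getLast
  obtain ⟨a', ha', hav'⟩ := hq.exists_getLast
  cases ℓ with
  | inverse r =>
    obtain ⟨c, b, hc, hb, hr⟩ := h
    obtain ⟨c', b', hc', hb', hr'⟩ := h'
    obtain rfl : b = b' := Option.some.inj (hb.symm.trans hb')
    obtain rfl : a = c := Option.some.inj (ha.symm.trans hc)
    obtain rfl : a' = c' := Option.some.inj (ha'.symm.trans hc')
    have hbv : b.right = v := (hℓ : IsPathIn I r y v).2.1.head_right hb
    rw [ha, ha', hI.left_unique_rel b a a' (by rw [hav, hbv]) (by rw [hav', hbv]) hr hr']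
  | direct r =>
    obtain ⟨b, hb, hbv⟩ := (hℓ : IsPathIn I r v y).exists_getLast
    have h1 : r.getLast? ≠ p.getLast? := h
    have h2 : r.getLast? ≠ q.getLast? := h'
    rw [hb, ha] at h1
    rw [hb, ha'] at h2
    rw [ha, ha', eq_of_encard_le_two (hI.starting v) (a := b) (b := a) (c := a') hbv hav hav'
      (fun e => h1 (by rw [e])) (fun e => h2 (by rw [e]))]

theorem Joins.inv {ℓ : Letter Q} {x y : Q} (h : ℓ.Joins I y x) : ℓ.inv.Joins I x y := by
  cases ℓ <;> exact h

theorem Junction.inv {ℓ ℓ' : Letter Q} (h : Junction I ℓ' ℓ) : Junction I ℓ.inv ℓ'.inv := by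
  cases ℓ <;> cases ℓ'
  · exact h
  · exact Ne.symm h
  · exact Ne.symm h
  · exact h

theorem isDirect_inv {ℓ : Letter Q} : ℓ.inv.IsDirect ↔ ℓ.IsInverse := by cases ℓ <;> rfl

theorem isInverse_inv {ℓ : Letter Q} : ℓ.inv.IsInverse ↔ ℓ.IsDirect := by cases ℓ <;> rfl

theorem path_inv {ℓ : Letter Q} : ℓ.inv.path = ℓ.path := by cases ℓ <;> rfl

theorem isDirect_iff {ℓ : Letter Q} : ℓ.IsDirect ↔ ℓ = direct ℓ.path := by
  cases ℓ <;> simp [IsDirect, path]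

theorem isInverse_iff {ℓ : Letter Q} : ℓ.IsInverse ↔ ℓ = inverse ℓ.path := by
  cases ℓ <;> simp [IsInverse, path]

theorem isDirect_or_isInverse (ℓ : Letter Q) : ℓ.IsDirect ∨ ℓ.IsInverse := by
  cases ℓ <;> simp [IsInverse, IsDirect]

theorem Joins.right_eq {ℓ : Letter Q} {x x' y : Q} (h : ℓ.Joins I y x) (h' : ℓ.Joins I y x') :
    x = x' := by
  cases ℓ with
  | direct p => exact h.2.1.left_eq h'.2.1 h.1
  | inverse p => exact h.2.1.right_eq h'.2.1 h.1

end Letter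

/-! ### Inverting, shifting and splicing homotopy strings. -/

namespace GradedWalk

open Letter

/-- The letter at `i` joins the positions `i` and `i - 1`, so the reflection of positions `i ↦ -i`
moves it to `1 - i`. -/
theorem hasLetter_inv {σ : GradedWalk Q} {i : ℤ} : σ.inv.HasLetter i ↔ σ.HasLetter (1 - i) := by
  simp only [HasLetter, GradedWalk.inv, Set.mem_ofPred_eq]
  rw [show -(i - 1) = 1 - i by ring, show 1 - i - 1 = -i by ring, and_comm]

theorem IsHomotopyString.inv {σ : GradedWalk Q} (hσ : σ.IsHomotopyString I) :
    σ.inv.IsHomotopyString I where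
  nonempty := by
    obtain ⟨i, hi⟩ := hσ.nonempty
    exact ⟨-i, by simpa [GradedWalk.inv] using hi⟩
  ordConnected := ⟨fun i hi j hj l hl =>
    hσ.ordConnected.out (x := -j) (y := -i) hj hi ⟨neg_le_neg hl.2, neg_le_neg hl.1⟩⟩
  joins i hi := by
    have h := (hσ.joins _ (hasLetter_inv.1 hi)).inv
    rw [show 1 - i - 1 = -i by ring, show 1 - i = -(i - 1) by ring] at h
    simpa [GradedWalk.inv] using h
  junction i hi' hi := by
    have h1 := hasLetter_inv.1 hi
    have h2 := hasLetter_inv.1 hi'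
    have h3 := hσ.junction (1 - (i + 1)) (by rwa [show 1 - (i + 1) + 1 = 1 - i by ring]) h2
    rw [show 1 - (i + 1) + 1 = 1 - i by ring] at h3
    exact h3.inv
  left_infinite h := by
    obtain ⟨m, hm⟩ := hσ.right_infinite fun ⟨b, hb⟩ => h ⟨-b, fun i hi => le_neg_of_le_neg (hb hi)⟩
    refine ⟨1 - m, fun i hi => ?_⟩
    have := hm (1 - i) (by omega)
    exact ⟨isDirect_inv.2 this.1, by simpa [GradedWalk.inv, path_inv] using this.2⟩
  right_infinite h := by
    obtain ⟨m, hm⟩ := hσ.left_infinite fun ⟨b, hb⟩ => h ⟨-b, fun i hi => neg_le_of_neg_le (hb hi)⟩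
    refine ⟨1 - m, fun i hi => ?_⟩
    have := hm (1 - i) (by omega)
    exact ⟨isInverse_inv.2 this.1, by simpa [GradedWalk.inv, path_inv] using this.2⟩
  deg_direct i hi hd := by
    have h := hσ.deg_inverse _ (hasLetter_inv.1 hi) (isDirect_inv.1 hd)
    rw [show 1 - i - 1 = -i by ring, show 1 - i = -(i - 1) by ring] at h
    exact h
  deg_inverse i hi hd := by
    have h := hσ.deg_direct _ (hasLetter_inv.1 hi) (isInverse_inv.1 hd)
    rw [show 1 - i - 1 = -i by ring, show 1 - i = -(i - 1) by ring] at h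
    exact h

theorem IsHomotopyString.raise {σ : GradedWalk Q} (hσ : σ.IsHomotopyString I) (n : ℤ) :
    (σ.raise n).IsHomotopyString I where
  nonempty := hσ.nonempty
  ordConnected := hσ.ordConnected
  joins := hσ.joins
  junction := hσ.junction
  left_infinite := hσ.left_infinite
  right_infinite := hσ.right_infinite
  deg_direct i hi hd := by
    have := hσ.deg_direct i hi hd
    simp only [GradedWalk.raise]
    omega
  deg_inverse i hi hd := by
    have := hσ.deg_inverse i hi hd
    simp only [GradedWalk.raise]
    omega

section Splice

variable {σ τ : GradedWalk Q} {a b i : ℤ} {ℓ : Letter Q}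

theorem mem_splice_of_pos (hi : 1 ≤ i) :
    i ∈ (σ.splice a ℓ τ b).pos ↔ a + (i - 1) ∈ σ.pos := by
  simp only [splice, Set.mem_ofPred_eq]
  constructor
  · rintro (h | h)
    · exact h.2
    · omega
  · exact fun h => Or.inl ⟨hi, h⟩

theorem mem_splice_of_nonpos (hi : i ≤ 0) : i ∈ (σ.splice a ℓ τ b).pos ↔ b + i ∈ τ.pos := by
  simp only [splice, Set.mem_ofPred_eq]
  constructor
  · rintro (h | h)
    · omega
    · exact h.2
  · exact fun h => Or.inr ⟨hi, h⟩

theorem splice_vertex_of_pos (hi : 1 ≤ i) :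
    (σ.splice a ℓ τ b).vertex i = σ.vertex (a + (i - 1)) := if_pos hi

theorem splice_vertex_of_nonpos (hi : i ≤ 0) :
    (σ.splice a ℓ τ b).vertex i = τ.vertex (b + i) := if_neg (by omega)

theorem splice_deg_of_pos (hi : 1 ≤ i) :
    (σ.splice a ℓ τ b).deg i = σ.deg (a + (i - 1)) := if_pos hi

theorem splice_deg_of_nonpos (hi : i ≤ 0) :
    (σ.splice a ℓ τ b).deg i = τ.deg (b + i) := if_neg (by omega)

theorem splice_letter_of_pos (hi : 2 ≤ i) :
    (σ.splice a ℓ τ b).letter i = σ.letter (a + (i - 1)) := if_pos hi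

theorem splice_letter_one : (σ.splice a ℓ τ b).letter 1 = ℓ := by simp [splice]

theorem splice_letter_of_nonpos (hi : i ≤ 0) :
    (σ.splice a ℓ τ b).letter i = τ.letter (b + i) := by
  simp [splice, show ¬ 2 ≤ i by omega, show i ≠ 1 by omega]

theorem hasLetter_splice_of_pos (hi : 2 ≤ i) :
    (σ.splice a ℓ τ b).HasLetter i ↔ σ.HasLetter (a + (i - 1)) := by
  rw [HasLetter, HasLetter, mem_splice_of_pos (by omega), mem_splice_of_pos (by omega),
    show a + (i - 1 - 1) = a + (i - 1) - 1 by ring]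

theorem hasLetter_splice_one :
    (σ.splice a ℓ τ b).HasLetter 1 ↔ a ∈ σ.pos ∧ b ∈ τ.pos := by
  rw [HasLetter, mem_splice_of_pos le_rfl, mem_splice_of_nonpos (by omega)]
  simp

theorem hasLetter_splice_of_nonpos (hi : i ≤ 0) :
    (σ.splice a ℓ τ b).HasLetter i ↔ τ.HasLetter (b + i) := by
  rw [HasLetter, HasLetter, mem_splice_of_nonpos hi, mem_splice_of_nonpos (by omega),
    show b + (i - 1) = b + i - 1 by ring]

/-- Away from the new letter everything is inherited from one of the halves, so only its ends, its
two junctions and its degree jump are needed. -/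
theorem IsHomotopyString.splice (hσ : σ.IsHomotopyString I) (hτ : τ.IsHomotopyString I)
    (ha : a ∈ σ.pos) (hb : b ∈ τ.pos) (hℓ : ℓ.Joins I (σ.vertex a) (τ.vertex b))
    (h1 : σ.HasLetter (a + 1) → Junction I (σ.letter (a + 1)) ℓ)
    (h2 : τ.HasLetter b → Junction I ℓ (τ.letter b))
    (hd : ℓ.IsDirect → τ.deg b = σ.deg a + 1) (hi : ℓ.IsInverse → σ.deg a = τ.deg b + 1) :
    (σ.splice a ℓ τ b).IsHomotopyString I where
  nonempty := ⟨1, (mem_splice_of_pos le_rfl).2 (by simpa using ha)⟩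
  ordConnected := by
    refine ⟨fun i hi j hj l hl => ?_⟩
    rcases le_or_gt 1 l with h | h
    · rw [mem_splice_of_pos h]
      have hj' := (mem_splice_of_pos (h.trans hl.2)).1 hj
      exact hσ.ordConnected.out ha hj' ⟨by omega, by have := hl.2; omega⟩
    · rw [mem_splice_of_nonpos (by omega)]
      have hi' := (mem_splice_of_nonpos (by have := hl.1; omega)).1 hi
      exact hτ.ordConnected.out hi' hb ⟨by have := hl.1; omega, by omega⟩
  joins i h := by
    rcases lt_trichotomy i 1 with hi | rfl | hi
    · rw [hasLetter_splice_of_nonpos (by omega)] at h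
      rw [splice_letter_of_nonpos (by omega), splice_vertex_of_nonpos (by omega),
        splice_vertex_of_nonpos (by omega), show b + (i - 1) = b + i - 1 by ring]
      exact hτ.joins _ h
    · rw [splice_letter_one, splice_vertex_of_pos le_rfl, splice_vertex_of_nonpos (by omega)]
      simpa using hℓ
    · rw [hasLetter_splice_of_pos (by omega)] at h
      rw [splice_letter_of_pos (by omega), splice_vertex_of_pos (by omega),
        splice_vertex_of_pos (by omega), show a + (i - 1 - 1) = a + (i - 1) - 1 by ring]
      exact hσ.joins _ h
  junction i h' h := by
    rcases lt_trichotomy i 0 with hi | rfl | hi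
    · rw [hasLetter_splice_of_nonpos (by omega)] at h h'
      rw [splice_letter_of_nonpos (by omega), splice_letter_of_nonpos (by omega)]
      rw [← add_assoc] at h' ⊢
      exact hτ.junction _ h' h
    · rw [hasLetter_splice_of_nonpos le_rfl] at h
      rw [splice_letter_of_nonpos le_rfl, zero_add, splice_letter_one]
      simpa using h2 (by simpa using h)
    · rw [hasLetter_splice_of_pos (by omega)] at h'
      rw [splice_letter_of_pos (by omega)]
      rcases (show 1 ≤ i from hi).eq_or_lt with rfl | hi
      · rw [splice_letter_one]
        simpa using h1 (by simpa using h')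
      · rw [hasLetter_splice_of_pos (by omega)] at h
        rw [splice_letter_of_pos (by omega)]
        rw [show a + (i + 1 - 1) = a + (i - 1) + 1 by ring] at h' ⊢
        exact hσ.junction _ h' h
  left_infinite h := by
    -- If `c` bounded the positions of `σ`, then `c - a + 1` would bound the shifted half of `σ`,
    -- while the other half lies below `1`.
    obtain ⟨m, hm⟩ := hσ.left_infinite fun ⟨c, hc⟩ => h ⟨max 1 (c - a + 1), fun i hi => by
      rcases le_or_gt i 1 with h' | h'
      · exact h'.trans (le_max_left _ _)
      · have := hc ((mem_splice_of_pos h'.le).1 hi)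
        exact le_trans (by omega) (le_max_right _ _)⟩
    refine ⟨max 2 (m - a + 1), fun i hi => ?_⟩
    rw [splice_letter_of_pos (by omega)]
    exact hm _ (by omega)
  right_infinite h := by
    obtain ⟨m, hm⟩ := hτ.right_infinite fun ⟨c, hc⟩ => h ⟨min 0 (c - b), fun i hi => by
      rcases le_or_gt 0 i with h' | h'
      · exact (min_le_left _ _).trans h'
      · have := hc ((mem_splice_of_nonpos h'.le).1 hi)
        exact (min_le_right _ _).trans (by omega)⟩
    refine ⟨min 0 (m - b), fun i hi => ?_⟩
    rw [splice_letter_of_nonpos (by omega)]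
    exact hm _ (by omega)
  deg_direct i h hdir := by
    rcases lt_trichotomy i 1 with hi | rfl | hi
    · rw [hasLetter_splice_of_nonpos (by omega)] at h
      rw [splice_letter_of_nonpos (by omega)] at hdir
      rw [splice_deg_of_nonpos (by omega), splice_deg_of_nonpos (by omega),
        show b + (i - 1) = b + i - 1 by ring]
      exact hτ.deg_direct _ h hdir
    · rw [splice_letter_one] at hdir
      rw [splice_deg_of_pos le_rfl, splice_deg_of_nonpos (by omega)]
      simpa using hd hdir
    · rw [hasLetter_splice_of_pos (by omega)] at h
      rw [splice_letter_of_pos (by omega)] at hdir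
      rw [splice_deg_of_pos (by omega), splice_deg_of_pos (by omega),
        show a + (i - 1 - 1) = a + (i - 1) - 1 by ring]
      exact hσ.deg_direct _ h hdir
  deg_inverse i h hinv := by
    rcases lt_trichotomy i 1 with hi | rfl | hi
    · rw [hasLetter_splice_of_nonpos (by omega)] at h
      rw [splice_letter_of_nonpos (by omega)] at hinv
      rw [splice_deg_of_nonpos (by omega), splice_deg_of_nonpos (by omega),
        show b + (i - 1) = b + i - 1 by ring]
      exact hτ.deg_inverse _ h hinv
    · rw [splice_letter_one] at hinv
      rw [splice_deg_of_pos le_rfl, splice_deg_of_nonpos (by omega)]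
      simpa using hi hinv
    · rw [hasLetter_splice_of_pos (by omega)] at h
      rw [splice_letter_of_pos (by omega)] at hinv
      rw [splice_deg_of_pos (by omega), splice_deg_of_pos (by omega),
        show a + (i - 1 - 1) = a + (i - 1) - 1 by ring]
      exact hσ.deg_inverse _ h hinv

end Splice

end GradedWalk

/-! ### The words c₁ and c₂ are homotopy strings. -/

namespace IsDoubleMap

open GradedWalk Letter

variable {σ τ : GradedWalk Q} {i j : ℤ} {fL fR : List (Quiver.Total Q)}

theorem pathIn_σ (hσ : σ.IsHomotopyString I) (hf : IsDoubleMap I σ τ i j fL fR) :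
    IsPathIn I (σ.letter i).path (σ.vertex (i - 1)) (σ.vertex i) :=
  hσ.direct hf.letter_σ hf.direct_σ

theorem pathIn_τ (hτ : τ.IsHomotopyString I) (hf : IsDoubleMap I σ τ i j fL fR) :
    IsPathIn I (τ.letter j).path (τ.vertex (j - 1)) (τ.vertex j) :=
  hτ.direct hf.letter_τ hf.direct_τ

theorem getLast_fR (hτ : τ.IsHomotopyString I) (hf : IsDoubleMap I σ τ i j fL fR) :
    fR.getLast? = (τ.letter j).path.getLast? := by
  have h := congrArg List.getLast? hf.comm
  rwa [List.getLast?_append_of_ne_nil _ (hf.pathIn_τ hτ).1,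
    List.getLast?_append_of_ne_nil _ hf.path_right.1, eq_comm] at h

theorem head_fL (hσ : σ.IsHomotopyString I) (hf : IsDoubleMap I σ τ i j fL fR) :
    fL.head? = (σ.letter i).path.head? := by
  have h := congrArg List.head? hf.comm
  rwa [List.head?_append_of_ne_nil _ hf.path_left.1,
    List.head?_append_of_ne_nil _ (hf.pathIn_σ hσ).1] at h

/-- If σ_R is direct, σ_C σ_R meets in a relation whereas σ_C f_R is nonzero, so σ_R and f_R have
different first arrows. If σ_R is inverse, the relation comes from (R1). -/
theorem junction_right_σ (hI : IsGentle I) (hσ : σ.IsHomotopyString I)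
    (hf : IsDoubleMap I σ τ i j fL fR) (h : σ.HasLetter (i - 1)) :
    Junction I (Letter.inverse fR) (σ.letter (i - 1)) := by
  rcases (σ.letter (i - 1)).isDirect_or_isInverse with hd | hd
  · have hj := hσ.junction (i - 1) (by simpa using hf.letter_σ) h
    rw [sub_add_cancel, isDirect_iff.1 hf.direct_σ, isDirect_iff.1 hd] at hj
    rw [isDirect_iff.1 hd]
    obtain ⟨b, a, hb, ha, hr⟩ := hj
    intro e
    exact nonRel_of_word_append (hf.comm ▸ hf.comm_notMem) hb (e.trans ha) hr
  · have hr := hf.R1 h hd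
    rw [isInverse_iff.1 hd]
    exact hI.exists_rel (hσ.inverse h hd) hf.path_right hr

/-- If τ_R is direct, the relation comes from (R2). If it is inverse, f_R has the same last arrow as
τ_C, so non-cancellation is inherited from `τ`. -/
theorem junction_right_τ (hI : IsGentle I) (hτ : τ.IsHomotopyString I)
    (hf : IsDoubleMap I σ τ i j fL fR) (h : τ.HasLetter (j - 1)) :
    Junction I (τ.letter (j - 1)).inv (Letter.inverse fR) := by
  rcases (τ.letter (j - 1)).isDirect_or_isInverse with hd | hd
  · have hr := hf.R2 h hd
    rw [isDirect_iff.1 hd]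
    exact hI.exists_rel hf.path_right (hτ.direct h hd) hr
  · have hj := hτ.junction (j - 1) (by simpa using hf.letter_τ) h
    rw [sub_add_cancel, isDirect_iff.1 hf.direct_τ, isInverse_iff.1 hd] at hj
    rw [isInverse_iff.1 hd]
    intro e
    exact hj (((hf.getLast_fR hτ).symm.trans (Eq.symm e)))

/-- If σ_L is direct, the relation comes from (L1). If it is inverse, f_L has the same first arrow
as σ_C, so non-cancellation is inherited from `σ`. -/
theorem junction_left_σ (hI : IsGentle I) (hσ : σ.IsHomotopyString I)
    (hf : IsDoubleMap I σ τ i j fL fR) (h : σ.HasLetter (i + 1)) :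
    Junction I (σ.letter (i + 1)) (Letter.direct fL) := by
  rcases (σ.letter (i + 1)).isDirect_or_isInverse with hd | hd
  · have hr := hf.L1 h hd
    rw [isDirect_iff.1 hd]
    have hp := hσ.direct h hd
    rw [add_sub_cancel_right] at hp
    exact hI.exists_rel hp hf.path_left hr
  · have hj := hσ.junction i h hf.letter_σ
    rw [isDirect_iff.1 hf.direct_σ, isInverse_iff.1 hd] at hj
    rw [isInverse_iff.1 hd]
    intro e
    exact hj (e.trans (hf.head_fL hσ))

/-- If τ_L is direct, τ_L τ_C meets in a relation whereas f_L τ_C is nonzero, so τ_L and f_L have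
different last arrows. If τ_L is inverse, the relation comes from (L2). -/
theorem junction_left_τ (hI : IsGentle I) (hτ : τ.IsHomotopyString I)
    (hf : IsDoubleMap I σ τ i j fL fR) (h : τ.HasLetter (j + 1)) :
    Junction I (Letter.direct fL) (τ.letter (j + 1)).inv := by
  rcases (τ.letter (j + 1)).isDirect_or_isInverse with hd | hd
  · have hj := hτ.junction j h hf.letter_τ
    rw [isDirect_iff.1 hf.direct_τ, isDirect_iff.1 hd] at hj
    rw [isDirect_iff.1 hd]
    obtain ⟨b, a, hb, ha, hr⟩ := hj
    intro e
    exact nonRel_of_word_append hf.comm_notMem (e.trans hb) ha hr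
  · have hr := hf.L2 h hd
    rw [isInverse_iff.1 hd]
    have hp := hτ.inverse h hd
    rw [add_sub_cancel_right] at hp
    exact hI.exists_rel hf.path_left hp hr

theorem deg_right (hσ : σ.IsHomotopyString I) (hτ : τ.IsHomotopyString I)
    (hf : IsDoubleMap I σ τ i j fL fR) : σ.deg (i - 1) = τ.deg (j - 1) := by
  rw [hσ.deg_direct i hf.letter_σ hf.direct_σ, hτ.deg_direct j hf.letter_τ hf.direct_τ, hf.deg_eq]

theorem cone₁_isHomotopyString (hI : IsGentle I) (hσ : σ.IsHomotopyString I)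
    (hτ : τ.IsHomotopyString I) (hf : IsDoubleMap I σ τ i j fL fR) :
    (cone₁ σ τ i j fR).IsHomotopyString I := by
  refine hτ.inv.splice (hσ.raise (-1)) ?_ hf.letter_σ.2 ?_ ?_ ?_ ?_ ?_
  · simpa [GradedWalk.inv] using hf.letter_τ.2
  · simpa [GradedWalk.inv, GradedWalk.raise, Letter.Joins] using hf.path_right
  · intro h
    rw [hasLetter_inv, show 1 - (-(j - 1) + 1) = j - 1 by ring] at h
    have := hf.junction_right_τ hI hτ h
    simpa only [GradedWalk.inv, show 1 - (-(j - 1) + 1) = j - 1 by ring] using this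
  · exact fun h => (hf.junction_right_σ hI hσ h :)
  · exact fun h => h.elim
  · intro _
    simp [GradedWalk.inv, GradedWalk.raise, hf.deg_right hσ hτ]

theorem cone₂_isHomotopyString (hI : IsGentle I) (hσ : σ.IsHomotopyString I)
    (hτ : τ.IsHomotopyString I) (hf : IsDoubleMap I σ τ i j fL fR) :
    (cone₂ σ τ i j fL).IsHomotopyString I := by
  refine (hσ.raise (-1)).splice hτ.inv hf.letter_σ.1 ?_ ?_ ?_ ?_ ?_ ?_
  · simpa [GradedWalk.inv] using hf.letter_τ.1
  · simpa [GradedWalk.inv, GradedWalk.raise, Letter.Joins] using hf.path_left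
  · exact fun h => (hf.junction_left_σ hI hσ h :)
  · intro h
    rw [hasLetter_inv, show 1 - -j = j + 1 by ring] at h
    have := hf.junction_left_τ hI hτ h
    simpa only [GradedWalk.inv, show 1 - -j = j + 1 by ring] using this
  · intro _
    simp [GradedWalk.inv, GradedWalk.raise, hf.deg_eq]
  · exact fun h => h.elim

end IsDoubleMap

end Walks

/-! ### Comparison of the halves of two homotopy strings -/

section HalfMaps

open PathAlgebra

variable {k : Type u} [Field k] {Q : Type u} [Quiver.{u} Q] [Fintype Q]
variable (I : TwoSidedIdeal (PathAlgebra k Q))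

namespace GradedWalk

open Letter

open Classical in
/-- The component `P(x_i) → P(x_{i-1})` of the differential of the string complex. -/
def down (A : GradedWalk Q) (i : ℤ) : BoundAlgebra I :=
  if A.HasLetter i ∧ (A.letter i).IsDirect then cls I (A.letter i).path else 0

open Classical in
/-- The component `P(x_{i-1}) → P(x_i)` of the differential of the string complex. -/
def up (A : GradedWalk Q) (i : ℤ) : BoundAlgebra I :=
  if A.HasLetter i ∧ (A.letter i).IsInverse then cls I (A.letter i).path else 0

variable {I}

theorem down_eq {A : GradedWalk Q} {i : ℤ} (h : A.HasLetter i) (hd : (A.letter i).IsDirect) :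
    A.down I i = cls I (A.letter i).path := if_pos ⟨h, hd⟩

theorem down_eq_zero {A : GradedWalk Q} {i : ℤ} (h : A.HasLetter i → (A.letter i).IsInverse) :
    A.down I i = 0 := if_neg fun h' => not_direct_inverse h'.2 (h h'.1)

theorem up_eq {A : GradedWalk Q} {i : ℤ} (h : A.HasLetter i) (hd : (A.letter i).IsInverse) :
    A.up I i = cls I (A.letter i).path := if_pos ⟨h, hd⟩

theorem up_eq_zero {A : GradedWalk Q} {i : ℤ} (h : A.HasLetter i → (A.letter i).IsDirect) :
    A.up I i = 0 := if_neg fun h' => not_direct_inverse (h h'.1) h'.2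

theorem down_congr {A B : GradedWalk Q} {i j : ℤ} (h : A.HasLetter i ↔ B.HasLetter j)
    (h' : A.letter i = B.letter j) : A.down I i = B.down I j := by
  rw [down, down, h']
  by_cases hB : B.HasLetter j ∧ (B.letter j).IsDirect
  · rw [if_pos hB, if_pos ⟨h.2 hB.1, hB.2⟩]
  · rw [if_neg hB, if_neg fun hA => hB ⟨h.1 hA.1, hA.2⟩]

theorem up_congr {A B : GradedWalk Q} {i j : ℤ} (h : A.HasLetter i ↔ B.HasLetter j)
    (h' : A.letter i = B.letter j) : A.up I i = B.up I j := by
  rw [up, up, h']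
  by_cases hB : B.HasLetter j ∧ (B.letter j).IsInverse
  · rw [if_pos hB, if_pos ⟨h.2 hB.1, hB.2⟩]
  · rw [if_neg hB, if_neg fun hA => hB ⟨h.1 hA.1, hA.2⟩]

theorem down_eq_zero_or (A : GradedWalk Q) (i : ℤ) :
    A.down I i = 0 ∨ (A.HasLetter i ∧ (A.letter i).IsDirect) := by
  by_cases h : A.HasLetter i ∧ (A.letter i).IsDirect
  · exact Or.inr h
  · exact Or.inl (if_neg h)

theorem up_eq_zero_or (A : GradedWalk Q) (i : ℤ) :
    A.up I i = 0 ∨ (A.HasLetter i ∧ (A.letter i).IsInverse) := by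
  by_cases h : A.HasLetter i ∧ (A.letter i).IsInverse
  · exact Or.inr h
  · exact Or.inl (if_neg h)

variable (I) in
/-- The element `q` is zero, or it is the class of a path giving a map from `P(y_b)` to `P(x_a)`,
where these two projectives have the degrees `e'` and `e`. -/
def IsCoeff (A B : GradedWalk Q) (a b : ℤ) (e e' : ℤ) (q : BoundAlgebra I) : Prop :=
  q = 0 ∨ (a ∈ A.pos ∧ b ∈ B.pos ∧ A.deg a - e = B.deg b - e' ∧
    ∃ l, q = cls I l ∧ IsPath l (A.vertex a) (B.vertex b))

variable (I) in
/-- The coefficients `c t` define a chain map `y_{b-t} ↦ c t • x_{a-t}` from the string complex of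
the part of `B` to the right of its vertex at `b` to the one of the part of `A` to the right of its
vertex at `a`. -/
structure IsHalfMap (A B : GradedWalk Q) (a b : ℤ) (c : ℕ → BoundAlgebra I) : Prop where
  coeff : ∀ t : ℕ, IsCoeff I A B (a - t) (b - t) (A.deg a) (B.deg b) (c t)
  down : ∀ t : ℕ, B.down I (b - t) * c (t + 1) = c t * A.down I (a - t)
  up : ∀ t : ℕ, B.up I (b - t) * c t = c (t + 1) * A.up I (a - t)

variable {A B : GradedWalk Q} {a b : ℤ}

/-- The only squares that do not vanish identically are those of the first letters: `h1` concerns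
the map leaving x_a, and `h2` the map of `B` arriving at y_b. -/
theorem isHalfMap_of_path {g : List (Quiver.Total Q)} (ha : a ∈ A.pos) (hb : b ∈ B.pos)
    (hg : IsPath g (A.vertex a) (B.vertex b)) (h1 : cls I g * A.down I a = 0)
    (h2 : B.up I b * cls I g = 0) :
    IsHalfMap I A B a b (fun t => if t = 0 then cls I g else 0) where
  coeff t := by
    rcases Nat.eq_zero_or_pos t with rfl | ht
    · exact Or.inr ⟨by simpa using ha, by simpa using hb, by simp, g, by simp, by simpa using hg⟩
    · exact Or.inl (if_neg ht.ne')
  down t := by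
    rcases Nat.eq_zero_or_pos t with rfl | ht
    · simpa using h1.symm
    · simp [ht.ne']
  up t := by
    rcases Nat.eq_zero_or_pos t with rfl | ht
    · simpa using h2
    · simp [ht.ne']

variable (I) in
/-- The element `q` is the last coefficient of a chain map between the parts of `B` and `A` to the
right of `b` and `a` that starts with an identity. -/
structure IsLastCoeff (A B : GradedWalk Q) (a b : ℤ) (q : BoundAlgebra I) : Prop where
  coeff : IsCoeff I A B (a - 1) (b - 1) (A.deg a) (B.deg b) q
  down : B.down I b * q = A.down I a
  up : B.up I b = q * A.up I a
  down_next : q * A.down I (a - 1) = 0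
  up_next : B.up I (b - 1) * q = 0

/-- Without a map x_a → x_{a-1} and without a map y_{b-1} → y_b, the identity at the last common
vertex can be followed by zero. -/
theorem isLastCoeff_zero (hA : A.HasLetter a → (A.letter a).IsInverse)
    (hB : B.HasLetter b → (B.letter b).IsDirect) : IsLastCoeff I A B a b 0 where
  coeff := Or.inl rfl
  down := by simp [down_eq_zero hA]
  up := by simp [up_eq_zero hB]
  down_next := zero_mul _
  up_next := mul_zero _

/-- The coefficient is the piece l by which the letter of `A` is longer. It contains the last arrow
of that letter, hence its relation with a following direct letter. If the next letter of `B` is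
inverse, its last arrow differs from that of `B.letter b`, and only the latter has a nonzero product
with the first arrow of l. -/
theorem exists_isLastCoeff_of_direct (hI : IsGentle I) (hA : A.IsHomotopyString I)
    (hB : B.IsHomotopyString I) (ha : A.HasLetter a)
    (hb : B.HasLetter b) (hda : (A.letter a).IsDirect) (hdb : (B.letter b).IsDirect)
    (hne : A.letter a ≠ B.letter b) (hp : (B.letter b).path <+: (A.letter a).path) :
    ∃ q, IsLastCoeff I A B a b q := by
  obtain ⟨l, hl⟩ := hp
  have hl0 : l ≠ [] := by
    rintro rfl
    rw [List.append_nil] at hl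
    exact hne (by rw [isDirect_iff.1 hda, isDirect_iff.1 hdb, hl])
  have hpa := hA.direct ha hda
  have hpb := hB.direct hb hdb
  refine ⟨cls I l, ?_, ?_, ?_, ?_, ?_⟩
  · refine Or.inr ⟨ha.2, hb.2, ?_, l, rfl, ?_⟩
    · rw [hA.deg_direct a ha hda, hB.deg_direct b hb hdb]
      ring
    · have h := hpa.2.1
      rw [← hl] at h
      obtain ⟨y, hy1, hy2⟩ := h.exists_of_append
      rw [← hy1.left_eq hpb.2.1 hpb.1]
      exact hy2
  · rw [down_eq hb hdb, down_eq ha hda, ← hl, cls_append]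
  · rw [up_eq_zero fun _ => hdb, up_eq_zero fun _ => hda, mul_zero]
  · rcases A.down_eq_zero_or (I := I) (a - 1) with h | ⟨h, hd⟩
    · rw [h, mul_zero]
    · have hj := hA.junction (a - 1) (by simpa using ha) h
      rw [sub_add_cancel, isDirect_iff.1 hda, isDirect_iff.1 hd] at hj
      obtain ⟨x, y, hx, hy, hr⟩ := hj
      rw [down_eq h hd]
      rw [← hl, List.getLast?_append_of_ne_nil _ hl0] at hx
      exact cls_mul_eq_zero hx hy hr
  · rcases B.up_eq_zero_or (I := I) (b - 1) with h | ⟨h, hd⟩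
    · rw [h, zero_mul]
    · have hj := hB.junction (b - 1) (by simpa using hb) h
      rw [sub_add_cancel, isDirect_iff.1 hdb, isInverse_iff.1 hd] at hj
      rw [up_eq h hd]
      obtain ⟨x, hx, -⟩ := hpb.exists_getLast
      obtain ⟨y, hy, -⟩ := (hB.inverse h hd).exists_getLast
      have hz : l.head? = some (l.head hl0) := List.head?_eq_some_head hl0
      have hxz := nonRel_of_word_append (hl ▸ hpa.2.2) hx hz
      refine cls_mul_eq_zero hy hz ?_
      by_contra hyz
      refine hj ?_
      show (B.letter b).path.getLast? = (B.letter (b - 1)).path.getLast?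
      rw [hx, hy, hI.left_unique _ _ _ hxz hyz]

/-- Dual: the path of `B` is now the longer one, l is its surplus on the left, and uniqueness of
continuation on the right is used. -/
theorem exists_isLastCoeff_of_inverse (hI : IsGentle I) (hA : A.IsHomotopyString I)
    (hB : B.IsHomotopyString I) (hv : A.vertex a = B.vertex b) (ha : A.HasLetter a)
    (hb : B.HasLetter b) (hda : (A.letter a).IsInverse) (hdb : (B.letter b).IsInverse)
    (hne : A.letter a ≠ B.letter b) (hp : (A.letter a).path <:+ (B.letter b).path) :
    ∃ q, IsLastCoeff I A B a b q := by
  obtain ⟨l, hl⟩ := hp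
  have hl0 : l ≠ [] := by
    rintro rfl
    rw [List.nil_append] at hl
    exact hne (by rw [isInverse_iff.1 hda, isInverse_iff.1 hdb, hl])
  have hpa := hA.inverse ha hda
  have hpb := hB.inverse hb hdb
  refine ⟨cls I l, ?_, ?_, ?_, ?_, ?_⟩
  · refine Or.inr ⟨ha.2, hb.2, ?_, l, rfl, ?_⟩
    · rw [hA.deg_inverse a ha hda, hB.deg_inverse b hb hdb]
      ring
    · have h := hpb.2.1
      rw [← hl] at h
      obtain ⟨y, hy1, hy2⟩ := h.exists_of_append
      rw [hpa.2.1.right_eq (hv ▸ hy2) hpa.1]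
      exact hy1
  · rw [down_eq_zero fun _ => hdb, down_eq_zero fun _ => hda, zero_mul]
  · rw [up_eq hb hdb, up_eq ha hda, ← hl, cls_append]
  · rcases A.down_eq_zero_or (I := I) (a - 1) with h | ⟨h, hd⟩
    · rw [h, mul_zero]
    · have hj := hA.junction (a - 1) (by simpa using ha) h
      rw [sub_add_cancel, isInverse_iff.1 hda, isDirect_iff.1 hd] at hj
      rw [down_eq h hd]
      obtain ⟨x, hx, -⟩ := hpa.exists_head
      obtain ⟨y, hy, -⟩ := (hA.direct h hd).exists_head
      have hz : l.getLast? = some (l.getLast hl0) := List.getLast?_eq_some_getLast hl0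
      have hzx := nonRel_of_word_append (hl ▸ hpb.2.2) hz hx
      refine cls_mul_eq_zero hz hy ?_
      by_contra hzy
      refine hj ?_
      show (A.letter a).path.head? = (A.letter (a - 1)).path.head?
      rw [hx, hy, hI.right_unique _ _ _ hzx hzy]
  · rcases B.up_eq_zero_or (I := I) (b - 1) with h | ⟨h, hd⟩
    · rw [h, zero_mul]
    · have hj := hB.junction (b - 1) (by simpa using hb) h
      rw [sub_add_cancel, isInverse_iff.1 hdb, isInverse_iff.1 hd] at hj
      obtain ⟨x, y, hx, hy, hr⟩ := hj
      rw [up_eq h hd]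
      rw [← hl, List.head?_append_of_ne_nil _ hl0] at hy
      exact cls_mul_eq_zero hx hy hr

/-! ### Following two walks until they part. -/

variable (I) in
/-- The walks `A` and `B` have the same vertex at `a` and `b`, reached from the left by a common
letter. -/
structure IsMeeting (A B : GradedWalk Q) (a b : ℤ) : Prop where
  mem_left : a ∈ A.pos
  mem_right : b ∈ B.pos
  vertex_eq : A.vertex a = B.vertex b
  exists_letter : ∃ (ℓ : Letter Q) (y : Q), ℓ.Joins I y (A.vertex a) ∧
    (A.HasLetter a → Junction I ℓ (A.letter a)) ∧ (B.HasLetter b → Junction I ℓ (B.letter b))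

theorem IsMeeting.symm (h : IsMeeting I A B a b) : IsMeeting I B A b a := by
  obtain ⟨ℓ, y, h1, h2, h3⟩ := h.exists_letter
  exact ⟨h.mem_right, h.mem_left, h.vertex_eq.symm, ℓ, y, h.vertex_eq ▸ h1, h3, h2⟩

/-- The letters of `A` and `B` to the right of `a` and `b` exist and are equal. -/
def SameLetter (A B : GradedWalk Q) (a b : ℤ) : Prop :=
  A.HasLetter a ∧ B.HasLetter b ∧ A.letter a = B.letter b

theorem SameLetter.symm (h : SameLetter A B a b) : SameLetter B A b a :=
  ⟨h.2.1, h.1, h.2.2.symm⟩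

theorem IsMeeting.next (hA : A.IsHomotopyString I) (hB : B.IsHomotopyString I)
    (h : IsMeeting I A B a b) (hs : SameLetter A B a b) : IsMeeting I A B (a - 1) (b - 1) := by
  obtain ⟨h1, h2, h3⟩ := hs
  refine ⟨h1.2, h2.2, ?_, A.letter a, A.vertex a, hA.joins a h1, fun h => ?_, fun h => ?_⟩
  · refine (hA.joins a h1).right_eq ?_
    rw [h.vertex_eq, h3]
    exact hB.joins b h2
  · simpa using hA.junction (a - 1) (by simpa using h1) h
  · rw [h3]
    simpa using hB.junction (b - 1) (by simpa using h2) h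

theorem SameLetter.deg_eq (hA : A.IsHomotopyString I) (hB : B.IsHomotopyString I)
    (hs : SameLetter A B a b) : A.deg (a - 1) - A.deg a = B.deg (b - 1) - B.deg b := by
  obtain ⟨h1, h2, h3⟩ := hs
  rcases (A.letter a).isDirect_or_isInverse with hd | hd
  · rw [hA.deg_direct a h1 hd, hB.deg_direct b h2 (h3 ▸ hd)]
    ring
  · rw [hA.deg_inverse a h1 hd, hB.deg_inverse b h2 (h3 ▸ hd)]
    ring

theorem SameLetter.down_eq (hs : SameLetter A B a b) : B.down I b = A.down I a :=
  down_congr (iff_of_true hs.2.1 hs.1) hs.2.2.symm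

theorem SameLetter.up_eq (hs : SameLetter A B a b) : B.up I b = A.up I a :=
  up_congr (iff_of_true hs.2.1 hs.1) hs.2.2.symm

/-- Unless the zero coefficient works in one of the two directions, both letters exist and have the
same direction. The common letter before them forces a common first or last arrow, so one path
extends the other, and the longer one decides the direction of the map. -/
theorem IsMeeting.exists_isLastCoeff (hI : IsGentle I) (hA : A.IsHomotopyString I)
    (hB : B.IsHomotopyString I) (h : IsMeeting I A B a b) (hs : ¬ SameLetter A B a b) :
    (∃ q, IsLastCoeff I A B a b q) ∨ ∃ q, IsLastCoeff I B A b a q := by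
  obtain ⟨ℓ, y, hℓ, hjA, hjB⟩ := h.exists_letter
  by_cases h1 : (A.HasLetter a → (A.letter a).IsInverse) ∧ (B.HasLetter b → (B.letter b).IsDirect)
  · exact Or.inl ⟨0, isLastCoeff_zero h1.1 h1.2⟩
  by_cases h2 : (B.HasLetter b → (B.letter b).IsInverse) ∧ (A.HasLetter a → (A.letter a).IsDirect)
  · exact Or.inr ⟨0, isLastCoeff_zero h2.1 h2.2⟩
  have hcases : A.HasLetter a ∧ B.HasLetter b ∧
      ((A.letter a).IsDirect ∧ (B.letter b).IsDirect ∨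
        (A.letter a).IsInverse ∧ (B.letter b).IsInverse) := by
    have hA' := (A.letter a).isDirect_or_isInverse
    have hB' := (B.letter b).isDirect_or_isInverse
    tauto
  obtain ⟨ha, hb, hd⟩ := hcases
  have hne : A.letter a ≠ B.letter b := fun e => hs ⟨ha, hb, e⟩
  have hjA := hjA ha
  have hjB := hjB hb
  rcases hd with ⟨hda, hdb⟩ | ⟨hda, hdb⟩
  · have hpa := hA.direct ha hda
    have hpb := hB.direct hb hdb
    rw [isDirect_iff.1 hda] at hjA
    rw [isDirect_iff.1 hdb] at hjB
    have hh := head_eq_of_junction hI hℓ hpa (h.vertex_eq ▸ hpb) hjA hjB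
    rcases hI.isPrefix_or_isPrefix hpa.2.2 hpb.2.2 hh with hp | hp
    · exact Or.inr (exists_isLastCoeff_of_direct hI hB hA hb ha hdb hda hne.symm hp)
    · exact Or.inl (exists_isLastCoeff_of_direct hI hA hB ha hb hda hdb hne hp)
  · have hpa := hA.inverse ha hda
    have hpb := hB.inverse hb hdb
    rw [isInverse_iff.1 hda] at hjA
    rw [isInverse_iff.1 hdb] at hjB
    have hh := getLast_eq_of_junction hI hℓ hpa (h.vertex_eq ▸ hpb) hjA hjB
    rcases hI.isSuffix_or_isSuffix hpa.2.2 hpb.2.2 hh with hp | hp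
    · exact Or.inl (exists_isLastCoeff_of_inverse hI hA hB h.vertex_eq ha hb hda hdb hne hp)
    · exact Or.inr
        (exists_isLastCoeff_of_inverse hI hB hA h.vertex_eq.symm hb ha hdb hda hne.symm hp)

theorem IsMeeting.overlap (hA : A.IsHomotopyString I) (hB : B.IsHomotopyString I)
    (h : IsMeeting I A B a b) {m : ℕ} (hs : ∀ t < m, SameLetter A B (a - t) (b - t)) :
    IsMeeting I A B (a - m) (b - m) ∧ A.deg (a - m) - A.deg a = B.deg (b - m) - B.deg b := by
  induction m with
  | zero => simpa using h
  | succ m ih =>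
    obtain ⟨h1, h2⟩ := ih fun t ht => hs t (by omega)
    have h3 := hs m (by omega)
    have h4 := h3.deg_eq hA hB
    have h5 := h1.next hA hB h3
    push_cast
    rw [← sub_sub, ← sub_sub]
    exact ⟨h5, by omega⟩

theorem IsMeeting.isCoeff_one {e e' : ℤ} (h : IsMeeting I A B a b)
    (hd : A.deg a - e = B.deg b - e') : IsCoeff I A B a b e e' 1 :=
  Or.inr ⟨h.mem_left, h.mem_right, hd, [], by simp [cls, word], h.vertex_eq⟩

theorem IsMeeting.isHalfMap_one (hA : A.IsHomotopyString I) (hB : B.IsHomotopyString I)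
    (h : IsMeeting I A B a b) (hs : ∀ t : ℕ, SameLetter A B (a - t) (b - t)) :
    IsHalfMap I A B a b fun _ => 1 where
  coeff t := by
    obtain ⟨h1, h2⟩ := h.overlap hA hB (m := t) fun s _ => hs s
    exact h1.isCoeff_one h2
  down t := by rw [one_mul, mul_one, (hs t).down_eq]
  up t := by rw [one_mul, mul_one, (hs t).up_eq]

/-- Identities along the overlap, then `q`, then zero. Equality of letters gives the squares before
`m`; the fields of `IsLastCoeff` are the squares at `m` and `m + 1`. -/
theorem IsMeeting.isHalfMap_of_isLastCoeff (hA : A.IsHomotopyString I)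
    (hB : B.IsHomotopyString I) (h : IsMeeting I A B a b) {m : ℕ}
    (hs : ∀ t < m, SameLetter A B (a - t) (b - t)) {q : BoundAlgebra I}
    (hq : IsLastCoeff I A B (a - m) (b - m) q) :
    IsHalfMap I A B a b fun t => if t ≤ m then 1 else if t = m + 1 then q else 0 where
  coeff t := by
    rcases le_or_gt t m with ht | ht
    · rw [if_pos ht]
      obtain ⟨h1, h2⟩ := h.overlap hA hB (m := t) fun s hst => hs s (by omega)
      exact h1.isCoeff_one h2
    · rw [if_neg (by omega)]
      split_ifs with ht'
      · subst ht'
        obtain ⟨-, h2⟩ := h.overlap hA hB hs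
        push_cast
        rw [← sub_sub, ← sub_sub]
        rcases hq.coeff with h0 | ⟨h3, h4, h5, h6⟩
        · exact Or.inl h0
        · exact Or.inr ⟨h3, h4, by omega, h6⟩
      · exact Or.inl rfl
  down t := by
    rcases lt_trichotomy t m with ht | rfl | ht
    · rw [if_pos (by omega), if_pos (by omega), mul_one, one_mul, (hs t ht).down_eq]
    · simp [hq.down]
    · rw [if_neg (by omega), if_neg (by omega), if_neg (by omega), mul_zero]
      split_ifs with ht'
      · subst ht'
        push_cast
        rw [← sub_sub, hq.down_next]
      · rw [zero_mul]
  up t := by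
    rcases lt_trichotomy t m with ht | rfl | ht
    · rw [if_pos (by omega), if_pos (by omega), mul_one, one_mul, (hs t ht).up_eq]
    · simp [hq.up]
    · rw [if_neg (show ¬ t + 1 ≤ m by omega), if_neg (show ¬ t + 1 = m + 1 by omega),
        if_neg (show ¬ t ≤ m by omega), zero_mul]
      split_ifs with ht'
      · subst ht'
        push_cast
        rw [← sub_sub, hq.up_next]
      · rw [mul_zero]

/-- If the walks agree forever, identities form an infinite half map; otherwise the first
disagreement decides which of the two directions is possible. -/
theorem IsMeeting.exists_isHalfMap (hI : IsGentle I) (hA : A.IsHomotopyString I)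
    (hB : B.IsHomotopyString I) (h : IsMeeting I A B a b) :
    (∃ c, IsHalfMap I A B a b c ∧ c 0 = 1) ∨ ∃ c, IsHalfMap I B A b a c ∧ c 0 = 1 := by
  classical
  by_cases hs : ∀ t : ℕ, SameLetter A B (a - t) (b - t)
  · exact Or.inl ⟨_, h.isHalfMap_one hA hB hs, rfl⟩
  · push Not at hs
    have hm := Nat.find_spec hs
    have hlt : ∀ t < Nat.find hs, SameLetter A B (a - t) (b - t) := fun t ht => by
      simpa using Nat.find_min hs ht
    rcases (h.overlap hA hB hlt).1.exists_isLastCoeff hI hA hB hm with ⟨q, hq⟩ | ⟨q, hq⟩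
    · exact Or.inl ⟨_, h.isHalfMap_of_isLastCoeff hA hB hlt hq, by simp⟩
    · exact Or.inr ⟨_, h.symm.isHalfMap_of_isLastCoeff hB hA (fun t ht => (hlt t ht).symm) hq,
        by simp⟩

end GradedWalk

/-! ### The half map attached to a double map. -/

namespace IsDoubleMap

open GradedWalk Letter

variable {I} {σ τ : GradedWalk Q} {i j : ℤ} {fL fR : List (Quiver.Total Q)}

theorem letter_inv_left (τ : GradedWalk Q) (j : ℤ) :
    τ.inv.letter (-j) = (τ.letter (j + 1)).inv := by
  show (τ.letter (1 - -j)).inv = _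
  rw [show 1 - -j = j + 1 by ring]

theorem hasLetter_inv_left {τ : GradedWalk Q} {j : ℤ} :
    τ.inv.HasLetter (-j) ↔ τ.HasLetter (j + 1) := by
  rw [hasLetter_inv, show 1 - -j = j + 1 by ring]

/-- Here f_L and σ_C are the same letter; `σ` continues it by σ_R and c₂ continues it by τ̄_L. The
two halves to be compared therefore leave their common vertex after the same letter. -/
theorem isMeeting (hI : IsGentle I) (hσ : σ.IsHomotopyString I) (hτ : τ.IsHomotopyString I)
    (hf : IsDoubleMap I σ τ i j fL fR) (h : fL = (σ.letter i).path) :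
    IsMeeting I σ τ.inv (i - 1) (-j) := by
  have hp := hf.pathIn_σ hσ
  rw [← h] at hp
  refine ⟨hf.letter_σ.2, ?_, ?_, Letter.direct fL, σ.vertex i, hp, fun h' => ?_, fun h' => ?_⟩
  · simpa [GradedWalk.inv] using hf.letter_τ.1
  · simpa [GradedWalk.inv] using hp.2.1.left_eq hf.path_left.2.1 hp.1
  · rw [h, ← isDirect_iff.1 hf.direct_σ]
    simpa using hσ.junction (i - 1) (by simpa using hf.letter_σ) h'
  · rw [letter_inv_left]
    exact hf.junction_left_τ hI hτ (hasLetter_inv_left.1 h')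

/-- The two factorizations of f_L τ_C = σ_C f_R differ by an overlap g. Its position decides the
direction of the half map if g is nontrivial; otherwise the adjacent halves of the walks have to be
compared. -/
theorem exists_isHalfMap (hI : IsGentle I) (hσ : σ.IsHomotopyString I)
    (hτ : τ.IsHomotopyString I) (hf : IsDoubleMap I σ τ i j fL fR) :
    (∃ g c, (σ.letter i).path = fL ++ g ∧ (τ.letter j).path = g ++ fR ∧
      IsHalfMap I σ τ.inv (i - 1) (-j) c ∧ c 0 = cls I g) ∨
    ∃ g c, fL = (σ.letter i).path ++ g ∧ fR = g ++ (τ.letter j).path ∧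
      IsHalfMap I τ.inv σ (-j) (i - 1) c ∧ c 0 = cls I g := by
  -- The case of a trivial overlap, which can lead to either alternative.
  have hmeet (e : fL = (σ.letter i).path) (e' : fR = (τ.letter j).path) :
      (∃ g c, (σ.letter i).path = fL ++ g ∧ (τ.letter j).path = g ++ fR ∧
        IsHalfMap I σ τ.inv (i - 1) (-j) c ∧ c 0 = cls I g) ∨
      ∃ g c, fL = (σ.letter i).path ++ g ∧ fR = g ++ (τ.letter j).path ∧
        IsHalfMap I τ.inv σ (-j) (i - 1) c ∧ c 0 = cls I g := by
    have h := (hf.isMeeting hI hσ hτ e).exists_isHalfMap hI hσ hτ.inv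
    have h1 : cls I ([] : List (Quiver.Total Q)) = 1 := by simp [cls, word]
    rcases h with ⟨c, hc, hc0⟩ | ⟨c, hc, hc0⟩
    · exact Or.inl ⟨[], c, by simp [e], by simp [e'], hc, hc0.trans h1.symm⟩
    · exact Or.inr ⟨[], c, by simp [e], by simp [e'], hc, hc0.trans h1.symm⟩
  have hmemτ : -j ∈ τ.inv.pos := by simpa [GradedWalk.inv] using hf.letter_τ.1
  have hvτ : τ.inv.vertex (-j) = τ.vertex j := by simp [GradedWalk.inv]
  rcases List.append_eq_append_iff.1 hf.comm with ⟨g, h1, h2⟩ | ⟨g, h1, h2⟩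
  · by_cases hg : g = []
    · subst hg
      exact hmeet (by simpa using h1.symm) (by simpa using h2.symm)
    -- g is the right-hand piece of σ_C and the left-hand piece of τ_C, so it inherits the relations
    -- σ_C σ_R and τ_L τ_C.
    refine Or.inl ⟨g, _, h1, h2, isHalfMap_of_path hf.letter_σ.2 hmemτ ?_ ?_ ?_, if_pos rfl⟩
    · have hp := (hf.pathIn_σ hσ).2.1
      rw [h1] at hp
      obtain ⟨y, hy1, hy2⟩ := hp.exists_of_append
      rw [hvτ, ← hy1.left_eq hf.path_left.2.1 hf.path_left.1]
      exact hy2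
    · rcases σ.down_eq_zero_or (I := I) (i - 1) with h | ⟨h, hd⟩
      · rw [h, mul_zero]
      · have hj := hσ.junction (i - 1) (by simpa using hf.letter_σ) h
        rw [sub_add_cancel, isDirect_iff.1 hf.direct_σ, isDirect_iff.1 hd] at hj
        obtain ⟨x, y, hx, hy, hr⟩ := hj
        rw [down_eq h hd]
        rw [h1, List.getLast?_append_of_ne_nil _ hg] at hx
        exact cls_mul_eq_zero hx hy hr
    · rcases τ.inv.up_eq_zero_or (I := I) (-j) with h | ⟨h, hd⟩
      · rw [h, zero_mul]
      · rw [up_eq h hd]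
        rw [letter_inv_left] at hd ⊢
        rw [hasLetter_inv_left] at h
        rw [isInverse_inv] at hd
        have hj := hτ.junction j h hf.letter_τ
        rw [isDirect_iff.1 hf.direct_τ, isDirect_iff.1 hd] at hj
        obtain ⟨x, y, hx, hy, hr⟩ := hj
        rw [h2, List.head?_append_of_ne_nil _ hg] at hy
        rw [path_inv]
        exact cls_mul_eq_zero hx hy hr
  · by_cases hg : g = []
    · subst hg
      exact hmeet (by simpa using h1) (by simpa using h2)
    -- g is the right-hand piece of f_L and the left-hand piece of f_R, so its relations come from
    -- (L2) and (R1).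
    refine Or.inr ⟨g, _, h1, h2, isHalfMap_of_path hmemτ hf.letter_σ.2 ?_ ?_ ?_, if_pos rfl⟩
    · have hp := hf.path_left.2.1
      rw [h1] at hp
      obtain ⟨y, hy1, hy2⟩ := hp.exists_of_append
      rw [hvτ, ← hy1.left_eq (hf.pathIn_σ hσ).2.1 (hf.pathIn_σ hσ).1]
      exact hy2
    · rcases τ.inv.down_eq_zero_or (I := I) (-j) with h | ⟨h, hd⟩
      · rw [h, mul_zero]
      · rw [down_eq h hd]
        rw [letter_inv_left] at hd ⊢
        rw [hasLetter_inv_left] at h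
        have hj := hf.junction_left_τ hI hτ h
        rw [isDirect_iff.1 hd] at hj
        obtain ⟨x, y, hx, hy, hr⟩ := hj
        rw [h1, List.getLast?_append_of_ne_nil _ hg] at hx
        exact cls_mul_eq_zero hx hy hr
    · rcases σ.up_eq_zero_or (I := I) (i - 1) with h | ⟨h, hd⟩
      · rw [h, zero_mul]
      · have hj := hf.junction_right_σ hI hσ h
        rw [isInverse_iff.1 hd] at hj
        obtain ⟨x, y, hx, hy, hr⟩ := hj
        rw [up_eq h hd]
        rw [h2, List.head?_append_of_ne_nil _ hg] at hy
        exact cls_mul_eq_zero hx hy hr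

end IsDoubleMap

end HalfMaps

/-! ### Mapping cones that split -/

section Abstract

open Limits CochainComplex CochainComplex.HomComplex

/-- The pairs (s, t) are chain maps into the cone, and the eight equations say that they and the
pairs (a, b) form mutually inverse matrices in each degree. No compatibility of a and b with
differentials is required, since a chain map invertible in every degree is an isomorphism. -/
theorem nonempty_biprod_iso_mappingCone {C : Type*} [Category* C] [Preadditive C]
    [HasBinaryBiproducts C] {F G K₁ K₂ : CochainComplex C ℤ} (φ : F ⟶ G)
    (s₁ : Cocycle K₁ F 1) (t₁ : Cochain K₁ G 0) (s₂ : Cocycle K₂ F 1) (t₂ : Cochain K₂ G 0)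
    (e₁ : δ 0 1 t₁ + s₁.1.comp (Cochain.ofHom φ) (add_zero 1) = 0)
    (e₂ : δ 0 1 t₂ + s₂.1.comp (Cochain.ofHom φ) (add_zero 1) = 0)
    (a₁ : Cochain F K₁ (-1)) (b₁ : Cochain G K₁ 0) (a₂ : Cochain F K₂ (-1)) (b₂ : Cochain G K₂ 0)
    (h₁₁ : ∀ (p q : ℤ) (h : p + 1 = q), s₁.1.v p q h ≫ a₁.v q p (by omega) +
      t₁.v p p (add_zero p) ≫ b₁.v p p (add_zero p) = 𝟙 _)
    (h₁₂ : ∀ (p q : ℤ) (h : p + 1 = q), s₁.1.v p q h ≫ a₂.v q p (by omega) +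
      t₁.v p p (add_zero p) ≫ b₂.v p p (add_zero p) = 0)
    (h₂₁ : ∀ (p q : ℤ) (h : p + 1 = q), s₂.1.v p q h ≫ a₁.v q p (by omega) +
      t₂.v p p (add_zero p) ≫ b₁.v p p (add_zero p) = 0)
    (h₂₂ : ∀ (p q : ℤ) (h : p + 1 = q), s₂.1.v p q h ≫ a₂.v q p (by omega) +
      t₂.v p p (add_zero p) ≫ b₂.v p p (add_zero p) = 𝟙 _)
    (hFF : ∀ (p q : ℤ) (h : p + 1 = q), a₁.v q p (by omega) ≫ s₁.1.v p q h +
      a₂.v q p (by omega) ≫ s₂.1.v p q h = 𝟙 _)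
    (hFG : ∀ (p q : ℤ) (h : p + 1 = q), a₁.v q p (by omega) ≫ t₁.v p p (add_zero p) +
      a₂.v q p (by omega) ≫ t₂.v p p (add_zero p) = 0)
    (hGF : ∀ (p q : ℤ) (h : p + 1 = q), b₁.v p p (add_zero p) ≫ s₁.1.v p q h +
      b₂.v p p (add_zero p) ≫ s₂.1.v p q h = 0)
    (hGG : ∀ p : ℤ, b₁.v p p (add_zero p) ≫ t₁.v p p (add_zero p) +
      b₂.v p p (add_zero p) ≫ t₂.v p p (add_zero p) = 𝟙 _) :
    Nonempty (K₁ ⊞ K₂ ≅ mappingCone φ) := by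
  let Φ : K₁ ⊞ K₂ ⟶ mappingCone φ :=
    biprod.desc (mappingCone.lift φ s₁ t₁ e₁) (mappingCone.lift φ s₂ t₂ e₂)
  have hl : ∀ n, (biprod.inl : K₁ ⟶ K₁ ⊞ K₂).f n ≫ Φ.f n = (mappingCone.lift φ s₁ t₁ e₁).f n :=
    fun n => by rw [← HomologicalComplex.comp_f, biprod.inl_desc]
  have hr : ∀ n, (biprod.inr : K₂ ⟶ K₁ ⊞ K₂).f n ≫ Φ.f n = (mappingCone.lift φ s₂ t₂ e₂).f n :=
    fun n => by rw [← HomologicalComplex.comp_f, biprod.inr_desc]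
  have htot : ∀ n, (biprod.fst : K₁ ⊞ K₂ ⟶ K₁).f n ≫ (biprod.inl : K₁ ⟶ K₁ ⊞ K₂).f n +
      (biprod.snd : K₁ ⊞ K₂ ⟶ K₂).f n ≫ (biprod.inr : K₂ ⟶ K₁ ⊞ K₂).f n = 𝟙 _ := fun n => by
    rw [← HomologicalComplex.comp_f, ← HomologicalComplex.comp_f, ← HomologicalComplex.add_f_apply,
      biprod.total, HomologicalComplex.id_f]
  have hiso : ∀ n, IsIso (Φ.f n) := by
    intro n
    let r₁ : (mappingCone φ).X n ⟶ K₁.X n :=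
      (mappingCone.fst φ).1.v n (n + 1) rfl ≫ a₁.v (n + 1) n (by omega) +
        (mappingCone.snd φ).v n n (add_zero n) ≫ b₁.v n n (add_zero n)
    let r₂ : (mappingCone φ).X n ⟶ K₂.X n :=
      (mappingCone.fst φ).1.v n (n + 1) rfl ≫ a₂.v (n + 1) n (by omega) +
        (mappingCone.snd φ).v n n (add_zero n) ≫ b₂.v n n (add_zero n)
    have hf : Φ.f n = (biprod.fst : K₁ ⊞ K₂ ⟶ K₁).f n ≫ (mappingCone.lift φ s₁ t₁ e₁).f n +
        (biprod.snd : K₁ ⊞ K₂ ⟶ K₂).f n ≫ (mappingCone.lift φ s₂ t₂ e₂).f n := by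
      rw [← hl, ← hr, ← Category.assoc, ← Category.assoc, ← Preadditive.add_comp, htot,
        Category.id_comp]
    refine ⟨r₁ ≫ (biprod.inl : K₁ ⟶ K₁ ⊞ K₂).f n + r₂ ≫ (biprod.inr : K₂ ⟶ K₁ ⊞ K₂).f n, ?_, ?_⟩
    · have h1 : Φ.f n ≫ r₁ = (biprod.fst : K₁ ⊞ K₂ ⟶ K₁).f n := by
        simp only [hf, r₁, Preadditive.add_comp, Preadditive.comp_add, Category.assoc,
          mappingCone.lift_f_fst_v_assoc, mappingCone.lift_f_snd_v_assoc]
        rw [add_add_add_comm, ← Preadditive.comp_add, ← Preadditive.comp_add, h₁₁, h₂₁, Category.comp_id,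
          Limits.comp_zero, add_zero]
      have h2 : Φ.f n ≫ r₂ = (biprod.snd : K₁ ⊞ K₂ ⟶ K₂).f n := by
        simp only [hf, r₂, Preadditive.add_comp, Preadditive.comp_add, Category.assoc,
          mappingCone.lift_f_fst_v_assoc, mappingCone.lift_f_snd_v_assoc]
        rw [add_add_add_comm, ← Preadditive.comp_add, ← Preadditive.comp_add, h₁₂, h₂₂, Category.comp_id,
          Limits.comp_zero, zero_add]
      rw [Preadditive.comp_add, ← Category.assoc, ← Category.assoc, h1, h2, htot]
    · rw [Preadditive.add_comp, Category.assoc, Category.assoc, hl, hr]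
      -- An endomorphism of the cone in one degree is determined by its four entries with respect to
      -- the two summands.
      rw [mappingCone.ext_to_iff _ _ (n + 1) rfl, mappingCone.ext_from_iff _ (n + 1) n rfl,
        mappingCone.ext_from_iff _ (n + 1) n rfl]
      simp only [r₁, r₂, Preadditive.add_comp, Preadditive.comp_add, Category.assoc,
        mappingCone.lift_f_fst_v, mappingCone.lift_f_snd_v, mappingCone.inl_v_fst_v_assoc,
        mappingCone.inl_v_snd_v_assoc, mappingCone.inr_f_fst_v_assoc,
        mappingCone.inr_f_snd_v_assoc, Category.id_comp, mappingCone.inl_v_fst_v,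
        mappingCone.inl_v_snd_v, mappingCone.inr_f_fst_v, mappingCone.inr_f_snd_v,
        Limits.zero_comp, add_zero, zero_add]
      exact ⟨⟨hFF n _ rfl, hGF n _ rfl⟩, hFG n _ rfl, hGG n⟩
  have : IsIso Φ := HomologicalComplex.Hom.isIso_of_components Φ
  exact ⟨asIso Φ⟩

end Abstract

/-! ### Cochains between string complexes -/

section Cochains

open PathAlgebra CochainComplex.HomComplex

variable {k : Type u} [Field k] {Q : Type u} [Quiver.{u} Q] [Fintype Q]
variable (I : TwoSidedIdeal (PathAlgebra k Q))

/-- The linear map that sends the generator at `l` to `w l` times the generator at `p l`. -/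
def weightedMap (p : ℤ → ℤ) (w : ℤ → BoundAlgebra I) :
    (ℤ →₀ BoundAlgebra I) →ₗ[BoundAlgebra I] (ℤ →₀ BoundAlgebra I) :=
  Finsupp.lsum ℕ fun l => (Finsupp.lsingle (p l)).comp (rightMul I (w l))

@[simp]
theorem weightedMap_single (p : ℤ → ℤ) (w : ℤ → BoundAlgebra I) (l : ℤ) (u : BoundAlgebra I) :
    weightedMap I p w (Finsupp.single l u) = Finsupp.single (p l) (u * w l) := by
  simp [weightedMap]

variable {I}

namespace GradedWalk

theorem differential_single_eq (A : GradedWalk Q) (l : ℤ) (u : BoundAlgebra I) :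
    A.differential I (Finsupp.single l u) =
      Finsupp.single (l - 1) (u * A.down I l) + Finsupp.single (l + 1) (u * A.up I (l + 1)) := by
  rw [differential_single, outgoing, LinearMap.add_apply, down, up]
  congr 1 <;> split_ifs <;> simp

variable (I) in
/-- The linear map `L` sends the components of the string complex of `A` to those of the string
complex of `B` and raises the degree by `e`. -/
def RaisesDegree (A B : GradedWalk Q) (e : ℤ)
    (L : (ℤ →₀ BoundAlgebra I) →ₗ[BoundAlgebra I] (ℤ →₀ BoundAlgebra I)) : Prop :=
  ∀ p q, p + e = q → ∀ f ∈ A.component I p, L f ∈ B.component I q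

/-- Only positions of nonzero weight matter, so the maps below can be given by formulas on all of ℤ
and cut off by their weights. -/
theorem raisesDegree_weightedMap {A B : GradedWalk Q} {e : ℤ} {p : ℤ → ℤ}
    {w : ℤ → BoundAlgebra I} (h : ∀ l, w l ≠ 0 → l ∈ A.pos → p l ∈ B.pos ∧
      B.deg (p l) = A.deg l + e ∧ ∀ v ∈ proj I (A.vertex l), v * w l ∈ proj I (B.vertex (p l))) :
    RaisesDegree I A B e (weightedMap I p w) := by
  rintro n _ rfl f hf
  rw [← Finsupp.sum_single f, Finsupp.sum, map_sum]
  refine Submodule.sum_mem _ fun l hl => ?_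
  obtain ⟨h1, h2⟩ := (hf l).2 (Finsupp.mem_support_iff.1 hl)
  rw [weightedMap_single]
  by_cases hw : w l = 0
  · rw [hw, mul_zero, Finsupp.single_zero]
    exact zero_mem _
  · obtain ⟨h3, h4, h5⟩ := h l hw h1
    exact single_mem_component I B h3 (by rw [h4, h2]) (h5 _ (hf l).1)

variable {A B C : GradedWalk Q} {hA : A.IsHomotopyString I} {hB : B.IsHomotopyString I}
  {hC : C.IsHomotopyString I}

/-- The cochain given by a linear map that raises degrees. -/
def RaisesDegree.cochain {e : ℤ}
    {L : (ℤ →₀ BoundAlgebra I) →ₗ[BoundAlgebra I] (ℤ →₀ BoundAlgebra I)}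
    (h : RaisesDegree I A B e L) (hA : A.IsHomotopyString I) (hB : B.IsHomotopyString I) :
    Cochain (A.basicStringComplex hA) (B.basicStringComplex hB) e :=
  Cochain.mk fun p q hpq => ModuleCat.ofHom (L.restrict (h p q hpq))

theorem RaisesDegree.δ_cochain {e e' : ℤ} (he : e + 1 = e')
    {L : (ℤ →₀ BoundAlgebra I) →ₗ[BoundAlgebra I] (ℤ →₀ BoundAlgebra I)}
    (h : RaisesDegree I A B e L)
    {L' : (ℤ →₀ BoundAlgebra I) →ₗ[BoundAlgebra I] (ℤ →₀ BoundAlgebra I)}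
    (h' : RaisesDegree I A B e' L')
    (hL : ∀ f, L' f = B.differential I (L f) + e'.negOnePow • L (A.differential I f)) :
    δ e e' (h.cochain hA hB) = h'.cochain hA hB := by
  refine Cochain.ext _ _ fun p q hpq => ?_
  rw [δ_v e e' he _ p q hpq (q - 1) (p + 1) rfl rfl]
  have h1 : (B.basicStringComplex hB).d (q - 1) q = ModuleCat.ofHom
      ((B.differential I).restrict (differential_mem hB (show q - 1 + 1 = q by ring))) :=
    dif_pos (show q - 1 + 1 = q by ring)
  have h2 : (A.basicStringComplex hA).d p (p + 1) = ModuleCat.ofHom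
      ((A.differential I).restrict (differential_mem hA rfl)) := dif_pos rfl
  rw [h1, h2]
  rcases Int.units_eq_one_or e'.negOnePow with hs | hs
  · simp only [hs, one_smul] at hL ⊢
    refine ModuleCat.hom_ext (LinearMap.ext fun f => ?_)
    exact Subtype.ext (hL f.1).symm
  · simp only [hs, Units.neg_smul, one_smul] at hL ⊢
    refine ModuleCat.hom_ext (LinearMap.ext fun f => ?_)
    exact Subtype.ext (hL f.1).symm

end GradedWalk

end Cochains

/-! ### The mapping cone of a double map -/

section DoubleMapCone

open PathAlgebra CochainComplex.HomComplex

variable {k : Type u} [Field k] {Q : Type u} [Quiver.{u} Q] [Fintype Q]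
variable {I : TwoSidedIdeal (PathAlgebra k Q)}

theorem mul_cls_mem_proj_of_isPath {l : List (Quiver.Total Q)} {x y : Q} (h : IsPath l x y)
    {v : BoundAlgebra I} (hv : v ∈ proj I y) : v * cls I l ∈ proj I x := by
  by_cases hl : l = []
  · subst hl
    have h' : x = y := h
    subst h'
    simpa [cls, word] using hv
  · rw [← vertex_mul_arrow_aux I h hl, ← mul_assoc]
    exact Ideal.mul_mem_left _ _ (Ideal.subset_span rfl)

theorem mul_intCast_mem_proj {x : Q} {v : BoundAlgebra I} (hv : v ∈ proj I x) (n : ℤ) :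
    v * (n : BoundAlgebra I) ∈ proj I x := by
  rw [← (Int.cast_commute n v).eq]
  exact Ideal.mul_mem_left _ _ hv

namespace GradedWalk

variable {A B : GradedWalk Q} {a b : ℤ} {c : ℕ → BoundAlgebra I}

theorem IsHalfMap.coeff_of_nonpos (h : IsHalfMap I A B a b c) {l : ℤ} (hl : l ≤ 0) :
    IsCoeff I A B (a + l) (b + l) (A.deg a) (B.deg b) (c (-l).toNat) := by
  have := h.coeff (-l).toNat
  rwa [Int.toNat_of_nonneg (by omega), sub_neg_eq_add, sub_neg_eq_add] at this

theorem IsHalfMap.down_of_nonpos (h : IsHalfMap I A B a b c) {l : ℤ} (hl : l ≤ 0) :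
    B.down I (b + l) * c (-(l - 1)).toNat = c (-l).toNat * A.down I (a + l) := by
  have := h.down (-l).toNat
  rwa [Int.toNat_of_nonneg (by omega), sub_neg_eq_add, sub_neg_eq_add,
    show (-l).toNat + 1 = (-(l - 1)).toNat by omega] at this

theorem IsHalfMap.up_of_nonpos (h : IsHalfMap I A B a b c) {l : ℤ} (hl : l ≤ 0) :
    B.up I (b + l) * c (-l).toNat = c (-(l - 1)).toNat * A.up I (a + l) := by
  have := h.up (-l).toNat
  rwa [Int.toNat_of_nonneg (by omega), sub_neg_eq_add, sub_neg_eq_add,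
    show (-l).toNat + 1 = (-(l - 1)).toNat by omega] at this

theorem IsCoeff.mul_mem {e e' : ℤ} {q : BoundAlgebra I} (h : IsCoeff I A B a b e e' q)
    {v : BoundAlgebra I} (hv : v ∈ proj I (B.vertex b)) : v * q ∈ proj I (A.vertex a) := by
  rcases h with rfl | ⟨-, -, -, l, rfl, hl⟩
  · rw [mul_zero]
    exact zero_mem _
  · exact mul_cls_mem_proj_of_isPath hl hv

theorem down_inv (σ : GradedWalk Q) (l : ℤ) : σ.inv.down I l = σ.up I (1 - l) := by
  rcases (σ.letter (1 - l)).isDirect_or_isInverse with hd | hd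
  · rw [down_eq_zero fun _ => Letter.isInverse_inv.2 hd, up_eq_zero fun _ => hd]
  · by_cases h : σ.HasLetter (1 - l)
    · rw [down_eq (hasLetter_inv.2 h) (Letter.isDirect_inv.2 hd), up_eq h hd]
      exact congrArg _ Letter.path_inv
    · rw [down_eq_zero fun h' => absurd (hasLetter_inv.1 h') h, up_eq_zero fun h' => absurd h' h]

theorem up_inv (σ : GradedWalk Q) (l : ℤ) : σ.inv.up I l = σ.down I (1 - l) := by
  rcases (σ.letter (1 - l)).isDirect_or_isInverse with hd | hd
  · by_cases h : σ.HasLetter (1 - l)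
    · rw [up_eq (hasLetter_inv.2 h) (Letter.isInverse_inv.2 hd), down_eq h hd]
      exact congrArg _ Letter.path_inv
    · rw [up_eq_zero fun h' => absurd (hasLetter_inv.1 h') h, down_eq_zero fun h' => absurd h' h]
  · rw [up_eq_zero fun _ => Letter.isDirect_inv.2 hd, down_eq_zero fun _ => hd]

section Splice

variable {σ τ : GradedWalk Q} {l : ℤ} {ℓ : Letter Q}

theorem down_splice_of_pos (hl : 2 ≤ l) :
    (σ.splice a ℓ τ b).down I l = σ.down I (a + (l - 1)) :=
  down_congr (hasLetter_splice_of_pos hl) (splice_letter_of_pos hl)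

theorem up_splice_of_pos (hl : 2 ≤ l) :
    (σ.splice a ℓ τ b).up I l = σ.up I (a + (l - 1)) :=
  up_congr (hasLetter_splice_of_pos hl) (splice_letter_of_pos hl)

theorem down_splice_of_nonpos (hl : l ≤ 0) :
    (σ.splice a ℓ τ b).down I l = τ.down I (b + l) :=
  down_congr (hasLetter_splice_of_nonpos hl) (splice_letter_of_nonpos hl)

theorem up_splice_of_nonpos (hl : l ≤ 0) :
    (σ.splice a ℓ τ b).up I l = τ.up I (b + l) :=
  up_congr (hasLetter_splice_of_nonpos hl) (splice_letter_of_nonpos hl)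

end Splice

/-- Differentials of string complexes only join neighbouring positions, so anticommutation is a
condition on the two coefficients at each letter. -/
theorem differential_weightedMap (A B : GradedWalk Q) {p : ℤ → ℤ} {w : ℤ → BoundAlgebra I}
    (hp : ∀ l, p (l - 1) = p l - 1) (hd : ∀ l, w l * B.down I (p l) = -(A.down I l * w (l - 1)))
    (hu : ∀ l, w (l - 1) * B.up I (p l) = -(A.up I l * w l)) (f : ℤ →₀ BoundAlgebra I) :
    B.differential I (weightedMap I p w f) + weightedMap I p w (A.differential I f) = 0 := by
  induction f using Finsupp.induction_linear with
  | zero => simp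
  | add f g hf hg =>
    simp only [map_add]
    rw [add_add_add_comm, hf, hg, add_zero]
  | single l u =>
    have hu' := hu (l + 1)
    have hp' := hp (l + 1)
    rw [add_sub_cancel_right] at hu' hp'
    rw [weightedMap_single, differential_single_eq, differential_single_eq, map_add,
      weightedMap_single, weightedMap_single, hp, add_add_add_comm, ← Finsupp.single_add,
      show p (l + 1) = p l + 1 by omega, ← Finsupp.single_add, mul_assoc, hd, mul_assoc,
      mul_assoc, mul_assoc, show p l + 1 = p (l + 1) by omega, hu']
    simp

end GradedWalk

section

variable (I)

/-- With x_{i-1+l} placed opposite y_{j-l}, both components of the double map land at neighbours of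
`j - l`, exactly where the differential of y_{j-l} lands. Coefficients can then be compared. -/
theorem twoComponents_single (i j l : ℤ) (fL fR : List (Quiver.Total Q)) (v : BoundAlgebra I) :
    twoComponents I i j fL fR (Finsupp.single (i - 1 + l) v) =
      Finsupp.single (j - l + 1) (v * if l = 1 then cls I fL else 0) +
      Finsupp.single (j - l - 1) (v * if l = 0 then cls I fR else 0) := by
  by_cases h1 : l = 1
  · subst h1
    rw [sub_add_cancel, twoComponents_left]
    simp
  · by_cases h0 : l = 0
    · subst h0
      rw [add_zero, twoComponents_right]
      simp
    · rw [twoComponents_other I i j fL fR v (by omega) (by omega)]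
      simp [h0, h1]

end

/-- The map `l ↦ j - l` reverses the walk, so maps down in `A` are matched with maps up in `τ`. The
double map contributes only at the letter `l = 1`. -/
theorem differential_reflect (A τ : GradedWalk Q) {i j : ℤ} {fL fR : List (Quiver.Total Q)}
    {w w' : ℤ → BoundAlgebra I}
    (hd : ∀ l, w l * τ.up I (j - l + 1) + (w' l * if l = 1 then cls I fL else 0) =
      A.down I l * w (l - 1))
    (hu : ∀ l, w (l - 1) * τ.down I (j - l + 1) + (w' (l - 1) * if l = 1 then cls I fR else 0) =
      A.up I l * w l) (f : ℤ →₀ BoundAlgebra I) :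
    τ.differential I (weightedMap I (fun l => j - l) w f) +
      twoComponents I i j fL fR (weightedMap I (fun l => i - 1 + l) w' f) =
      weightedMap I (fun l => j - l) w (A.differential I f) := by
  induction f using Finsupp.induction_linear with
  | zero => simp
  | add f g hf hg =>
    simp only [map_add]
    rw [add_add_add_comm, hf, hg]
  | single l u =>
    have hu' := hu (l + 1)
    rw [add_sub_cancel_right, show j - (l + 1) + 1 = j - l by ring] at hu'
    simp only [add_eq_right] at hu'
    rw [weightedMap_single, weightedMap_single, GradedWalk.differential_single_eq,
      GradedWalk.differential_single_eq, map_add, weightedMap_single, weightedMap_single,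
      twoComponents_single, add_comm (Finsupp.single (j - l - 1) _), add_add_add_comm,
      ← Finsupp.single_add, ← Finsupp.single_add, mul_assoc, mul_assoc, mul_assoc, mul_assoc,
      mul_assoc, mul_assoc, ← mul_add, ← mul_add, hd, hu', show j - (l - 1) = j - l + 1 by ring,
      show j - (l + 1) = j - l - 1 by ring]

/-- In the coordinate m = i - 1 + l, the target position i + j - 1 - m is again j - l. -/
theorem differential_homotopy (σ τ : GradedWalk Q) {i j : ℤ} {fL fR : List (Quiver.Total Q)}
    {w : ℤ → BoundAlgebra I}
    (hd : ∀ l, w (i - 1 + l) * τ.up I (j - l + 1) + σ.down I (i - 1 + l) * w (i - 1 + (l - 1)) =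
      if l = 1 then cls I fL else 0)
    (hu : ∀ l, w (i - 1 + (l - 1)) * τ.down I (j - l + 1) + σ.up I (i - 1 + l) * w (i - 1 + l) =
      if l = 1 then cls I fR else 0) (f : ℤ →₀ BoundAlgebra I) :
    τ.differential I (weightedMap I (fun m => i + j - 1 - m) w f) +
      weightedMap I (fun m => i + j - 1 - m) w (σ.differential I f) =
      twoComponents I i j fL fR f := by
  induction f using Finsupp.induction_linear with
  | zero => simp
  | add f g hf hg =>
    simp only [map_add]
    rw [add_add_add_comm, hf, hg]
  | single m u =>
    obtain ⟨l, rfl⟩ : ∃ l, m = i - 1 + l := ⟨m - (i - 1), by ring⟩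
    have hu' := hu (l + 1)
    rw [add_sub_cancel_right, show j - (l + 1) + 1 = j - l by ring] at hu'
    simp only [add_eq_right] at hu'
    have hd' := hd l
    rw [weightedMap_single, GradedWalk.differential_single_eq,
      GradedWalk.differential_single_eq, map_add, weightedMap_single, weightedMap_single,
      twoComponents_single, show i + j - 1 - (i - 1 + l) = j - l by ring,
      show i - 1 + l - 1 = i - 1 + (l - 1) by ring, show i - 1 + l + 1 = i - 1 + (l + 1) by ring,
      show i + j - 1 - (i - 1 + (l - 1)) = j - l + 1 by ring,
      show i + j - 1 - (i - 1 + (l + 1)) = j - l - 1 by ring,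
      add_comm (Finsupp.single (j - l - 1) _), add_add_add_comm,
      ← Finsupp.single_add, ← Finsupp.single_add, mul_assoc, mul_assoc, mul_assoc, mul_assoc,
      ← mul_add, ← mul_add, hd', hu']

/-! #### The walks `c₁` and `c₂` -/

section Cone

open GradedWalk

variable {σ τ : GradedWalk Q} {i j l : ℤ} {fL fR : List (Quiver.Total Q)}

/-- Common coordinates: an integer `l` stands for x_{i-1+l} and for y_{j-l}. The word c₁ uses the
former for `l ≤ 0` and the latter for `l ≥ 1`; c₂ makes the complementary choice. -/
theorem cone₁_of_nonpos (hl : l ≤ 0) :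
    (l ∈ (cone₁ σ τ i j fR).pos ↔ i - 1 + l ∈ σ.pos) ∧
    (cone₁ σ τ i j fR).vertex l = σ.vertex (i - 1 + l) ∧
    (cone₁ σ τ i j fR).deg l = σ.deg (i - 1 + l) - 1 :=
  ⟨mem_splice_of_nonpos hl, splice_vertex_of_nonpos hl, splice_deg_of_nonpos hl⟩

theorem cone₁_of_pos (hl : 1 ≤ l) :
    (l ∈ (cone₁ σ τ i j fR).pos ↔ j - l ∈ τ.pos) ∧
    (cone₁ σ τ i j fR).vertex l = τ.vertex (j - l) ∧
    (cone₁ σ τ i j fR).deg l = τ.deg (j - l) := by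
  have e : -(-(j - 1) + (l - 1)) = j - l := by ring
  rw [← e]
  exact ⟨mem_splice_of_pos hl, splice_vertex_of_pos hl, splice_deg_of_pos hl⟩

theorem cone₂_of_pos (hl : 1 ≤ l) :
    (l ∈ (cone₂ σ τ i j fL).pos ↔ i - 1 + l ∈ σ.pos) ∧
    (cone₂ σ τ i j fL).vertex l = σ.vertex (i - 1 + l) ∧
    (cone₂ σ τ i j fL).deg l = σ.deg (i - 1 + l) - 1 := by
  have e : i + (l - 1) = i - 1 + l := by ring
  rw [← e]
  exact ⟨mem_splice_of_pos hl, splice_vertex_of_pos hl, splice_deg_of_pos hl⟩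

theorem cone₂_of_nonpos (hl : l ≤ 0) :
    (l ∈ (cone₂ σ τ i j fL).pos ↔ j - l ∈ τ.pos) ∧
    (cone₂ σ τ i j fL).vertex l = τ.vertex (j - l) ∧
    (cone₂ σ τ i j fL).deg l = τ.deg (j - l) := by
  have e : -(-j + l) = j - l := by ring
  rw [← e]
  exact ⟨mem_splice_of_nonpos hl, splice_vertex_of_nonpos hl, splice_deg_of_nonpos hl⟩

theorem cone₁_down_of_nonpos (hl : l ≤ 0) :
    (cone₁ σ τ i j fR).down I l = σ.down I (i - 1 + l) := down_splice_of_nonpos hl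

theorem cone₁_up_of_nonpos (hl : l ≤ 0) :
    (cone₁ σ τ i j fR).up I l = σ.up I (i - 1 + l) := up_splice_of_nonpos hl

theorem cone₁_down_of_pos (hl : 2 ≤ l) :
    (cone₁ σ τ i j fR).down I l = τ.up I (j - l + 1) := by
  refine (down_splice_of_pos hl).trans ?_
  rw [down_inv, show 1 - (-(j - 1) + (l - 1)) = j - l + 1 by ring]

theorem cone₁_up_of_pos (hl : 2 ≤ l) :
    (cone₁ σ τ i j fR).up I l = τ.down I (j - l + 1) := by
  refine (up_splice_of_pos hl).trans ?_
  rw [up_inv, show 1 - (-(j - 1) + (l - 1)) = j - l + 1 by ring]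

theorem cone₁_down_one : (cone₁ σ τ i j fR).down I 1 = 0 :=
  down_eq_zero fun _ => by
    rw [cone₁, splice_letter_one]
    trivial

theorem cone₁_up_one (hf : IsDoubleMap I σ τ i j fL fR) :
    (cone₁ σ τ i j fR).up I 1 = cls I fR := by
  have h : (cone₁ σ τ i j fR).HasLetter 1 :=
    hasLetter_splice_one.2 ⟨by simpa [GradedWalk.inv] using hf.letter_τ.2, hf.letter_σ.2⟩
  have e : (cone₁ σ τ i j fR).letter 1 = Letter.inverse fR := splice_letter_one
  rw [up_eq h (by rw [e]; trivial), e]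
  rfl

theorem cone₂_down_of_pos (hl : 2 ≤ l) :
    (cone₂ σ τ i j fL).down I l = σ.down I (i - 1 + l) := by
  refine (down_splice_of_pos hl).trans ?_
  rw [show i + (l - 1) = i - 1 + l by ring]
  rfl

theorem cone₂_up_of_pos (hl : 2 ≤ l) :
    (cone₂ σ τ i j fL).up I l = σ.up I (i - 1 + l) := by
  refine (up_splice_of_pos hl).trans ?_
  rw [show i + (l - 1) = i - 1 + l by ring]
  rfl

theorem cone₂_down_of_nonpos (hl : l ≤ 0) :
    (cone₂ σ τ i j fL).down I l = τ.up I (j - l + 1) := by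
  refine (down_splice_of_nonpos hl).trans ?_
  rw [down_inv, show 1 - (-j + l) = j - l + 1 by ring]

theorem cone₂_up_of_nonpos (hl : l ≤ 0) :
    (cone₂ σ τ i j fL).up I l = τ.down I (j - l + 1) := by
  refine (up_splice_of_nonpos hl).trans ?_
  rw [up_inv, show 1 - (-j + l) = j - l + 1 by ring]

theorem cone₂_up_one : (cone₂ σ τ i j fL).up I 1 = 0 :=
  up_eq_zero fun _ => by
    rw [cone₂, splice_letter_one]
    trivial

theorem cone₂_down_one (hf : IsDoubleMap I σ τ i j fL fR) :
    (cone₂ σ τ i j fL).down I 1 = cls I fL := by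
  have h : (cone₂ σ τ i j fL).HasLetter 1 :=
    hasLetter_splice_one.2 ⟨hf.letter_σ.1, by simpa [GradedWalk.inv] using hf.letter_τ.1⟩
  have e : (cone₂ σ τ i j fL).letter 1 = Letter.direct fL := splice_letter_one
  rw [down_eq h (by rw [e]; trivial), e]
  rfl

/-- The sign by which the generator of `P_σ` at `m` is multiplied, so that the differential of
`P_σ` changes its sign at all letters except for the one at `i`. -/
def coneSign (σ : GradedWalk Q) (i m : ℤ) : ℤ :=
  (if i ≤ m then σ.deg m - σ.deg i else σ.deg m - σ.deg (i - 1)).negOnePow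

theorem coneSign_self (σ : GradedWalk Q) (i : ℤ) : coneSign σ i i = 1 := by
  simp [coneSign]

theorem coneSign_sub_one (σ : GradedWalk Q) (i : ℤ) : coneSign σ i (i - 1) = 1 := by
  simp [coneSign]

theorem coneSign_mul_self (σ : GradedWalk Q) (i m : ℤ) :
    coneSign σ i m * coneSign σ i m = 1 :=
  Int.units_coe_mul_self _

/-- The cone carries -d on P_σ, while c₁ and c₂ carry d; alternating signs absorb the difference.
The letter σ_C is exempt because neither word contains it, so both of its ends can have sign 1, and
f_L and f_R enter without signs. -/
theorem coneSign_of_hasLetter (hσ : σ.IsHomotopyString I) {m : ℤ} (h : σ.HasLetter m)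
    (hm : m ≠ i) : coneSign σ i (m - 1) = - coneSign σ i m := by
  have key : ∀ x y : ℤ, (x = y + 1 ∨ y = x + 1) →
      ((x.negOnePow : ℤˣ) : ℤ) = -((y.negOnePow : ℤˣ) : ℤ) := by
    rintro x y (rfl | rfl) <;> simp [Int.negOnePow_succ]
  have hdeg : σ.deg (m - 1) = σ.deg m + 1 ∨ σ.deg m = σ.deg (m - 1) + 1 :=
    (σ.letter m).isDirect_or_isInverse.imp (hσ.deg_direct m h) (hσ.deg_inverse m h)
  -- As `m ≠ i`, the positions `m` and `m - 1` lie on the same side of σ_C and have the same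
  -- reference degree.
  refine key _ _ ?_
  split_ifs <;> omega

end Cone

end DoubleMapCone

/-! ### The change of basis in the mapping cone. -/

section ConeIso

open PathAlgebra GradedWalk CochainComplex.HomComplex

variable {k : Type u} [Field k] {Q : Type u} [Quiver.{u} Q] [Fintype Q]
variable {I : TwoSidedIdeal (PathAlgebra k Q)}
variable {σ τ : GradedWalk Q} {i j : ℤ} {fL fR g : List (Quiver.Total Q)}
variable {c : ℕ → BoundAlgebra I}

section Signs

variable (I)

/-- The sign `coneSign σ i m` as an element of `kQ/I`. -/
def coneSignCast (σ : GradedWalk Q) (i m : ℤ) : BoundAlgebra I := (coneSign σ i m : BoundAlgebra I)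

variable {I}

theorem coneSignCast_self : coneSignCast I σ i i = 1 := by
  simp [coneSignCast, coneSign_self]

theorem coneSignCast_sub_one : coneSignCast I σ i (i - 1) = 1 := by
  simp [coneSignCast, coneSign_sub_one]

theorem coneSignCast_mul_self (m : ℤ) : coneSignCast I σ i m * coneSignCast I σ i m = 1 := by
  rw [coneSignCast, ← Int.cast_mul, coneSign_mul_self, Int.cast_one]

theorem coneSignCast_down (hσ : σ.IsHomotopyString I) {m : ℤ} (hm : m ≠ i) :
    coneSignCast I σ i m * σ.down I m = -(σ.down I m * coneSignCast I σ i (m - 1)) := by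
  rcases σ.down_eq_zero_or (I := I) m with h | ⟨h, -⟩
  · rw [h, mul_zero, zero_mul, neg_zero]
  · rw [coneSignCast, coneSignCast, coneSign_of_hasLetter hσ h hm, Int.cast_neg, mul_neg, neg_neg,
      (Int.cast_commute _ _).eq]

theorem coneSignCast_up (hσ : σ.IsHomotopyString I) {m : ℤ} (hm : m ≠ i) :
    coneSignCast I σ i (m - 1) * σ.up I m = -(σ.up I m * coneSignCast I σ i m) := by
  rcases σ.up_eq_zero_or (I := I) m with h | ⟨h, -⟩
  · rw [h, mul_zero, zero_mul, neg_zero]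
  · rw [coneSignCast, coneSignCast, coneSign_of_hasLetter hσ h hm, Int.cast_neg, neg_mul,
      (Int.cast_commute _ _).eq]

theorem mul_coneSignCast_mem {x : Q} {v : BoundAlgebra I} (hv : v ∈ proj I x) (m : ℤ) :
    v * coneSignCast I σ i m ∈ proj I x := mul_intCast_mem_proj hv _

end Signs

theorem IsDoubleMap.down_σ (hf : IsDoubleMap I σ τ i j fL fR) :
    σ.down I i = cls I (σ.letter i).path := down_eq hf.letter_σ hf.direct_σ

theorem IsDoubleMap.up_σ (hf : IsDoubleMap I σ τ i j fL fR) : σ.up I i = 0 :=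
  up_eq_zero fun _ => hf.direct_σ

theorem IsDoubleMap.down_τ (hf : IsDoubleMap I σ τ i j fL fR) :
    τ.down I j = cls I (τ.letter j).path := down_eq hf.letter_τ hf.direct_τ

theorem IsDoubleMap.up_τ (hf : IsDoubleMap I σ τ i j fL fR) : τ.up I j = 0 :=
  up_eq_zero fun _ => hf.direct_τ

section Coefficients

variable {l : ℤ}

theorem GradedWalk.IsHalfMap.up_τ (hc : IsHalfMap I σ τ.inv (i - 1) (-j) c) (hl : l ≤ 0) :
    τ.up I (j - l + 1) * c (-(l - 1)).toNat = c (-l).toNat * σ.down I (i - 1 + l) := by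
  have h := hc.down_of_nonpos hl
  rwa [down_inv, show 1 - (-j + l) = j - l + 1 by ring] at h

theorem GradedWalk.IsHalfMap.down_τ (hc : IsHalfMap I σ τ.inv (i - 1) (-j) c) (hl : l ≤ 0) :
    τ.down I (j - l + 1) * c (-l).toNat = c (-(l - 1)).toNat * σ.up I (i - 1 + l) := by
  have h := hc.up_of_nonpos hl
  rwa [up_inv, show 1 - (-j + l) = j - l + 1 by ring] at h

theorem GradedWalk.IsHalfMap.τ_up (hc : IsHalfMap I τ.inv σ (-j) (i - 1) c) (hl : l ≤ 0) :
    σ.down I (i - 1 + l) * c (-(l - 1)).toNat = c (-l).toNat * τ.up I (j - l + 1) := by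
  have h := hc.down_of_nonpos hl
  rwa [down_inv, show 1 - (-j + l) = j - l + 1 by ring] at h

theorem GradedWalk.IsHalfMap.τ_down (hc : IsHalfMap I τ.inv σ (-j) (i - 1) c) (hl : l ≤ 0) :
    σ.up I (i - 1 + l) * c (-l).toNat = c (-(l - 1)).toNat * τ.down I (j - l + 1) := by
  have h := hc.up_of_nonpos hl
  rwa [up_inv, show 1 - (-j + l) = j - l + 1 by ring] at h

end Coefficients

/-! #### The maps between `P_{c₁} ⊕ P_{c₂}` and the mapping cone -/

section Maps

variable (I) (σ τ : GradedWalk Q) (i j : ℤ) (c : ℕ → BoundAlgebra I)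

/-- The weights of the component `P_{c₁} → P_σ`. -/
def weightS₁ (l : ℤ) : BoundAlgebra I := if l ≤ 0 then coneSignCast I σ i (i - 1 + l) else 0

/-- The weights of the component `P_{c₁} → P_τ`. -/
def weightT₁ (l : ℤ) : BoundAlgebra I := if l ≤ 0 then 0 else 1

/-- The weights of the component `P_{c₂} → P_σ`. -/
def weightS₂ (l : ℤ) : BoundAlgebra I :=
  if l ≤ 0 then -(c (-l).toNat * coneSignCast I σ i (i - 1 + l))
  else coneSignCast I σ i (i - 1 + l)

/-- The weights of the component `P_{c₂} → P_τ`. -/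
def weightT₂ (l : ℤ) : BoundAlgebra I := if l ≤ 0 then 1 else 0

/-- The weights of the component `P_σ → P_{c₁}`. -/
def weightA₁ (m : ℤ) : BoundAlgebra I := if m ≤ i - 1 then coneSignCast I σ i m else 0

/-- The weights of the component `P_σ → P_{c₂}`. -/
def weightA₂ (m : ℤ) : BoundAlgebra I := if m ≤ i - 1 then 0 else coneSignCast I σ i m

/-- The weights of the component `P_τ → P_{c₁}`. -/
def weightB₁ (m : ℤ) : BoundAlgebra I := if m ≤ j - 1 then 1 else c (-(j - m)).toNat

/-- The weights of the component `P_τ → P_{c₂}`. -/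
def weightB₂ (m : ℤ) : BoundAlgebra I := if m ≤ j - 1 then 0 else 1

variable {I σ τ i j c}

theorem raisesDegree_S₁ :
    RaisesDegree I (cone₁ σ τ i j fR) σ 1
      (weightedMap I (fun l => i - 1 + l) (weightS₁ I σ i)) := by
  refine raisesDegree_weightedMap fun l hw hl => ?_
  rw [weightS₁] at hw ⊢
  split_ifs at hw ⊢ with h0
  · obtain ⟨h1, h2, h3⟩ := cone₁_of_nonpos (σ := σ) (τ := τ) (i := i) (j := j) (fR := fR) h0
    exact ⟨h1.1 hl, by rw [h3]; ring, fun v hv => mul_coneSignCast_mem (h2 ▸ hv) _⟩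
  · exact absurd rfl hw

theorem raisesDegree_T₁ :
    RaisesDegree I (cone₁ σ τ i j fR) τ 0 (weightedMap I (fun l => j - l) (weightT₁ I)) := by
  refine raisesDegree_weightedMap fun l hw hl => ?_
  rw [weightT₁] at hw ⊢
  split_ifs at hw ⊢ with h0
  · exact absurd rfl hw
  · obtain ⟨h1, h2, h3⟩ := cone₁_of_pos (σ := σ) (τ := τ) (i := i) (j := j) (fR := fR)
      (show 1 ≤ l by omega)
    exact ⟨h1.1 hl, by rw [h3]; ring, fun v hv => by rw [mul_one]; exact h2 ▸ hv⟩

/-- x_{i-1} has degree one more than y_j, and a half map preserves degrees relative to these two;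
the correction terms therefore have the right degree in the cone. -/
theorem raisesDegree_S₂ (hσ : σ.IsHomotopyString I) (hf : IsDoubleMap I σ τ i j fL fR)
    (hc : IsHalfMap I σ τ.inv (i - 1) (-j) c) :
    RaisesDegree I (cone₂ σ τ i j fL) σ 1
      (weightedMap I (fun l => i - 1 + l) (weightS₂ I σ i c)) := by
  refine raisesDegree_weightedMap fun l hw hl => ?_
  rw [weightS₂] at hw ⊢
  split_ifs at hw ⊢ with h0
  · obtain ⟨h1, h2, h3⟩ := cone₂_of_nonpos (σ := σ) (τ := τ) (i := i) (j := j) (fL := fL) h0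
    have hcoeff := hc.coeff_of_nonpos h0
    have hdeg := hσ.deg_direct i hf.letter_σ hf.direct_σ
    have hdeg' := hf.deg_eq
    have hv : ∀ v ∈ proj I ((cone₂ σ τ i j fL).vertex l),
        v * c (-l).toNat ∈ proj I (σ.vertex (i - 1 + l)) := by
      intro v hv
      refine hcoeff.mul_mem ?_
      rw [h2] at hv
      simpa [GradedWalk.inv, sub_eq_add_neg, add_comm] using hv
    rcases hcoeff with h | ⟨h4, h5, h6, -⟩
    · exact absurd (by rw [h, zero_mul, neg_zero]) hw
    · refine ⟨h4, ?_, fun v hv' => ?_⟩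
      · simp only [GradedWalk.inv, neg_neg, show -(-j + l) = j - l by ring] at h6
        rw [h3]
        omega
      · rw [mul_neg, ← mul_assoc]
        exact neg_mem (mul_coneSignCast_mem (hv v hv') _)
  · obtain ⟨h1, h2, h3⟩ := cone₂_of_pos (σ := σ) (τ := τ) (i := i) (j := j) (fL := fL)
      (show 1 ≤ l by omega)
    exact ⟨h1.1 hl, by rw [h3]; ring, fun v hv => mul_coneSignCast_mem (h2 ▸ hv) _⟩

theorem raisesDegree_T₂ :
    RaisesDegree I (cone₂ σ τ i j fL) τ 0 (weightedMap I (fun l => j - l) (weightT₂ I)) := by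
  refine raisesDegree_weightedMap fun l hw hl => ?_
  rw [weightT₂] at hw ⊢
  split_ifs at hw ⊢ with h0
  · obtain ⟨h1, h2, h3⟩ := cone₂_of_nonpos (σ := σ) (τ := τ) (i := i) (j := j) (fL := fL) h0
    exact ⟨h1.1 hl, by rw [h3]; ring, fun v hv => by rw [mul_one]; exact h2 ▸ hv⟩
  · exact absurd rfl hw

theorem raisesDegree_A₁ :
    RaisesDegree I σ (cone₁ σ τ i j fR) (-1)
      (weightedMap I (fun m => m - (i - 1)) (weightA₁ I σ i)) := by
  refine raisesDegree_weightedMap fun m hw hm => ?_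
  rw [weightA₁] at hw ⊢
  split_ifs at hw ⊢ with h0
  · obtain ⟨h1, h2, h3⟩ := cone₁_of_nonpos (σ := σ) (τ := τ) (i := i) (j := j) (fR := fR)
      (show m - (i - 1) ≤ 0 by omega)
    rw [add_sub_cancel] at h1 h2 h3
    exact ⟨h1.2 hm, by rw [h3]; ring, fun v hv => mul_coneSignCast_mem (h2 ▸ hv) _⟩
  · exact absurd rfl hw

theorem raisesDegree_A₂ :
    RaisesDegree I σ (cone₂ σ τ i j fL) (-1)
      (weightedMap I (fun m => m - (i - 1)) (weightA₂ I σ i)) := by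
  refine raisesDegree_weightedMap fun m hw hm => ?_
  rw [weightA₂] at hw ⊢
  split_ifs at hw ⊢ with h0
  · exact absurd rfl hw
  · obtain ⟨h1, h2, h3⟩ := cone₂_of_pos (σ := σ) (τ := τ) (i := i) (j := j) (fL := fL)
      (show 1 ≤ m - (i - 1) by omega)
    rw [add_sub_cancel] at h1 h2 h3
    exact ⟨h1.2 hm, by rw [h3]; ring, fun v hv => mul_coneSignCast_mem (h2 ▸ hv) _⟩

theorem raisesDegree_B₁ (hσ : σ.IsHomotopyString I) (hf : IsDoubleMap I σ τ i j fL fR)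
    (hc : IsHalfMap I σ τ.inv (i - 1) (-j) c) :
    RaisesDegree I τ (cone₁ σ τ i j fR) 0
      (weightedMap I (fun m => j - m) (weightB₁ I j c)) := by
  refine raisesDegree_weightedMap fun m hw hm => ?_
  rw [weightB₁] at hw ⊢
  split_ifs at hw ⊢ with h0
  · obtain ⟨h1, h2, h3⟩ := cone₁_of_pos (σ := σ) (τ := τ) (i := i) (j := j) (fR := fR)
      (show 1 ≤ j - m by omega)
    rw [sub_sub_cancel] at h1 h2 h3
    exact ⟨h1.2 hm, by rw [h3]; ring, fun v hv => by rw [mul_one]; exact h2 ▸ hv⟩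
  · have hl : j - m ≤ 0 := by omega
    obtain ⟨h1, h2, h3⟩ := cone₁_of_nonpos (σ := σ) (τ := τ) (i := i) (j := j) (fR := fR) hl
    have hcoeff := hc.coeff_of_nonpos hl
    have hdeg := hσ.deg_direct i hf.letter_σ hf.direct_σ
    have hdeg' := hf.deg_eq
    have hv : ∀ v ∈ proj I (τ.vertex m),
        v * c (-(j - m)).toNat ∈ proj I ((cone₁ σ τ i j fR).vertex (j - m)) := by
      intro v hv
      rw [h2]
      refine hcoeff.mul_mem ?_
      simpa [GradedWalk.inv] using hv
    rcases hcoeff with h | ⟨h4, h5, h6, -⟩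
    · exact absurd h hw
    · refine ⟨h1.2 h4, ?_, hv⟩
      simp only [GradedWalk.inv, neg_neg, show -(-j + (j - m)) = m by ring] at h6
      rw [h3]
      omega

theorem raisesDegree_B₂ :
    RaisesDegree I τ (cone₂ σ τ i j fL) 0
      (weightedMap I (fun m => j - m) (weightB₂ I j)) := by
  refine raisesDegree_weightedMap fun m hw hm => ?_
  rw [weightB₂] at hw ⊢
  split_ifs at hw ⊢ with h0
  · exact absurd rfl hw
  · obtain ⟨h1, h2, h3⟩ := cone₂_of_nonpos (σ := σ) (τ := τ) (i := i) (j := j) (fL := fL)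
      (show j - m ≤ 0 by omega)
    rw [sub_sub_cancel] at h1 h2 h3
    exact ⟨h1.2 hm, by rw [h3]; ring, fun v hv => by rw [mul_one]; exact h2 ▸ hv⟩

/-- At the new letter nothing is missing on the side of `σ`: σ_C is direct, so x_{i-1} has no
component towards x_i. -/
theorem differential_S₁ (hσ : σ.IsHomotopyString I) (hf : IsDoubleMap I σ τ i j fL fR)
    (f : ℤ →₀ BoundAlgebra I) :
    σ.differential I (weightedMap I (fun l => i - 1 + l) (weightS₁ I σ i) f) +
      weightedMap I (fun l => i - 1 + l) (weightS₁ I σ i)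
        ((cone₁ σ τ i j fR).differential I f) = 0 := by
  refine differential_weightedMap _ _ (fun l => by ring) (fun l => ?_) (fun l => ?_) f
  · rcases lt_trichotomy l 1 with h | rfl | h
    · rw [weightS₁, weightS₁, if_pos (by omega), if_pos (by omega),
        cone₁_down_of_nonpos (by omega), coneSignCast_down hσ (by omega), add_sub_assoc]
    · simp [weightS₁, cone₁_down_one]
    · simp [weightS₁, show ¬ l ≤ 0 by omega, show ¬ l ≤ 1 by omega]
  · rcases lt_trichotomy l 1 with h | rfl | h
    · rw [weightS₁, weightS₁, if_pos (by omega), if_pos (by omega),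
        cone₁_up_of_nonpos (by omega), ← coneSignCast_up hσ (by omega), add_sub_assoc]
    · simp [weightS₁, hf.up_σ]
    · simp [weightS₁, show ¬ l ≤ 0 by omega, show ¬ l ≤ 1 by omega]

/-- At `l = 1` the identity σ_C = f_L g cancels the image of x_i under σ_C against the correction -g
x_{i-1}. For `l ≤ 0` the corrections are compatible by the squares of the half map. -/
theorem differential_S₂ (hσ : σ.IsHomotopyString I) (hf : IsDoubleMap I σ τ i j fL fR)
    (hc : IsHalfMap I σ τ.inv (i - 1) (-j) c) (hg : (σ.letter i).path = fL ++ g)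
    (hc0 : c 0 = cls I g) (f : ℤ →₀ BoundAlgebra I) :
    σ.differential I (weightedMap I (fun l => i - 1 + l) (weightS₂ I σ i c) f) +
      weightedMap I (fun l => i - 1 + l) (weightS₂ I σ i c)
        ((cone₂ σ τ i j fL).differential I f) = 0 := by
  refine differential_weightedMap _ _ (fun l => by ring) (fun l => ?_) (fun l => ?_) f
  · rcases lt_trichotomy l 1 with h | rfl | h
    · rw [weightS₂, weightS₂, if_pos (by omega), if_pos (by omega),
        cone₂_down_of_nonpos (by omega), neg_mul, mul_assoc, coneSignCast_down hσ (by omega),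
        mul_neg, mul_neg, ← mul_assoc, ← mul_assoc, hc.up_τ (by omega), add_sub_assoc]
    · rw [weightS₂, weightS₂, if_neg (by omega), if_pos (by omega), cone₂_down_one hf,
        sub_add_cancel, coneSignCast_self, hf.down_σ, hg, cls_append]
      simp [hc0, coneSignCast_sub_one]
    · rw [weightS₂, weightS₂, if_neg (by omega), if_neg (by omega),
        cone₂_down_of_pos (by omega), coneSignCast_down hσ (by omega), add_sub_assoc]
  · rcases lt_trichotomy l 1 with h | rfl | h
    · rw [weightS₂, weightS₂, if_pos (by omega), if_pos (by omega),
        cone₂_up_of_nonpos (by omega), neg_mul, mul_assoc, ← add_sub_assoc,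
        coneSignCast_up hσ (by omega), mul_neg, mul_neg, neg_neg, neg_neg, ← mul_assoc,
        ← mul_assoc, hc.down_τ (by omega)]
    · simp [cone₂_up_one, hf.up_σ]
    · rw [weightS₂, weightS₂, if_neg (by omega), if_neg (by omega),
        cone₂_up_of_pos (by omega), ← coneSignCast_up hσ (by omega), add_sub_assoc]

theorem differential_T₁ (hf : IsDoubleMap I σ τ i j fL fR) (f : ℤ →₀ BoundAlgebra I) :
    τ.differential I (weightedMap I (fun l => j - l) (weightT₁ I) f) +
      twoComponents I i j fL fR (weightedMap I (fun l => i - 1 + l) (weightS₁ I σ i) f) =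
      weightedMap I (fun l => j - l) (weightT₁ I) ((cone₁ σ τ i j fR).differential I f) := by
  refine differential_reflect _ _ (fun l => ?_) (fun l => ?_) f
  · rcases lt_trichotomy l 1 with h | rfl | h
    · simp [weightT₁, show l ≤ 0 by omega, show l ≤ 1 by omega, h.ne]
    · simp [weightT₁, weightS₁, hf.up_τ]
    · rw [weightT₁, weightT₁, if_neg (by omega), if_neg (by omega), if_neg (by omega),
        cone₁_down_of_pos (by omega), one_mul, mul_zero, add_zero, mul_one]
  · rcases lt_trichotomy l 1 with h | rfl | h
    · simp [weightT₁, show l ≤ 0 by omega, show l ≤ 1 by omega, h.ne]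
    · simp [weightT₁, weightS₁, cone₁_up_one hf, coneSignCast_sub_one]
    · rw [weightT₁, weightT₁, if_neg (by omega), if_neg (by omega), if_neg (by omega),
        cone₁_up_of_pos (by omega), one_mul, mul_zero, add_zero, mul_one]

/-- At `l = 1` the identity τ_C = g f_R cancels the image of y_j under τ_C against that of -g
x_{i-1} under f_R, so that nothing reaches y_{j-1}. -/
theorem differential_T₂ (hf : IsDoubleMap I σ τ i j fL fR)
    (hg : (τ.letter j).path = g ++ fR) (hc0 : c 0 = cls I g) (f : ℤ →₀ BoundAlgebra I) :
    τ.differential I (weightedMap I (fun l => j - l) (weightT₂ I) f) +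
      twoComponents I i j fL fR (weightedMap I (fun l => i - 1 + l) (weightS₂ I σ i c) f) =
      weightedMap I (fun l => j - l) (weightT₂ I) ((cone₂ σ τ i j fL).differential I f) := by
  refine differential_reflect _ _ (fun l => ?_) (fun l => ?_) f
  · rcases lt_trichotomy l 1 with h | rfl | h
    · rw [weightT₂, weightT₂, if_neg (show ¬ l = 1 by omega), if_pos (by omega), if_pos (by omega),
        cone₂_down_of_nonpos (by omega), one_mul, mul_zero, add_zero, mul_one]
    · simp [weightT₂, weightS₂, cone₂_down_one hf, coneSignCast_self]
    · simp [weightT₂, show ¬ l ≤ 0 by omega, show ¬ l ≤ 1 by omega, h.ne']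
  · rcases lt_trichotomy l 1 with h | rfl | h
    · rw [weightT₂, weightT₂, if_neg (show ¬ l = 1 by omega), if_pos (by omega), if_pos (by omega),
        cone₂_up_of_nonpos (by omega), one_mul, mul_zero, add_zero, mul_one]
    · simp [weightT₂, weightS₂, hf.down_τ, hg, cls_append, hc0, coneSignCast_sub_one]
    · simp [weightT₂, show ¬ l ≤ 0 by omega, show ¬ l ≤ 1 by omega, h.ne']

end Maps

end ConeIso

/-! ### The splitting of the cone over kQ/I. -/

section ConeIso

open PathAlgebra GradedWalk CochainComplex.HomComplex

variable {k : Type u} [Field k] {Q : Type u} [Quiver.{u} Q] [Fintype Q]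
variable {I : TwoSidedIdeal (PathAlgebra k Q)}

namespace GradedWalk

variable {A B C D : GradedWalk Q} {e : ℤ}
  {L L' M M' N : (ℤ →₀ BoundAlgebra I) →ₗ[BoundAlgebra I] (ℤ →₀ BoundAlgebra I)}

theorem raisesDegree_zero : RaisesDegree I A B e 0 := fun _ _ _ _ _ => zero_mem _

theorem RaisesDegree.δ_cochain_eq_zero (h : RaisesDegree I A B 1 L) (hA : A.IsHomotopyString I)
    (hB : B.IsHomotopyString I)
    (hL : ∀ f, B.differential I (L f) + L (A.differential I f) = 0) :
    δ 1 2 (h.cochain hA hB) = 0 := by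
  rw [h.δ_cochain (show (1 : ℤ) + 1 = 2 by norm_num) raisesDegree_zero fun f => ?_]
  · refine Cochain.ext _ _ fun p q hpq => ModuleCat.hom_ext (LinearMap.ext fun f => ?_)
    exact Subtype.ext rfl
  · rw [show (2 : ℤ).negOnePow = 1 from rfl, one_smul, hL]
    rfl

theorem RaisesDegree.v_comp_add_eq_id {e e' e₂ e₂' : ℤ} (hA : A.IsHomotopyString I)
    (hB : B.IsHomotopyString I) (hC : C.IsHomotopyString I) (hL : RaisesDegree I A B e L)
    (hM : RaisesDegree I B A e' M) (hL' : RaisesDegree I A C e₂ L')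
    (hM' : RaisesDegree I C A e₂' M') (h : ∀ f, M (L f) + M' (L' f) = f)
    (p q q' : ℤ) (h₁ : p + e = q) (h₂ : q + e' = p) (h₃ : p + e₂ = q') (h₄ : q' + e₂' = p) :
    (hL.cochain hA hB).v p q h₁ ≫ (hM.cochain hB hA).v q p h₂ +
      (hL'.cochain hA hC).v p q' h₃ ≫ (hM'.cochain hC hA).v q' p h₄ = 𝟙 _ :=
  ModuleCat.hom_ext (LinearMap.ext fun f => Subtype.ext (h f.1))

theorem RaisesDegree.v_comp_add_eq_zero {e e' e₂ e₂' : ℤ} (hA : A.IsHomotopyString I)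
    (hB : B.IsHomotopyString I) (hC : C.IsHomotopyString I) (hD : D.IsHomotopyString I)
    (hL : RaisesDegree I A B e L)
    (hM : RaisesDegree I B D e' M) (hL' : RaisesDegree I A C e₂ L')
    (hM' : RaisesDegree I C D e₂' M') (h : ∀ f, M (L f) + M' (L' f) = 0)
    (p q q' r : ℤ) (h₁ : p + e = q) (h₂ : q + e' = r) (h₃ : p + e₂ = q') (h₄ : q' + e₂' = r) :
    (hL.cochain hA hB).v p q h₁ ≫ (hM.cochain hB hD).v q r h₂ +
      (hL'.cochain hA hC).v p q' h₃ ≫ (hM'.cochain hC hD).v q' r h₄ = 0 :=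
  ModuleCat.hom_ext (LinearMap.ext fun f => Subtype.ext (h f.1))

end GradedWalk

theorem weightedMap_comp_add {p p' q q' r : ℤ → ℤ} {w w' v v' s : ℤ → BoundAlgebra I}
    (hp : ∀ l, p' (p l) = r l) (hq : ∀ l, q' (q l) = r l)
    (h : ∀ l, w l * w' (p l) + v l * v' (q l) = s l) (f : ℤ →₀ BoundAlgebra I) :
    weightedMap I p' w' (weightedMap I p w f) + weightedMap I q' v' (weightedMap I q v f) =
      weightedMap I r s f := by
  induction f using Finsupp.induction_linear with
  | zero => simp
  | add f g hf hg =>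
    simp only [map_add]
    rw [add_add_add_comm, hf, hg]
  | single l u =>
    simp only [weightedMap_single]
    rw [hp, hq, ← Finsupp.single_add, mul_assoc, mul_assoc, ← mul_add, h]

theorem weightedMap_comp_add_eq_self {p p' q q' : ℤ → ℤ} {w w' v v' : ℤ → BoundAlgebra I}
    (hp : ∀ l, p' (p l) = l) (hq : ∀ l, q' (q l) = l)
    (h : ∀ l, w l * w' (p l) + v l * v' (q l) = 1) (f : ℤ →₀ BoundAlgebra I) :
    weightedMap I p' w' (weightedMap I p w f) + weightedMap I q' v' (weightedMap I q v f) = f := by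
  rw [weightedMap_comp_add hp hq h]
  induction f using Finsupp.induction_linear with
  | zero => simp
  | add f g hf hg => rw [map_add, hf, hg]
  | single l u => simp

theorem weightedMap_comp_add_eq_zero {p p' q q' r : ℤ → ℤ} {w w' v v' : ℤ → BoundAlgebra I}
    (hp : ∀ l, p' (p l) = r l) (hq : ∀ l, q' (q l) = r l)
    (h : ∀ l, w l * w' (p l) + v l * v' (q l) = 0) (f : ℤ →₀ BoundAlgebra I) :
    weightedMap I p' w' (weightedMap I p w f) + weightedMap I q' v' (weightedMap I q v f) = 0 := by
  rw [weightedMap_comp_add hp hq h]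
  induction f using Finsupp.induction_linear with
  | zero => simp
  | add f g hf hg => rw [map_add, hf, hg, add_zero]
  | single l u => simp

variable {σ τ : GradedWalk Q} {i j : ℤ} {fL fR g : List (Quiver.Total Q)}
variable {c : ℕ → BoundAlgebra I}

theorem IsDoubleMap.δ_cochain_add (hσ : σ.IsHomotopyString I) (hτ : τ.IsHomotopyString I)
    (hf : IsDoubleMap I σ τ i j fL fR) {A : GradedWalk Q} (hA : A.IsHomotopyString I)
    {S T : (ℤ →₀ BoundAlgebra I) →ₗ[BoundAlgebra I] (ℤ →₀ BoundAlgebra I)}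
    (hS : RaisesDegree I A σ 1 S) (hT : RaisesDegree I A τ 0 T)
    (h : ∀ f, τ.differential I (T f) + twoComponents I i j fL fR (S f) =
      T (A.differential I f)) :
    δ 0 1 (hT.cochain hA hτ) + (hS.cochain hA hσ).comp
      (Cochain.ofHom (hf.basicMap hσ hτ)) (add_zero 1) = 0 := by
  have hL' : RaisesDegree I A τ 1 (-(twoComponents I i j fL fR ∘ₗ S)) :=
    fun p q hpq f hfm => neg_mem (hf.map_mem hσ hτ q _ (hS p q hpq f hfm))
  rw [hT.δ_cochain (zero_add 1) hL' fun f => ?_]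
  · refine Cochain.ext _ _ fun p q hpq => ?_
    rw [Cochain.add_v, Cochain.comp_zero_cochain_v, Cochain.ofHom_v]
    refine ModuleCat.hom_ext (LinearMap.ext fun f => Subtype.ext ?_)
    exact neg_add_cancel (twoComponents I i j fL fR (S f.1))
  · rw [show (1 : ℤ).negOnePow = -1 from rfl, Units.neg_smul, one_smul, ← h f]
    simp

/-- If the left part of `τ` maps to the right part of `σ` as in a half map, then the mapping cone
of the double map splits into the string complexes of `c₁` and `c₂`. -/
theorem IsDoubleMap.nonempty_biprod_iso_mappingCone (hσ : σ.IsHomotopyString I)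
    (hτ : τ.IsHomotopyString I) (hf : IsDoubleMap I σ τ i j fL fR)
    (hc : IsHalfMap I σ τ.inv (i - 1) (-j) c) (hgσ : (σ.letter i).path = fL ++ g)
    (hgτ : (τ.letter j).path = g ++ fR) (hc0 : c 0 = cls I g)
    (h₁ : (cone₁ σ τ i j fR).IsHomotopyString I) (h₂ : (cone₂ σ τ i j fL).IsHomotopyString I) :
    Nonempty ((cone₁ σ τ i j fR).basicStringComplex h₁ ⊞
      (cone₂ σ τ i j fL).basicStringComplex h₂ ≅
        CochainComplex.mappingCone (hf.basicMap hσ hτ)) := by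
  have hS₁ := raisesDegree_S₁ (I := I) (σ := σ) (τ := τ) (i := i) (j := j) (fR := fR)
  have hS₂ := raisesDegree_S₂ hσ hf hc
  have hT₁ := raisesDegree_T₁ (I := I) (σ := σ) (τ := τ) (i := i) (j := j) (fR := fR)
  have hT₂ := raisesDegree_T₂ (I := I) (σ := σ) (τ := τ) (i := i) (j := j) (fL := fL)
  have hA₁ := raisesDegree_A₁ (I := I) (σ := σ) (τ := τ) (i := i) (j := j) (fR := fR)
  have hA₂ := raisesDegree_A₂ (I := I) (σ := σ) (τ := τ) (i := i) (j := j) (fL := fL)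
  have hB₁ := raisesDegree_B₁ hσ hf hc
  have hB₂ := raisesDegree_B₂ (I := I) (σ := σ) (τ := τ) (i := i) (j := j) (fL := fL)
  refine GentleAlg.nonempty_biprod_iso_mappingCone (hf.basicMap hσ hτ)
    (Cocycle.mk (hS₁.cochain h₁ hσ) 2 rfl
      (hS₁.δ_cochain_eq_zero h₁ hσ (differential_S₁ hσ hf)))
    (hT₁.cochain h₁ hτ)
    (Cocycle.mk (hS₂.cochain h₂ hσ) 2 rfl
      (hS₂.δ_cochain_eq_zero h₂ hσ (differential_S₂ hσ hf hc hgσ hc0)))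
    (hT₂.cochain h₂ hτ)
    (hf.δ_cochain_add hσ hτ h₁ hS₁ hT₁ (differential_T₁ hf))
    (hf.δ_cochain_add hσ hτ h₂ hS₂ hT₂ (differential_T₂ hf hgτ hc0))
    (hA₁.cochain hσ h₁) (hB₁.cochain hτ h₁) (hA₂.cochain hσ h₂) (hB₂.cochain hτ h₂)
    (fun p q h => RaisesDegree.v_comp_add_eq_id h₁ hσ hτ hS₁ hA₁ hT₁ hB₁ ?_ p q p _ _ _ _)
    (fun p q h => RaisesDegree.v_comp_add_eq_zero h₁ hσ hτ h₂ hS₁ hA₂ hT₁ hB₂ ?_ p q p p _ _ _ _)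
    (fun p q h => RaisesDegree.v_comp_add_eq_zero h₂ hσ hτ h₁ hS₂ hA₁ hT₂ hB₁ ?_ p q p p _ _ _ _)
    (fun p q h => RaisesDegree.v_comp_add_eq_id h₂ hσ hτ hS₂ hA₂ hT₂ hB₂ ?_ p q p _ _ _ _)
    (fun p q h => RaisesDegree.v_comp_add_eq_id hσ h₁ h₂ hA₁ hS₁ hA₂ hS₂ ?_ q p p _ _ _ _)
    (fun p q h => RaisesDegree.v_comp_add_eq_zero hσ h₁ h₂ hτ hA₁ hT₁ hA₂ hT₂ ?_ q p p p _ _ _ _)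
    (fun p q h => RaisesDegree.v_comp_add_eq_zero hτ h₁ h₂ hσ hB₁ hS₁ hB₂ hS₂ ?_ p p p q _ _ _ _)
    (fun p => RaisesDegree.v_comp_add_eq_id hτ h₁ h₂ hB₁ hT₁ hB₂ hT₂ ?_ p p p _ _ _ _)
  · refine weightedMap_comp_add_eq_self (fun l => by ring) (fun l => by ring) fun l => ?_
    by_cases hl : l ≤ 0
    · simp [weightS₁, weightA₁, weightT₁, hl, show i - 1 + l < i by omega, coneSignCast_mul_self]
    · simp [weightS₁, weightT₁, weightB₁, hl, show j - l ≤ j - 1 by omega]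
  · refine weightedMap_comp_add_eq_zero (r := fun l => l) (fun l => by ring) (fun l => by ring)
      fun l => ?_
    by_cases hl : l ≤ 0
    · simp [weightA₂, weightT₁, hl, show i - 1 + l < i by omega]
    · simp [weightS₁, weightB₂, hl, show j - l ≤ j - 1 by omega]
  · refine weightedMap_comp_add_eq_zero (r := fun l => l) (fun l => by ring) (fun l => by ring)
      fun l => ?_
    by_cases hl : l ≤ 0
    -- The correction `-c` of the new generator cancels against the coefficient `c` of y in the
    -- inverse matrix, since the signs square to 1.
    · simp [weightS₂, weightA₁, weightT₂, weightB₁, hl, show i - 1 + l < i by omega, mul_assoc, coneSignCast_mul_self,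
        show ¬ j - l ≤ j - 1 by omega]
    · simp [weightA₁, weightT₂, hl, show ¬ i - 1 + l < i by omega]
  · refine weightedMap_comp_add_eq_self (fun l => by ring) (fun l => by ring) fun l => ?_
    by_cases hl : l ≤ 0
    · simp [weightA₂, weightT₂, weightB₂, hl, show i - 1 + l < i by omega, show ¬ j - l ≤ j - 1 by omega]
    · simp [weightS₂, weightA₂, weightT₂, hl, show ¬ i - 1 + l < i by omega, coneSignCast_mul_self]
  · refine weightedMap_comp_add_eq_self (fun l => by ring) (fun l => by ring) fun m => ?_
    by_cases hm : m ≤ i - 1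
    · simp [weightS₁, weightA₁, weightA₂, hm, coneSignCast_mul_self]
    · simp [weightS₂, weightA₁, weightA₂, hm, coneSignCast_mul_self]
  · refine weightedMap_comp_add_eq_zero (r := fun m => j - (m - (i - 1))) (fun l => by ring)
      (fun l => by ring) fun m => ?_
    by_cases hm : m ≤ i - 1
    · simp [weightT₁, weightA₂, hm]
    · simp [weightA₁, weightT₂, hm]
  · refine weightedMap_comp_add_eq_zero (r := fun m => i - 1 + (j - m)) (fun l => by ring)
      (fun l => by ring) fun m => ?_
    by_cases hm : m ≤ j - 1
    · simp [weightS₁, weightB₁, weightB₂, hm, show ¬ j ≤ m by omega]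
    -- The same cancellation of `c` against `-c`, now in the other composition.
    · simp [weightS₁, weightS₂, weightB₁, weightB₂, hm, show j ≤ m by omega]
  · refine weightedMap_comp_add_eq_self (fun l => by ring) (fun l => by ring) fun m => ?_
    by_cases hm : m ≤ j - 1
    · simp [weightT₁, weightB₁, weightB₂, hm, show ¬ j ≤ m by omega]
    · simp [weightT₁, weightT₂, weightB₁, weightB₂, hm, show j ≤ m by omega]

/-! #### Null-homotopic double maps -/

variable (I) in
/-- The weights of the homotopy given by a half map from the right part of `σ` to the left part of
`τ`. -/
def weightH (i : ℤ) (c : ℕ → BoundAlgebra I) (m : ℤ) : BoundAlgebra I :=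
  if m ≤ i - 1 then
    (((m - (i - 1)).negOnePow : ℤ) : BoundAlgebra I) * c (-(m - (i - 1))).toNat
  else 0

theorem raisesDegree_H (hσ : σ.IsHomotopyString I) (hf : IsDoubleMap I σ τ i j fL fR)
    (hc : IsHalfMap I τ.inv σ (-j) (i - 1) c) :
    RaisesDegree I σ τ (-1) (weightedMap I (fun m => i + j - 1 - m) (weightH I i c)) := by
  refine raisesDegree_weightedMap fun m hw hm => ?_
  rw [weightH] at hw ⊢
  split_ifs at hw ⊢ with h0
  · have hcoeff := hc.coeff_of_nonpos (show m - (i - 1) ≤ 0 by omega)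
    have hdeg := hσ.deg_direct i hf.letter_σ hf.direct_σ
    have hdeg' := hf.deg_eq
    rw [add_sub_cancel] at hcoeff
    have hv : ∀ v ∈ proj I (σ.vertex m),
        v * c (-(m - (i - 1))).toNat ∈ proj I (τ.vertex (i + j - 1 - m)) := by
      intro v hv
      have := hcoeff.mul_mem hv
      simpa only [GradedWalk.inv, show -(-j + (m - (i - 1))) = i + j - 1 - m by ring] using this
    rcases hcoeff with h | ⟨h1, h2, h3, -⟩
    · exact absurd (by rw [h, mul_zero]) hw
    · simp only [GradedWalk.inv, Set.mem_ofPred_eq, neg_neg,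
        show -(-j + (m - (i - 1))) = i + j - 1 - m by ring] at h1 h3
      refine ⟨h1, by omega, fun v hv' => ?_⟩
      rw [← mul_assoc, ← (Int.cast_commute _ v).eq, mul_assoc]
      exact Ideal.mul_mem_left _ _ (hv v hv')
  · exact absurd rfl hw

/-- To the right of σ_C the squares of the half map commute and the signs alternate with the
position, so all terms cancel. At `l = 1` only one end carries the homotopy, which leaves σ_C g =
f_L and g τ_C = f_R. -/
theorem differential_H (hf : IsDoubleMap I σ τ i j fL fR)
    (hc : IsHalfMap I τ.inv σ (-j) (i - 1) c) (hgσ : fL = (σ.letter i).path ++ g)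
    (hgτ : fR = g ++ (τ.letter j).path) (hc0 : c 0 = cls I g) (f : ℤ →₀ BoundAlgebra I) :
    τ.differential I (weightedMap I (fun m => i + j - 1 - m) (weightH I i c) f) +
      weightedMap I (fun m => i + j - 1 - m) (weightH I i c) (σ.differential I f) =
      twoComponents I i j fL fR f := by
  have hw : ∀ l, l ≤ 0 → weightH I i c (i - 1 + l) =
      ((l.negOnePow : ℤ) : BoundAlgebra I) * c (-l).toNat := fun l hl => by
    rw [weightH, if_pos (by omega), add_sub_cancel_left]
  have hw' : ∀ l, 0 < l → weightH I i c (i - 1 + l) = 0 := fun l hl => by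
    rw [weightH, if_neg (by omega)]
  have hs : ∀ l : ℤ, (((l - 1).negOnePow : ℤ) : BoundAlgebra I) = -((l.negOnePow : ℤ) : BoundAlgebra I) :=
    fun l => by simp [Int.negOnePow_sub]
  refine differential_homotopy _ _ (fun l => ?_) (fun l => ?_) f
  · rcases lt_trichotomy l 1 with h | rfl | h
    · rw [hw l (by omega), hw (l - 1) (by omega), hs, if_neg h.ne, ← mul_assoc, mul_neg,
        ← (Int.cast_commute _ _).eq, neg_mul, mul_assoc, mul_assoc, hc.τ_up (by omega),
        add_neg_cancel]
    · rw [hw' 1 (by omega), hw (1 - 1) (by omega), sub_add_cancel i, hf.down_σ, if_pos rfl, hgσ,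
        cls_append]
      simp [hc0]
    · rw [hw' l (by omega), hw' (l - 1) (by omega), if_neg h.ne']
      simp
  · rcases lt_trichotomy l 1 with h | rfl | h
    · rw [hw l (by omega), hw (l - 1) (by omega), hs, if_neg h.ne, ← mul_assoc,
        ← (Int.cast_commute _ (σ.up I (i - 1 + l))).eq, neg_mul, neg_mul, mul_assoc, mul_assoc,
        hc.τ_down (by omega), neg_add_cancel]
    · rw [hw' 1 (by omega), hw (1 - 1) (by omega), sub_add_cancel, hf.down_τ, if_pos rfl, hgτ,
        cls_append]
      simp [hc0]
    · rw [hw' l (by omega), hw' (l - 1) (by omega), if_neg h.ne']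
      simp

theorem IsDoubleMap.nonempty_homotopy_zero (hσ : σ.IsHomotopyString I)
    (hτ : τ.IsHomotopyString I) (hf : IsDoubleMap I σ τ i j fL fR)
    (hc : IsHalfMap I τ.inv σ (-j) (i - 1) c) (hgσ : fL = (σ.letter i).path ++ g)
    (hgτ : fR = g ++ (τ.letter j).path) (hc0 : c 0 = cls I g) :
    Nonempty (Homotopy (hf.basicMap hσ hτ) 0) := by
  have hH := raisesDegree_H hσ hf hc
  have hL' : RaisesDegree I σ τ 0 (twoComponents I i j fL fR) := by
    rintro p _ rfl f hfm
    rw [add_zero]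
    exact hf.map_mem hσ hτ p f hfm
  refine ⟨(Cochain.equivHomotopy _ _).symm ⟨hH.cochain hσ hτ, ?_⟩⟩
  rw [hH.δ_cochain (neg_add_cancel 1) hL' fun f => ?_, Cochain.ofHom_zero, add_zero]
  · refine Cochain.ext₀ _ _ fun p => ?_
    rw [Cochain.ofHom_v]
    rfl
  · rw [show (0 : ℤ).negOnePow = 1 from rfl, one_smul, differential_H hf hc hgσ hgτ hc0]

end ConeIso

end GentleAlg

end

/-! ### Transport along the Morita equivalence. -/

theorem mainTheorem3 {k : Type u} [Field k] [IsAlgClosed k]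
    {Q : Type u} [Quiver.{u} Q] [Fintype Q]
    (I : TwoSidedIdeal (GentleAlg.PathAlgebra k Q)) (hI : GentleAlg.IsGentle I)
    {A : Type u} [Ring A] [Algebra k A] (E : MoritaEquivalence k (GentleAlg.BoundAlgebra I) A)
    (σ τ : GentleAlg.GradedWalk Q) (hσ : σ.IsHomotopyString I) (hτ : τ.IsHomotopyString I)
    (i j : ℤ) (fL fR : List (Quiver.Total Q)) (hf : GentleAlg.IsDoubleMap I σ τ i j fL fR)
    (hne : (HomotopyCategory.quotient _ _).map (GentleAlg.doubleMap E hσ hτ hf) ≠ 0) :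
    ∃ (h₁ : (GentleAlg.cone₁ σ τ i j fR).IsHomotopyString I)
      (h₂ : (GentleAlg.cone₂ σ τ i j fL).IsHomotopyString I),
      Nonempty
        (GentleAlg.inHomotopyCategory
            (CochainComplex.mappingCone (GentleAlg.doubleMap E hσ hτ hf)) ≅
          GentleAlg.inHomotopyCategory
            (GentleAlg.stringComplex E (GentleAlg.cone₁ σ τ i j fR) h₁ ⊞
              GentleAlg.stringComplex E (GentleAlg.cone₂ σ τ i j fL) h₂)) := by
  have h₁ := hf.cone₁_isHomotopyString hI hσ hτ
  have h₂ := hf.cone₂_isHomotopyString hI hσ hτ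
  refine ⟨h₁, h₂, ?_⟩
  rcases hf.exists_isHalfMap hI hσ hτ with ⟨g, c, hgσ, hgτ, hc, hc0⟩ | ⟨g, c, hgσ, hgτ, hc, hc0⟩
  -- The isomorphism of complexes over kQ/I carries over because an additive functor preserves
  -- mapping cones and biproducts.
  · obtain ⟨e⟩ := hf.nonempty_biprod_iso_mappingCone hσ hτ hc hgσ hgτ hc0 h₁ h₂
    have : (GentleAlg.moritaFunctor E).Additive := by
      unfold GentleAlg.moritaFunctor
      infer_instance
    have := CategoryTheory.Limits.preservesBinaryBiproducts_of_preservesBiproducts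
      (GentleAlg.moritaFunctor E)
    refine ⟨(HomotopyCategory.quotient _ _).mapIso ?_⟩
    exact (CochainComplex.mappingCone.mapHomologicalComplexIso
        (hf.basicMap hσ hτ) E.eqv.functor).symm ≪≫
      (GentleAlg.moritaFunctor E).mapIso e.symm ≪≫ (GentleAlg.moritaFunctor E).mapBiprod _ _
  -- The null-homotopy carries over as well and contradicts `hne`.
  · obtain ⟨h⟩ := hf.nonempty_homotopy_zero hσ hτ hc hgσ hgτ hc0
    refine absurd ?_ hne
    have h' := HomotopyCategory.eq_of_homotopy _ _ (E.eqv.functor.mapHomotopy h)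
    refine Eq.trans h' ?_
    rw [Functor.map_zero, Functor.map_zero]
    rfl
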